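/- Let $[0,1]$ be the real unit interval with $a\oplus b=\min(a+b,1)$, $a\odot b=\max(a+b-1,0)$; operations and joins in $[0,1]^X$ are pointwise, and $\mathbf 0,\mathbf 1$ are the constant functions. - An *MV-topological space* is a set $X$ with a set $\mathcal O\subseteq[0,1]^X$ that contains $\mathbf 0,\mathbf 1$ and is closed under arbitrary joins and under $\oplus$, $\odot$ and $\wedge$. It is *compact* if, whenever $\Gamma\subseteq\mathcal O$ and $\bigvee\Gamma=\mathbf 1$, there are $n<\omega$ and $\alpha_1,\dots,\alpha_n\in\Gamma$ (repetitions allowed) with $\alpha_1\oplus\cdots\oplus\alpha_n=\mathbf 1$ (the empty sum being $\mathbf 0$). - A *fuzzy topological space in the sense of Lowen* is a set $X$ with a set $\Delta\subseteq[0,1]^X$ that contains all constant functions and is closed under arbitrary joins and binary meets. It is *fuzzy compact* if for every constant $c\in[0,1]$, every $B\subseteq\Delta$ with $\bigvee B\ge c$ and every $\varepsilon>0$ there is a finite $B'\subseteq B$ with $\bigvee B'\ge c-\varepsilon$. - The *product* of a family of topological spaces (respectively, Lowen fuzzy topological spaces, MV-topological spaces) $X_i$, $i\in I$, is the Cartesian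 product $\prod_{i\in I}X_i$ with the least topology (respectively, Lowen fuzzy topology, MV-topology) that contains all $\pi_i^{-1}(u)$ (respectively, all $\alpha\circ\pi_i$) for $i\in I$ and $u$ (respectively, $\alpha$) open in $X_i$, where $\pi_i$ is the projection. A topological space is *compact* if every open cover has a finite subcover (no separation is assumed). **Theorem.** The following statements are equivalent in ZF (that is, in every model of ZF they are all true or all false): (a) the Cartesian product of a non-empty family of non-empty sets is non-empty (the Axiom of Choice); (b) the product space of any family of compact topological spaces is compact; (c) the product space of any family of fuzzy compact fuzzy topological spaces in the sense of Lowen is fuzzy compact; (d) the product space of any family of compact MV-topological spaces is compact. -/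

import Mathlib

/-! Everything below is read inside a fixed structure `M` for the language of set theory.
Apart from the two axiom schemata of ZF, all quantifiers range over the elements of `M`, so
every predicate is the interpretation in `M` of a first-order formula in the single symbol `∈`;
nothing from the ambient theory (its numbers, its functions, its sets, its choice) enters. -/

namespace ZFTych

/-- The only symbol of the language of set theory: the binary relation "is an element of". -/
inductive SetRel : ℕ → Type
  | mem : SetRel 2

/-- The first-order language of set theory. -/
def setLang : FirstOrder.Language := ⟨fun _ => Empty, SetRel⟩

section Internal

variable {M : Type*} [setLang.Structure M]

/-- The membership relation of the structure `M`. -/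
def SetMem (x y : M) : Prop :=
  FirstOrder.Language.Structure.RelMap (L := setLang) SetRel.mem ![x, y]

local infix:50 " ∈ᴹ " => SetMem

/-! ### Basic set theory -/

/-- `a ⊆ b`. -/
def Incl (a b : M) : Prop := ∀ x, x ∈ᴹ a → x ∈ᴹ b

/-- `e = ∅`. -/
def IsEmp (e : M) : Prop := ∀ x, ¬ x ∈ᴹ e

/-- `c = {a, b}`. -/
def IsUPair (c a b : M) : Prop := ∀ x, x ∈ᴹ c ↔ x = a ∨ x = b

/-- `p = ⟨a, b⟩ = {{a}, {a, b}}`. -/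
def IsPair (p a b : M) : Prop := ∃ u v, IsUPair u a a ∧ IsUPair v a b ∧ IsUPair p u v

/-- `c = b ∪ {x}`. -/
def IsAdjoin (c b x : M) : Prop := ∀ y, y ∈ᴹ c ↔ y ∈ᴹ b ∨ y = x

/-- `u = ⋃ S`. -/
def IsUnion (u S : M) : Prop := ∀ x, x ∈ᴹ u ↔ ∃ y, y ∈ᴹ S ∧ x ∈ᴹ y

/-- `u = a ∩ b`. -/
def IsInter (u a b : M) : Prop := ∀ x, x ∈ᴹ u ↔ x ∈ᴹ a ∧ x ∈ᴹ b

/-- `w` contains `∅` and is closed under `n ↦ n ∪ {n}`. -/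
def IsInductive (w : M) : Prop :=
  (∃ e, IsEmp e ∧ e ∈ᴹ w) ∧ ∀ n, n ∈ᴹ w → ∃ s, IsAdjoin s n n ∧ s ∈ᴹ w

variable (M) in
/-- `M` is a model of Zermelo–Fraenkel set theory (without choice). The two schemata range over
all classes and class relations that are first-order definable with parameters from `M`. -/
structure IsZFModel : Prop where
  extensionality : ∀ a b : M, (∀ x, x ∈ᴹ a ↔ x ∈ᴹ b) → a = b
  foundation : ∀ a : M, (∃ x, x ∈ᴹ a) → ∃ x, x ∈ᴹ a ∧ ∀ y, y ∈ᴹ x → ¬ y ∈ᴹ a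
  pairing : ∀ a b : M, ∃ c, IsUPair c a b
  union : ∀ a : M, ∃ u, IsUnion u a
  powerset : ∀ a : M, ∃ p, ∀ x, x ∈ᴹ p ↔ Incl x a
  infinity : ∃ w : M, IsInductive w
  separation : ∀ S : Set M, Set.Definable₁ (Set.univ : Set M) setLang S →
    ∀ a : M, ∃ b, ∀ x, x ∈ᴹ b ↔ x ∈ᴹ a ∧ x ∈ S
  replacement : ∀ R : Set (M × M), Set.Definable₂ (Set.univ : Set M) setLang R →
    ∀ a : M, (∀ x, x ∈ᴹ a → ∃! y, (x, y) ∈ R) →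
      ∃ b, ∀ y, y ∈ᴹ b ↔ ∃ x, x ∈ᴹ a ∧ (x, y) ∈ R

/-- `f(x) = y`, i.e. `⟨x, y⟩ ∈ f`. -/
def App (f x y : M) : Prop := ∃ p, p ∈ᴹ f ∧ IsPair p x y

/-- `F` is a function with domain `I`, i.e. a family indexed by `I`. -/
def IsFam (F I : M) : Prop :=
  (∀ p, p ∈ᴹ F → ∃ i y, i ∈ᴹ I ∧ IsPair p i y) ∧ ∀ i, i ∈ᴹ I → ∃! y, App F i y

/-- `P` is the Cartesian product of the family `F` indexed by `I`. -/
def IsProduct (P I F : M) : Prop :=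
  ∀ s, s ∈ᴹ P ↔ IsFam s I ∧ ∀ i, i ∈ᴹ I → ∃ x A, App s i x ∧ App F i A ∧ x ∈ᴹ A

/-- `A` is finite: it can be obtained from `∅` by successively adjoining elements of `A`, that
is, it lies in every set that contains `∅` and is closed under such adjunctions. -/
def IsFin (A : M) : Prop :=
  ∀ K, (∀ e, IsEmp e → e ∈ᴹ K) →
    (∀ b x c, b ∈ᴹ K → x ∈ᴹ A → IsAdjoin c b x → c ∈ᴹ K) → A ∈ᴹ K

/-! ### Natural numbers and non-negative fractions -/

/-- `w = ω`, the least inductive set. -/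
def IsOmega (w : M) : Prop := ∀ n, n ∈ᴹ w ↔ ∀ v, IsInductive v → n ∈ᴹ v

/-- `n` is a natural number. -/
def IsNat (n : M) : Prop := ∃ w, IsOmega w ∧ n ∈ᴹ w

/-- `g(n) = k` for a function `g` on `ω` with `g(0) = z` and with `S (g i) (g (i + 1))` for all
`i`: recursion on the natural numbers. -/
def NatRec (z : M) (S : M → M → Prop) (n k : M) : Prop :=
  ∃ w g, IsOmega w ∧ IsFam g w ∧ (∀ e, IsEmp e → App g e z) ∧
    (∀ i j a b, i ∈ᴹ w → IsAdjoin j i i → App g i a → App g j b → S a b) ∧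
    n ∈ᴹ w ∧ App g n k

/-- `m + n = k`: `m + 0 = m` and `m + (n + 1) = (m + n) + 1`. -/
def NatAdd (m n k : M) : Prop := NatRec m (fun a b => IsAdjoin b a a) n k

/-- `m * n = k`: `m * 0 = 0` and `m * (n + 1) = m * n + m`. -/
def NatMul (m n k : M) : Prop := ∃ e, IsEmp e ∧ NatRec e (fun a b => NatAdd a m b) n k

/-- `f` is the fraction `p / q`, coded as `⟨p, q⟩` with natural numbers `p` and `q ≠ 0`. -/
def IsFrac (f p q : M) : Prop := IsNat p ∧ IsNat q ∧ ¬ IsEmp q ∧ IsPair f p q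

/-- `f ≤ g` for fractions: `p / q ≤ p' / q'` iff `p * q' ≤ p' * q`. -/
def FracLe (f g : M) : Prop :=
  ∃ p q p' q' s t, IsFrac f p q ∧ IsFrac g p' q' ∧ NatMul p q' s ∧ NatMul p' q t ∧
    (s ∈ᴹ t ∨ s = t)

/-- `f < g` for fractions. -/
def FracLt (f g : M) : Prop :=
  ∃ p q p' q' s t, IsFrac f p q ∧ IsFrac g p' q' ∧ NatMul p q' s ∧ NatMul p' q t ∧ s ∈ᴹ t

/-- `f + g = h` for fractions: `p / q + p' / q' = (p * q' + p' * q) / (q * q')`. -/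
def FracAdd (f g h : M) : Prop :=
  ∃ p q p' q' a b n d, IsFrac f p q ∧ IsFrac g p' q' ∧ NatMul p q' a ∧ NatMul p' q b ∧
    NatAdd a b n ∧ NatMul q q' d ∧ IsFrac h n d

/-- `f` is a fraction `n / n`, of value `1`. -/
def IsFracOne (f : M) : Prop := ∃ n, IsFrac f n n

/-- The fraction `f` is less than `1`. -/
def FracLtOne (f : M) : Prop := ∃ o, IsFracOne o ∧ FracLt f o

/-! ### The real unit interval, by Dedekind cuts

The real number `r ∈ [0, 1]` is the set of all fractions `f` with `0 ≤ f < r`. Hence `r ≤ s` is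
inclusion, suprema are unions and minima are intersections. -/

/-- `c` is a real number of the unit interval. -/
def IsCut (c : M) : Prop :=
  (∀ f, f ∈ᴹ c → FracLtOne f) ∧
  (∀ f g, f ∈ᴹ c → FracLe g f → g ∈ᴹ c) ∧
  (∀ f, f ∈ᴹ c → ∃ g, g ∈ᴹ c ∧ FracLt f g)

/-- `c = 1`. -/
def IsOne (c : M) : Prop := ∀ f, f ∈ᴹ c ↔ FracLtOne f

/-- `c = a ⊕ b = min (a + b) 1`. -/
def IsOplus (c a b : M) : Prop :=
  ∀ f, f ∈ᴹ c ↔ FracLtOne f ∧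
    (f ∈ᴹ a ∨ f ∈ᴹ b ∨ ∃ x y s, x ∈ᴹ a ∧ y ∈ᴹ b ∧ FracAdd x y s ∧ FracLe f s)

/-- `c = a ⊙ b = max (a + b - 1) 0`: `f < a + b - 1` iff `f + 1 ≤ x + y` for some `x < a` and
`y < b`. -/
def IsOdot (c a b : M) : Prop :=
  ∀ f, f ∈ᴹ c ↔ ∃ x y s o t, x ∈ᴹ a ∧ y ∈ᴹ b ∧ FracAdd x y s ∧ IsFracOne o ∧ FracAdd f o t ∧
    FracLe t s

/-- `c = max (a - b) 0`: `f < a - b` iff `f + g < a` for some fraction `g ≥ b`. -/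
def IsTruncSub (c a b : M) : Prop :=
  ∀ f, f ∈ᴹ c ↔ ∃ g s, ¬ g ∈ᴹ b ∧ FracAdd f g s ∧ s ∈ᴹ a

/-! ### Fuzzy sets -/

/-- `α ∈ [0, 1]^X`. -/
def IsFuzzy (α X : M) : Prop := IsFam α X ∧ ∀ x a, App α x a → IsCut a

/-- `α` is the fuzzy subset of `X` with constant value `c`. -/
def IsConst (α c X : M) : Prop := IsFuzzy α X ∧ ∀ x, x ∈ᴹ X → App α x c

/-- `γ` is the fuzzy subset of `X` obtained from `α` and `β` by applying pointwise the operation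
whose graph is `op`. -/
def IsPointwise (op : M → M → M → Prop) (γ α β X : M) : Prop :=
  IsFuzzy γ X ∧ ∀ x, x ∈ᴹ X → ∃ a b c, App α x a ∧ App β x b ∧ App γ x c ∧ op c a b

/-- `γ` is the join (pointwise supremum) `⋁ Γ` of the set `Γ` of fuzzy subsets of `X`. -/
def IsJoin (γ Γ X : M) : Prop :=
  IsFuzzy γ X ∧ ∀ x, x ∈ᴹ X →
    ∃ c, App γ x c ∧ ∀ f, f ∈ᴹ c ↔ ∃ α a, α ∈ᴹ Γ ∧ App α x a ∧ f ∈ᴹ a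

/-- The constant fuzzy subset of `X` with value `c` is below the pointwise supremum of `B`. -/
def ConstLeJoin (c B X : M) : Prop :=
  ∀ x, x ∈ᴹ X → ∀ f, f ∈ᴹ c → ∃ μ m, μ ∈ᴹ B ∧ App μ x m ∧ f ∈ᴹ m

/-- `γ = α ∘ π_i` for the projection `π_i` of the product `P` on its `i`-th factor. -/
def IsPullback (γ α i P : M) : Prop :=
  IsFuzzy γ P ∧ ∀ s, s ∈ᴹ P → ∃ x a, App s i x ∧ App α x a ∧ App γ s a

/-! ### Topological spaces -/

/-- `T` is a topology on `X`. -/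
def IsTopology (X T : M) : Prop :=
  (∀ u, u ∈ᴹ T → Incl u X) ∧
  (∀ e, IsEmp e → e ∈ᴹ T) ∧ X ∈ᴹ T ∧
  (∀ S u, Incl S T → IsUnion u S → u ∈ᴹ T) ∧
  (∀ a b u, a ∈ᴹ T → b ∈ᴹ T → IsInter u a b → u ∈ᴹ T)

/-- The set `S` of subsets of `X` covers `X`. -/
def Covers (S X : M) : Prop := ∀ x, x ∈ᴹ X → ∃ u, u ∈ᴹ S ∧ x ∈ᴹ u

/-- Every open cover of the space `(X, T)` contains a finite cover. -/
def IsCompactTop (X T : M) : Prop :=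
  ∀ S, Incl S T → Covers S X → ∃ S', Incl S' S ∧ IsFin S' ∧ Covers S' X

/-- `O` contains the preimages under the projections of all open sets of the factors. -/
def ContainsPreimages (O I T P : M) : Prop :=
  ∀ i Ti a u, i ∈ᴹ I → App T i Ti → a ∈ᴹ Ti →
    (∀ s, s ∈ᴹ u ↔ s ∈ᴹ P ∧ ∃ x, App s i x ∧ x ∈ᴹ a) → u ∈ᴹ O

/-- `O` is the product topology on the Cartesian product `P` of the spaces with topologies `T i`:
the least topology that contains the preimages of the open sets of the factors. -/
def IsProductTop (O I T P : M) : Prop :=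
  IsTopology P O ∧ ContainsPreimages O I T P ∧
    ∀ O', IsTopology P O' → ContainsPreimages O' I T P → Incl O O'

/-- `O` contains `α ∘ π_i` for all open fuzzy sets `α` of the factors. -/
def ContainsPullbacks (O I T P : M) : Prop :=
  ∀ i Ti α γ, i ∈ᴹ I → App T i Ti → α ∈ᴹ Ti → IsPullback γ α i P → γ ∈ᴹ O

/-! ### Fuzzy topological spaces in the sense of Lowen -/

/-- `D` is a fuzzy topology on `X` in the sense of Lowen: it contains all constants and is closed
under binary minima and arbitrary joins. -/
def IsLowenTop (X D : M) : Prop :=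
  (∀ α, α ∈ᴹ D → IsFuzzy α X) ∧
  (∀ c α, IsCut c → IsConst α c X → α ∈ᴹ D) ∧
  (∀ Γ γ, Incl Γ D → IsJoin γ Γ X → γ ∈ᴹ D) ∧
  (∀ α β γ, α ∈ᴹ D → β ∈ᴹ D → IsPointwise IsInter γ α β X → γ ∈ᴹ D)

/-- `(X, D)` is fuzzy compact in the sense of Lowen: every constant `c` is a fuzzy compact fuzzy
set, i.e. whenever `c ≤ sup B` with `B ⊆ D` and `ε > 0`, there is a finite `B' ⊆ B` with
`c - ε ≤ sup B'`. -/
def IsFuzzyCompact (X D : M) : Prop :=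
  ∀ c B, IsCut c → Incl B D → ConstLeJoin c B X →
    ∀ ε, IsCut ε → ¬ IsEmp ε →
      ∃ B' d, Incl B' B ∧ IsFin B' ∧ IsTruncSub d c ε ∧ ConstLeJoin d B' X

/-- `O` is the product fuzzy topology on `P`: the least fuzzy topology that makes the projections
fuzzy continuous. -/
def IsProductLowen (O I T P : M) : Prop :=
  IsLowenTop P O ∧ ContainsPullbacks O I T P ∧
    ∀ O', IsLowenTop P O' → ContainsPullbacks O' I T P → Incl O O'

/-! ### MV-topological spaces -/

/-- `O` is an MV-topology on `X`. -/
def IsMVTop (X O : M) : Prop :=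
  (∀ α, α ∈ᴹ O → IsFuzzy α X) ∧
  (∀ z α, IsEmp z → IsConst α z X → α ∈ᴹ O) ∧
  (∀ c α, IsOne c → IsConst α c X → α ∈ᴹ O) ∧
  (∀ Γ γ, Incl Γ O → IsJoin γ Γ X → γ ∈ᴹ O) ∧
  (∀ α β γ, α ∈ᴹ O → β ∈ᴹ O → IsPointwise IsOdot γ α β X → γ ∈ᴹ O) ∧
  (∀ α β γ, α ∈ᴹ O → β ∈ᴹ O → IsPointwise IsOplus γ α β X → γ ∈ᴹ O) ∧
  (∀ α β γ, α ∈ᴹ O → β ∈ᴹ O → IsPointwise IsInter γ α β X → γ ∈ᴹ O)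

/-- `⋁ Γ` is the constant fuzzy set `1` on `X`. -/
def IsCovering (Γ X : M) : Prop :=
  ∃ c u, IsOne c ∧ IsConst u c X ∧ IsJoin u Γ X

/-- `σ` is a finite sum `α₁ ⊕ ⋯ ⊕ αₙ` of elements of `Γ`, with repetitions allowed: it lies in
every set that contains `0` and is closed under `δ ↦ δ ⊕ α` for `α ∈ Γ`. -/
def IsFiniteSum (σ Γ X : M) : Prop :=
  ∀ D, (∀ z ζ, IsEmp z → IsConst ζ z X → ζ ∈ᴹ D) →
    (∀ δ α γ, δ ∈ᴹ D → α ∈ᴹ Γ → IsPointwise IsOplus γ δ α X → γ ∈ᴹ D) → σ ∈ᴹ D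

/-- `Γ` contains an additive covering of `X`: some finite sum of elements of `Γ` equals `1`. -/
def ContainsAdditiveCovering (Γ X : M) : Prop :=
  ∃ c u, IsOne c ∧ IsConst u c X ∧ IsFiniteSum u Γ X

/-- The MV-topological space `(X, O)` is compact: every open covering contains an additive
covering. -/
def IsCompactMV (X O : M) : Prop :=
  ∀ Γ, Incl Γ O → IsCovering Γ X → ContainsAdditiveCovering Γ X

/-- `O` is the product MV-topology on `P`: the least MV-topology that contains the sets
`α ∘ π_i`, i.e. the one of which they form a subbase. -/
def IsProductMV (O I T P : M) : Prop :=
  IsMVTop P O ∧ ContainsPullbacks O I T P ∧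
    ∀ O', IsMVTop P O' → ContainsPullbacks O' I T P → Incl O O'

/-! ### The four statements, inside `M` -/

variable (M)

/-- The Cartesian product of a non-empty family of non-empty sets is non-empty. -/
def AxiomOfChoice : Prop :=
  ∀ I F : M, ¬ IsEmp I → IsFam F I → (∀ i A, i ∈ᴹ I → App F i A → ¬ IsEmp A) →
    ∃ P, IsProduct P I F ∧ ¬ IsEmp P

/-- The product space of compact topological spaces is compact. -/
def ClassicalTychonoff : Prop :=
  ∀ I X T : M, IsFam X I → IsFam T I →
    (∀ i Xi Ti, i ∈ᴹ I → App X i Xi → App T i Ti → IsTopology Xi Ti ∧ IsCompactTop Xi Ti) →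
      ∀ P O, IsProduct P I X → IsProductTop O I T P → IsCompactTop P O

/-- The product space of fuzzy compact fuzzy topological spaces is fuzzy compact. -/
def LowenTychonoff : Prop :=
  ∀ I X T : M, IsFam X I → IsFam T I →
    (∀ i Xi Ti, i ∈ᴹ I → App X i Xi → App T i Ti → IsLowenTop Xi Ti ∧ IsFuzzyCompact Xi Ti) →
      ∀ P O, IsProduct P I X → IsProductLowen O I T P → IsFuzzyCompact P O

/-- The product space of compact MV-topological spaces is compact. -/
def MVTychonoff : Prop :=
  ∀ I X T : M, IsFam X I → IsFam T I →
    (∀ i Xi Ti, i ∈ᴹ I → App X i Xi → App T i Ti → IsMVTop Xi Ti ∧ IsCompactMV Xi Ti) →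
      ∀ P O, IsProduct P I X → IsProductMV O I T P → IsCompactMV P O

end Internal

end ZFTych

/-! Choice and the three Tychonoff theorems are equivalent in every model `M` of ZF.

*Definability.* Inside `M`, comprehension, replacement and induction are available only for
first-order definable predicates and maps. The classes `DefPred` and `DefMap` express
definability, and their instances follow the shape of formulas and terms, so that instance search
discharges these obligations and the arguments below read as in naive set theory. On the natural
numbers of `M` this gives an ordered commutative semiring `Nt M`; the values of the fractions of
`M` form the ordered cancellative monoid `NRat M`, and all statements on cuts are reduced to
inequalities there (`fval`).

*From choice to Tychonoff.* Choice yields a map that enlarges every non-maximal filter. By the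
Bourbaki–Witt theorem `exists_fixed_point` it has a fixed point, so every filter extends to an
ultrafilter, and the finite intersection property yields ultrafilters
(`AxiomOfChoice.exists_ultra`). If an open cover of a product `P` has no finite subcover, some
ultrafilter `U` on `P` contains the complements of its members. Compactness of the factors provides
limits of the images of `U` there, and choice assembles them into one point `s`
(`AxiomOfChoice.exists_mem_product`). Call a subset `u` of `P` good if `s ∈ u` implies that `u` meets
every set of `U`. The good sets form a topology that contains the preimages of the open sets of the
factors, hence the product topology, by minimality. So `s` lies in no member of the cover. The fuzzy
versions are the same with other notions of limit:

* for Lowen spaces, fuzzy compactness is restated in terms of two fractions `h < g`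
  (`isFuzzyCompact_iff`), and good means that `μ s` does not contain `g` if `{t | h ∉ μ t}` is in `U`;
* for MV-topological spaces, good means that `μ s` contains no `p` with `{t | p ∉ μ t}` in `U`.
  Compactness only shows that open fuzzy sets that vanish on a set of `U` are bounded away from `1`
  at the limit (`IsCompactMV.exists_isWeakLimit`), but a gap between `α s` and the values of `α` on a
  set of `U` can be doubled by passing to `α ⊕ α` or `α ⊙ α`, so this already suffices
  (`IsWeakLimit.isLimit`).

*From Tychonoff to choice.* Add to each of the non-empty sets `A` one new point `w`, the same for all.
With the open sets that contain everything as soon as they meet `A`, the enlarged set is compact,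
because any open set around a point of `A` is the whole space, and `{w}` is open; likewise for fuzzy
sets. If the product of the given family were empty, the preimages of `{w}` would cover the product
of the enlarged sets, which contains the constant family `w`; but finitely many of them never do
(`exists_avoiding`), since finitely many components of a family can be changed without choice. -/

namespace ZFTych

local infix:50 " ∈ᴹ " => SetMem

universe u

set_option synthInstance.maxSize 10000
set_option synthInstance.maxHeartbeats 400000

/-! ### Automatic definability -/

/-- `E` is a type of valuations: of tuples of elements of `M`, built from `M` by products. -/
class Ctx (M : Type u) (E : Type u) where
  /-- The free variables. -/
  ι : Type
  finite : Finite ι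
  /-- A valuation is the tuple of its coordinates. -/
  val : (ι → M) ≃ E

attribute [instance] Ctx.finite

instance (M : Type u) : Ctx M M := ⟨Unit, inferInstance, Equiv.funUnique Unit M⟩

instance (M E F : Type u) [Ctx M E] [Ctx M F] : Ctx M (E × F) :=
  ⟨Ctx.ι M E ⊕ Ctx.ι M F, inferInstance,
    (Equiv.sumArrowEquivProdArrow _ _ _).trans (Equiv.prodCongr Ctx.val Ctx.val)⟩

section

variable {M : Type u} [setLang.Structure M] {E F G : Type u} [Ctx M E] [Ctx M F] [Ctx M G]

variable (M) in
/-- The predicate `P` on valuations is first-order definable with parameters from `M`. This is a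
class so that instance search proves it, by recursion on the shape of `P`. -/
class DefPred (P : E → Prop) : Prop where
  out : Set.Definable (Set.univ : Set M) setLang {v : Ctx.ι M E → M | P (Ctx.val v)}

variable (M) in
/-- The map `f` between types of valuations is first-order definable with parameters from `M`.
For `F = M` this says that `f` is a definable term. -/
class DefMap (f : E → F) : Prop where
  out : Set.DefinableMap setLang (Set.univ : Set M)
    (fun v : Ctx.ι M E → M => Ctx.val.symm (f (Ctx.val v)))

theorem DefPred.comp {P : F → Prop} (hP : DefPred M P) (f : E → F) [h : DefMap M f] :
    DefPred M (fun e => P (f e)) := by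
  have := hP.out.preimage_map h.out
  refine ⟨?_⟩
  convert this using 1
  ext v
  simp

theorem DefMap.comp {f : F → G} (hf : DefMap M f) (g : E → F) [h : DefMap M g] :
    DefMap M (fun e => f (g e)) := by
  refine ⟨fun i => ?_⟩
  have := Set.DefinableFun.comp h.out (hf.out i)
  simpa using this

namespace DefMap

instance id : DefMap M (fun e : E => e) := ⟨fun i => by simpa using Set.DefinableFun.proj _⟩

instance const (c : F) : DefMap M (fun _ : E => c) :=
  ⟨fun _ => FirstOrder.Language.definableFun_const _ _ trivial⟩

instance fst (f : E → F × G) [h : DefMap M f] : DefMap M (fun e => (f e).1) :=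
  ⟨fun i => h.out (Sum.inl i)⟩

instance snd (f : E → F × G) [h : DefMap M f] : DefMap M (fun e => (f e).2) :=
  ⟨fun i => h.out (Sum.inr i)⟩

theorem pair (f : E → F) (g : E → G) [hf : DefMap M f] [hg : DefMap M g] :
    DefMap M (fun e => (f e, g e)) :=
  ⟨fun i => by cases i with | inl i => exact hf.out i | inr i => exact hg.out i⟩

end DefMap

namespace DefPred

variable {P Q : E → Prop}

instance and [hP : DefPred M P] [hQ : DefPred M Q] : DefPred M (fun e => P e ∧ Q e) :=
  ⟨hP.out.inter hQ.out⟩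

instance or [hP : DefPred M P] [hQ : DefPred M Q] : DefPred M (fun e => P e ∨ Q e) :=
  ⟨hP.out.union hQ.out⟩

instance not [hP : DefPred M P] : DefPred M (fun e => ¬ P e) :=
  ⟨hP.out.compl⟩

theorem congr (h : ∀ e, P e ↔ Q e) (hP : DefPred M P) : DefPred M Q := by
  rwa [← show P = Q from funext fun e => propext (h e)]

instance imp [hP : DefPred M P] [hQ : DefPred M Q] : DefPred M (fun e => P e → Q e) :=
  congr (P := fun e => ¬ P e ∨ Q e) (fun _ => imp_iff_not_or.symm) inferInstance

instance iff [hP : DefPred M P] [hQ : DefPred M Q] : DefPred M (fun e => P e ↔ Q e) :=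
  congr (P := fun e => (P e → Q e) ∧ (Q e → P e)) (fun _ => iff_def.symm) inferInstance

instance ex {P : E → M → Prop} [hP : DefPred M (fun p : E × M => P p.1 p.2)] :
    DefPred M (fun e => ∃ x, P e x) := by
  have := hP.out.image_comp (Sum.inl : Ctx.ι M E → Ctx.ι M E ⊕ Ctx.ι M M)
  refine ⟨?_⟩
  convert this using 1
  ext v
  constructor
  · rintro ⟨x, hx⟩
    exact ⟨Sum.elim v (fun _ => x), hx, rfl⟩
  · rintro ⟨w, hw, rfl⟩
    exact ⟨_, hw⟩

instance all {P : E → M → Prop} [hP : DefPred M (fun p : E × M => P p.1 p.2)] :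
    DefPred M (fun e => ∀ x, P e x) :=
  congr (P := fun e => ¬ ∃ x, ¬ P e x) (fun _ => by simp) inferInstance

theorem comp₂ {P : F × G → Prop} (hP : DefPred M P) (f : E → F) (g : E → G) [DefMap M f]
    [DefMap M g] : DefPred M (fun e => P (f e, g e)) :=
  have := DefMap.pair (M := M) f g
  hP.comp (fun e => (f e, g e))

/-- Fixing some of the variables preserves definability. -/
theorem section_ {P : E → F → Prop} (h : DefPred M (fun p : E × F => P p.1 p.2)) (e : E) :
    DefPred M (P e) :=
  h.comp₂ (fun _ => e) (fun x => x)

instance existsUnique {P : E → M → Prop} [hP : DefPred M (fun p : E × M => P p.1 p.2)] :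
    DefPred M (fun e => ∃! x, P e x) := by
  have : DefPred M (fun q : (E × M) × M => P q.1.1 q.2) :=
    hP.comp₂ (fun q : (E × M) × M => q.1.1) (fun q => q.2)
  have : DefPred M (fun q : (E × M) × M => q.2 = q.1.2) := by
    have : DefPred M (fun p : M × M => p.1 = p.2) :=
      ⟨Set.DefinableFun.ofPred_eq (f := fun v => v (Sum.inl ())) (g := fun v => v (Sum.inr ()))
        (Set.DefinableFun.proj _) (Set.DefinableFun.proj _)⟩
    exact this.comp₂ (fun q : (E × M) × M => q.2) (fun q => q.1.2)
  unfold ExistsUnique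
  infer_instance

instance eq (f g : E → M) [hf : DefMap M f] [hg : DefMap M g] :
    DefPred M (fun e => f e = g e) :=
  ⟨Set.DefinableFun.ofPred_eq (hf.out ()) (hg.out ())⟩

instance mem (f g : E → M) [hf : DefMap M f] [hg : DefMap M g] :
    DefPred M (fun e => f e ∈ᴹ g e) := by
  have : DefPred M (fun p : M × M => p.1 ∈ᴹ p.2) := by
    refine ⟨(Set.empty_definable_iff (M := M) (L := setLang).2
      ⟨FirstOrder.Language.Relations.formula₂ (L := setLang) SetRel.mem
        (FirstOrder.Language.Term.var (Sum.inl ()))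
      (FirstOrder.Language.Term.var (Sum.inr ())), ?_⟩).mono (Set.empty_subset _)⟩
    ext v
    exact (FirstOrder.Language.Formula.realize_rel₂ (M := M) (L := setLang) (R := SetRel.mem)
      (t₁ := FirstOrder.Language.Term.var (Sum.inl ()))
      (t₂ := FirstOrder.Language.Term.var (Sum.inr ())) (v := v)).symm
  exact this.comp₂ f g

/-! Definability of the notions of set theory: each is unfolded once, for variables, and then
substituted into. -/

section

variable (f g h k : E → M) [DefMap M f] [DefMap M g] [DefMap M h] [DefMap M k]

theorem subst₁ {R : M → Prop} (H : DefPred M R) : DefPred M (fun e => R (f e)) :=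
  H.comp f

theorem subst₂ {R : M → M → Prop} (H : DefPred M (fun p : M × M => R p.1 p.2)) :
    DefPred M (fun e => R (f e) (g e)) :=
  H.comp₂ f g

theorem subst₃ {R : M → M → M → Prop} (H : DefPred M (fun p : (M × M) × M => R p.1.1 p.1.2 p.2)) :
    DefPred M (fun e => R (f e) (g e) (h e)) :=
  have := DefMap.pair (M := M) f g
  H.comp₂ (fun e => (f e, g e)) h

theorem subst₄ {R : M → M → M → M → Prop}
    (H : DefPred M (fun p : ((M × M) × M) × M => R p.1.1.1 p.1.1.2 p.1.2 p.2)) :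
    DefPred M (fun e => R (f e) (g e) (h e) (k e)) :=
  have := DefMap.pair (M := M) f g
  have := DefMap.pair (M := M) (fun e => (f e, g e)) h
  H.comp₂ (fun e => ((f e, g e), h e)) k

instance : DefPred M (fun e => Incl (f e) (g e)) := subst₂ f g (by unfold Incl; infer_instance)
instance : DefPred M (fun e => IsEmp (f e)) := subst₁ f (by unfold IsEmp; infer_instance)
instance : DefPred M (fun e => IsUPair (f e) (g e) (h e)) :=
  subst₃ f g h (by unfold IsUPair; infer_instance)
instance : DefPred M (fun e => IsPair (f e) (g e) (h e)) :=
  subst₃ f g h (by unfold IsPair; infer_instance)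
instance : DefPred M (fun e => IsAdjoin (f e) (g e) (h e)) :=
  subst₃ f g h (by unfold IsAdjoin; infer_instance)
instance : DefPred M (fun e => IsUnion (f e) (g e)) :=
  subst₂ f g (by unfold IsUnion; infer_instance)
instance : DefPred M (fun e => IsInter (f e) (g e) (h e)) :=
  subst₃ f g h (by unfold IsInter; infer_instance)
instance : DefPred M (fun e => IsInductive (f e)) :=
  subst₁ f (by unfold IsInductive; infer_instance)
instance : DefPred M (fun e => App (f e) (g e) (h e)) :=
  subst₃ f g h (by unfold App; infer_instance)
instance : DefPred M (fun e => IsFam (f e) (g e)) :=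
  subst₂ f g (by unfold IsFam; infer_instance)
instance : DefPred M (fun e => IsFin (f e)) :=
  subst₁ f (by unfold IsFin; infer_instance)
instance : DefPred M (fun e => IsOmega (f e)) := subst₁ f (by unfold IsOmega; infer_instance)
instance : DefPred M (fun e => IsNat (f e)) := subst₁ f (by unfold IsNat; infer_instance)
instance : DefPred M (fun e => NatAdd (f e) (g e) (h e)) :=
  subst₃ f g h (by unfold NatAdd NatRec; beta_reduce; infer_instance)
instance : DefPred M (fun e => NatMul (f e) (g e) (h e)) :=
  subst₃ f g h (by unfold NatMul NatRec; beta_reduce; infer_instance)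
instance : DefPred M (fun e => IsFrac (f e) (g e) (h e)) :=
  subst₃ f g h (by unfold IsFrac; infer_instance)
instance : DefPred M (fun e => FracLe (f e) (g e)) :=
  subst₂ f g (by unfold FracLe; infer_instance)
instance : DefPred M (fun e => FracLt (f e) (g e)) :=
  subst₂ f g (by unfold FracLt; infer_instance)
instance : DefPred M (fun e => FracAdd (f e) (g e) (h e)) :=
  subst₃ f g h (by unfold FracAdd; infer_instance)
instance : DefPred M (fun e => IsFracOne (f e)) := subst₁ f (by unfold IsFracOne; infer_instance)
instance : DefPred M (fun e => FracLtOne (f e)) := subst₁ f (by unfold FracLtOne; infer_instance)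
instance : DefPred M (fun e => IsCut (f e)) := subst₁ f (by unfold IsCut; infer_instance)
instance : DefPred M (fun e => IsOne (f e)) := subst₁ f (by unfold IsOne; infer_instance)
instance : DefPred M (fun e => IsOplus (f e) (g e) (h e)) :=
  subst₃ f g h (by unfold IsOplus; infer_instance)
instance : DefPred M (fun e => IsOdot (f e) (g e) (h e)) :=
  subst₃ f g h (by unfold IsOdot; infer_instance)
instance : DefPred M (fun e => IsFuzzy (f e) (g e)) :=
  subst₂ f g (by unfold IsFuzzy; infer_instance)
instance : DefPred M (fun e => IsConst (f e) (g e) (h e)) :=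
  subst₃ f g h (by unfold IsConst; infer_instance)

end

/-! Instance search works up to `η`, so predicates whose last argument is the bound variable of a
comprehension are provided in `η`-reduced form as well. -/

section

variable (a b : M)

instance : DefPred M (Incl a) := instIncl (fun _ => a) (fun x => x)
instance : DefPred M (NatAdd a b) := instNatAdd (fun _ => a) (fun _ => b) (fun x => x)
instance : DefPred M (NatMul a b) := instNatMul (fun _ => a) (fun _ => b) (fun x => x)
instance : DefPred M (FracLtOne : M → Prop) := instFracLtOne (fun x => x)
instance : DefPred M (IsCut : M → Prop) := instIsCut (fun x => x)
instance : DefPred M (SetMem a) := mem (fun _ => a) (fun x => x)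
instance : DefPred M (Eq a) := eq (fun _ => a) (fun x => x)

end

end DefPred
end

/-! ### Set-theoretic operations of a model -/

section

variable {M : Type u} [setLang.Structure M]

section

variable {E : Type u} [Ctx M E]

/-- A map into `M` is definable if its graph is. -/
theorem DefMap.of_graph {f : E → M} (h : DefPred M (fun p : E × M => p.2 = f p.1)) :
    DefMap M f := by
  refine ⟨fun i => ?_⟩
  have := h.out.preimage_comp
    (Sum.elim some (fun _ => none) : Ctx.ι M E ⊕ Unit → Option (Ctx.ι M E))
  unfold Set.DefinableFun
  convert this using 1
  ext v
  exact eq_comm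

theorem DefMap.subst₁ (f : E → M) [DefMap M f] {F : M → M} (H : DefMap M F) :
    DefMap M (fun e => F (f e)) := H.comp f

theorem DefMap.subst₂ (f g : E → M) [DefMap M f] [DefMap M g] {F : M → M → M}
    (H : DefMap M (fun p : M × M => F p.1 p.2)) : DefMap M (fun e => F (f e) (g e)) :=
  have := DefMap.pair (M := M) f g
  H.comp (fun e => (f e, g e))

end

theorem not_isEmp_iff {a : M} : ¬ IsEmp a ↔ ∃ x, x ∈ᴹ a := by simp [IsEmp]

theorem Incl.refl (a : M) : Incl a a := fun _ h => h

theorem Incl.trans {a b c : M} (h : Incl a b) (h' : Incl b c) : Incl a c :=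
  fun x hx => h' x (h x hx)

variable [hM : Fact (IsZFModel M)]

theorem mem_ext {a b : M} (h : ∀ x, x ∈ᴹ a ↔ x ∈ᴹ b) : a = b := hM.out.extensionality a b h

theorem exists_sep (a : M) (P : M → Prop) [hP : DefPred M P] :
    ∃ b, ∀ x, x ∈ᴹ b ↔ x ∈ᴹ a ∧ P x :=
  hM.out.separation {x | P x} (hP.out.preimage_comp (fun _ : Unit => (0 : Fin 1))) a

theorem exists_img (a : M) (f : M → M) [hf : DefMap M f] :
    ∃ b, ∀ y, y ∈ᴹ b ↔ ∃ x, x ∈ᴹ a ∧ y = f x := by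
  have : DefMap M (fun p : M × M => f p.1) := hf.comp _
  have h : DefPred M (fun p : M × M => p.2 = f p.1) := inferInstance
  exact hM.out.replacement {p | p.2 = f p.1}
    (h.out.preimage_comp (Sum.elim (fun _ => 0) (fun _ => 1) : Unit ⊕ Unit → Fin 2)) a
    (fun x _ => ⟨f x, rfl, fun _ h => h⟩)

open Classical in
/-- `{x ∈ a | P x}`, for definable `P`. If no such set exists, the value is irrelevant. -/
noncomputable def sep (a : M) (P : M → Prop) : M :=
  if h : ∃ b, ∀ x, x ∈ᴹ b ↔ x ∈ᴹ a ∧ P x then h.choose else a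

@[simp] theorem mem_sep {a : M} {P : M → Prop} [DefPred M P] {x : M} :
    x ∈ᴹ sep a P ↔ x ∈ᴹ a ∧ P x := by
  rw [sep, dif_pos (exists_sep a P)]
  exact (exists_sep a P).choose_spec x

open Classical in
/-- `{f x | x ∈ a}`, for definable `f`. If no such set exists, the value is irrelevant. -/
noncomputable def img (a : M) (f : M → M) : M :=
  if h : ∃ b, ∀ y, y ∈ᴹ b ↔ ∃ x, x ∈ᴹ a ∧ y = f x then h.choose else a

@[simp] theorem mem_img {a : M} {f : M → M} [DefMap M f] {y : M} :
    y ∈ᴹ img a f ↔ ∃ x, x ∈ᴹ a ∧ y = f x := by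
  rw [img, dif_pos (exists_img a f)]
  exact (exists_img a f).choose_spec y

variable (M) in
/-- The empty set. -/
noncomputable def emp : M := sep hM.out.infinity.choose (fun x => ¬ x ∈ᴹ x ∧ x ∈ᴹ x)

@[simp] theorem not_mem_emp {x : M} : ¬ x ∈ᴹ emp M := by
  rw [emp, mem_sep]
  exact fun h => h.2.1 h.2.2

theorem isEmp_iff {e : M} : IsEmp e ↔ e = emp M :=
  ⟨fun h => mem_ext fun x => ⟨fun hx => (h x hx).elim, fun hx => (not_mem_emp hx).elim⟩,
    fun h _ => h ▸ not_mem_emp⟩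

@[simp] theorem isEmp_emp : IsEmp (emp M) := isEmp_iff.2 rfl

/-- `{a, b}`. -/
noncomputable def upair (a b : M) : M := (hM.out.pairing a b).choose

@[simp] theorem mem_upair {a b x : M} : x ∈ᴹ upair a b ↔ x = a ∨ x = b :=
  (hM.out.pairing a b).choose_spec x

theorem isUPair_iff {a b c : M} : IsUPair c a b ↔ c = upair a b :=
  ⟨fun h => mem_ext fun x => by simp [h x], fun h x => h ▸ mem_upair⟩

/-- The ordered pair `⟨a, b⟩`. -/
noncomputable def pr (a b : M) : M := upair (upair a a) (upair a b)

@[simp] theorem isPair_iff {a b p : M} : IsPair p a b ↔ p = pr a b := by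
  simp [IsPair, isUPair_iff, pr]

theorem upair_eq_upair {a b c d : M} (h : upair a b = upair c d) :
    (a = c ∧ b = d) ∨ (a = d ∧ b = c) := by
  have h1 : ∀ x, (x = a ∨ x = b) ↔ (x = c ∨ x = d) := fun x => by
    rw [← mem_upair, h, mem_upair]
  have ha := (h1 a).1 (.inl rfl)
  have hb := (h1 b).1 (.inr rfl)
  have hc := (h1 c).2 (.inl rfl)
  have hd := (h1 d).2 (.inr rfl)
  grind

@[simp] theorem pr_inj {a b c d : M} : pr a b = pr c d ↔ a = c ∧ b = d := by
  refine ⟨fun h => ?_, fun ⟨h, h'⟩ => by rw [h, h']⟩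
  rcases upair_eq_upair h with ⟨h1, h2⟩ | ⟨h1, h2⟩ <;>
    rcases upair_eq_upair h1 with ⟨h3, h4⟩ | ⟨h3, h4⟩ <;>
    rcases upair_eq_upair h2 with ⟨h5, h6⟩ | ⟨h5, h6⟩ <;> grind

/-- The union `⋃ S`. -/
noncomputable def sU (S : M) : M := (hM.out.union S).choose

@[simp] theorem mem_sU {S x : M} : x ∈ᴹ sU S ↔ ∃ y, y ∈ᴹ S ∧ x ∈ᴹ y :=
  (hM.out.union S).choose_spec x

theorem isUnion_iff {S u : M} : IsUnion u S ↔ u = sU S :=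
  ⟨fun h => mem_ext fun x => by rw [h x, mem_sU], fun h x => h ▸ mem_sU⟩

/-- The power set. -/
noncomputable def pow (a : M) : M := (hM.out.powerset a).choose

@[simp] theorem mem_pow {a x : M} : x ∈ᴹ pow a ↔ Incl x a := (hM.out.powerset a).choose_spec x

theorem Incl.antisymm {a b : M} (h : Incl a b) (h' : Incl b a) : a = b :=
  mem_ext fun x => ⟨h x, h' x⟩

/-- `a ∪ b`. -/
noncomputable def un (a b : M) : M := sU (upair a b)

@[simp] theorem mem_un {a b x : M} : x ∈ᴹ un a b ↔ x ∈ᴹ a ∨ x ∈ᴹ b := by simp [un]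

/-- `b ∪ {x}`. -/
noncomputable def adj (b x : M) : M := un b (upair x x)

@[simp] theorem mem_adj {b x y : M} : y ∈ᴹ adj b x ↔ y ∈ᴹ b ∨ y = x := by simp [adj]

theorem isAdjoin_iff {b c x : M} : IsAdjoin c b x ↔ c = adj b x :=
  ⟨fun h => mem_ext fun y => by rw [h y, mem_adj], fun h y => h ▸ mem_adj⟩

section

variable {E : Type u} [Ctx M E] (f g : E → M) [DefMap M f] [DefMap M g]

instance defMap_upair : DefMap M (fun e => upair (f e) (g e)) :=
  .subst₂ f g <| .of_graph <| .congr (P := fun p : (M × M) × M => IsUPair p.2 p.1.1 p.1.2)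
    (fun _ => isUPair_iff) inferInstance

instance defMap_pr : DefMap M (fun e => pr (f e) (g e)) := by unfold pr; infer_instance

instance defMap_sU : DefMap M (fun e => sU (f e)) :=
  .subst₁ f <| .of_graph <| .congr (P := fun p : M × M => IsUnion p.2 p.1)
    (fun _ => isUnion_iff) inferInstance

instance defMap_un : DefMap M (fun e => un (f e) (g e)) := by unfold un; infer_instance

instance defMap_adj : DefMap M (fun e => adj (f e) (g e)) := by unfold adj; infer_instance

instance defMap_pow : DefMap M (fun e => pow (f e)) :=
  .subst₁ f <| .of_graph <| .congr (P := fun p : M × M => ∀ x, x ∈ᴹ p.2 ↔ Incl x p.1)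
    (fun p => ⟨fun h => mem_ext fun x => by rw [h, mem_pow], fun h x => by rw [h, mem_pow]⟩)
    inferInstance

instance {P : E → M → Prop} [hP : DefPred M (fun p : E × M => P p.1 p.2)] :
    DefMap M (fun e => sep (f e) (P e)) := by
  have h1 : DefMap M (fun p : (E × M) × M => f p.1.1) := .comp ‹DefMap M f› _
  have h2 : DefPred M (fun p : (E × M) × M => P p.1.1 p.2) :=
    hP.comp₂ (fun p : (E × M) × M => p.1.1) (fun p => p.2)
  refine .of_graph <| .congr (P := fun p : E × M => ∀ x, x ∈ᴹ p.2 ↔ x ∈ᴹ f p.1 ∧ P p.1 x)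
    (fun p => ?_) inferInstance
  have := hP.section_ p.1
  exact ⟨fun h => mem_ext fun x => by rw [h, mem_sep], fun h x => by rw [h, mem_sep]⟩

instance {F : E → M → M} [hF : DefMap M (fun p : E × M => F p.1 p.2)] :
    DefMap M (fun e => img (f e) (F e)) := by
  have h1 : DefMap M (fun p : ((E × M) × M) × M => f p.1.1.1) := .comp ‹DefMap M f› _
  have h2 : DefMap M (fun p : ((E × M) × M) × M => F p.1.1.1 p.2) := by
    have : DefMap M (fun p : ((E × M) × M) × M => (p.1.1.1, p.2)) := .pair _ _
    exact hF.comp (fun p : ((E × M) × M) × M => (p.1.1.1, p.2))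
  refine .of_graph <| .congr
    (P := fun p : E × M => ∀ y, y ∈ᴹ p.2 ↔ ∃ x, x ∈ᴹ f p.1 ∧ y = F p.1 x)
    (fun p => ?_) inferInstance
  have : DefMap M (F p.1) := by
    have : DefMap M (fun x : M => (p.1, x)) := .pair _ _
    exact hF.comp (fun x : M => (p.1, x))
  exact ⟨fun h => mem_ext fun x => by rw [h, mem_img], fun h x => by rw [h, mem_img]⟩

end

section

variable (a : M)

instance : DefMap M (pr a) := defMap_pr (fun _ => a) (fun x => x)
instance : DefMap M (un a) := defMap_un (fun _ => a) (fun x => x)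

end

/-- Some set lies outside any given set (Russell). -/
theorem exists_not_mem (a : M) : ∃ r, ¬ r ∈ᴹ a := by
  refine ⟨sep a (fun x => ¬ x ∈ᴹ x), fun h => ?_⟩
  have := mem_sep (a := a) (P := fun x => ¬ x ∈ᴹ x) (x := sep a (fun x => ¬ x ∈ᴹ x))
  tauto

/-! ### Families and products -/

theorem app_iff {f x y : M} : App f x y ↔ pr x y ∈ᴹ f := by simp [App]

/-- The family `i ↦ f i` on the index set `I`, for definable `f`. -/
noncomputable def lam (I : M) (f : M → M) : M := img I (fun i => pr i (f i))

/-- The value `f(x)`, written as the union of all `y` with `⟨x, y⟩ ∈ f`. -/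
noncomputable def ap (f x : M) : M := sU (sep (sU (sU f)) (fun y => pr x y ∈ᴹ f))

section

variable {E : Type u} [Ctx M E] (f g : E → M) [DefMap M f] [DefMap M g]

instance defMap_ap : DefMap M (fun e => ap (f e) (g e)) :=
  .subst₂ f g (by unfold ap; infer_instance)

instance {F : E → M → M} [DefMap M (fun p : E × M => F p.1 p.2)] :
    DefMap M (fun e => lam (f e) (F e)) := by unfold lam; infer_instance

end

instance (a : M) : DefMap M (ap a) := defMap_ap (fun _ => a) (fun x => x)

theorem app_eq {F I i y : M} (hF : IsFam F I) (hi : i ∈ᴹ I) : App F i y ↔ ap F i = y := by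
  obtain ⟨y', hy', hu⟩ := hF.2 i hi
  have h1 : ∀ z, z ∈ᴹ sep (sU (sU F)) (fun y => pr i y ∈ᴹ F) ↔ z = y' := by
    intro z
    rw [mem_sep, ← app_iff]
    refine ⟨fun h => hu z h.2, ?_⟩
    rintro rfl
    refine ⟨?_, hy'⟩
    rw [mem_sU]
    exact ⟨upair i z, mem_sU.2 ⟨_, app_iff.1 hy', by simp [pr]⟩, by simp⟩
  have h2 : ap F i = y' := mem_ext fun x => by simp only [ap, mem_sU, h1]; simp
  rw [h2]
  exact ⟨fun h => (hu y h).symm, fun h => h ▸ hy'⟩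

theorem app_ap {F I i : M} (hF : IsFam F I) (hi : i ∈ᴹ I) : App F i (ap F i) :=
  (app_eq hF hi).2 rfl

theorem app_dom {F I i y : M} (hF : IsFam F I) (h : App F i y) : i ∈ᴹ I := by
  obtain ⟨j, z, hj, hp⟩ := hF.1 _ (app_iff.1 h)
  rw [isPair_iff, pr_inj] at hp
  exact hp.1 ▸ hj

theorem app_lam {I i y : M} {f : M → M} [DefMap M f] : App (lam I f) i y ↔ i ∈ᴹ I ∧ y = f i := by
  have : DefMap M (fun i => pr i (f i)) := inferInstance
  simp only [app_iff, lam, mem_img, pr_inj]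
  constructor
  · rintro ⟨x, hx, rfl, rfl⟩; exact ⟨hx, rfl⟩
  · rintro ⟨hi, rfl⟩; exact ⟨i, hi, rfl, rfl⟩

theorem isFam_lam {I : M} {f : M → M} [DefMap M f] : IsFam (lam I f) I := by
  refine ⟨fun p hp => ?_, fun i hi => ⟨f i, app_lam.2 ⟨hi, rfl⟩, fun y hy => (app_lam.1 hy).2⟩⟩
  have : DefMap M (fun i => pr i (f i)) := inferInstance
  simp only [lam, mem_img] at hp
  obtain ⟨x, hx, rfl⟩ := hp
  exact ⟨x, f x, hx, isPair_iff.2 rfl⟩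

theorem ap_lam {I i : M} {f : M → M} [DefMap M f] (hi : i ∈ᴹ I) : ap (lam I f) i = f i :=
  (app_eq isFam_lam hi).1 (app_lam.2 ⟨hi, rfl⟩)

/-- A set that contains all families on `I` with values in `V`. -/
noncomputable def famBound (I V : M) : M := pow (pow (pow (un I V)))

theorem mem_famBound {I V s : M} (hs : IsFam s I) (h : ∀ i, i ∈ᴹ I → ap s i ∈ᴹ V) :
    s ∈ᴹ famBound I V := by
  simp only [famBound, mem_pow]
  intro p hp
  obtain ⟨i, y, hi, hpi⟩ := hs.1 p hp
  rw [isPair_iff] at hpi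
  subst hpi
  have hy := (app_eq hs hi).1 (app_iff.2 hp)
  have hyV := hy ▸ h i hi
  rw [mem_pow]
  intro q hq
  rw [mem_pow]
  intro z hz
  rw [pr, mem_upair] at hq
  rcases hq with rfl | rfl <;> rw [mem_upair] at hz <;> rcases hz with rfl | rfl <;>
    simp [hi, hyV]

/-- The Cartesian product of the family `F` indexed by `I`. -/
noncomputable def prod (I F : M) : M :=
  sep (famBound I (sU (sU (sU F)))) (fun s => IsFam s I ∧ ∀ i, i ∈ᴹ I → ap s i ∈ᴹ ap F i)

theorem mem_prod {I F s : M} (hF : IsFam F I) :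
    s ∈ᴹ prod I F ↔ IsFam s I ∧ ∀ i, i ∈ᴹ I → ap s i ∈ᴹ ap F i := by
  rw [prod, mem_sep]
  refine ⟨fun h => h.2, fun h => ⟨mem_famBound h.1 fun i hi => ?_, h⟩⟩
  refine mem_sU.2 ⟨_, mem_sU.2 ⟨upair i (ap F i), mem_sU.2 ⟨pr i (ap F i),
    app_iff.1 (app_ap hF hi), by simp [pr]⟩, by simp⟩, h.2 i hi⟩

theorem isProduct_iff {I F P : M} (hF : IsFam F I) : IsProduct P I F ↔
    ∀ s, s ∈ᴹ P ↔ IsFam s I ∧ ∀ i, i ∈ᴹ I → ap s i ∈ᴹ ap F i := by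
  refine forall_congr' fun s => iff_congr Iff.rfl (and_congr_right fun hs => ?_)
  refine forall₂_congr fun i hi => ?_
  simp [app_eq hs hi, app_eq hF hi]

theorem isProduct_prod {I F : M} (hF : IsFam F I) : IsProduct (prod I F) I F :=
  (isProduct_iff hF).2 fun _ => mem_prod hF

/-! ### Finite sets -/

/-- Induction on finite sets. -/
theorem fin_induction {A : M} (hA : IsFin A) (P : M → Prop) [DefPred M P] (h0 : P (emp M))
    (hs : ∀ b x, Incl b A → x ∈ᴹ A → P b → P (adj b x)) : P A := by
  refine (mem_sep (a := pow A) (P := P)|>.1 (hA (sep (pow A) P) ?_ ?_)).2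
  · intro e he
    rw [isEmp_iff] at he
    subst he
    exact mem_sep.2 ⟨mem_pow.2 fun x hx => (not_mem_emp hx).elim, h0⟩
  · intro b x c hb hx hc
    rw [isAdjoin_iff] at hc
    subst hc
    rw [mem_sep, mem_pow] at hb ⊢
    refine ⟨fun y hy => ?_, hs b x hb.1 hx hb.2⟩
    rcases mem_adj.1 hy with h | rfl
    · exact hb.1 y h
    · exact hx

theorem isFin_emp : IsFin (emp M) := fun _ h _ => h _ isEmp_emp

theorem IsFin.adj {A x : M} (hA : IsFin A) : IsFin (adj A x) := fun K h0 hs =>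
  hs A x _ (hA K h0 fun b y c hb hy hc => hs b y c hb (mem_adj.2 (.inl hy)) hc)
    (mem_adj.2 (.inr rfl)) (isAdjoin_iff.2 rfl)

theorem isFin_sing (x : M) : IsFin (adj (emp M) x) := isFin_emp.adj

theorem IsFin.un {A B : M} (hA : IsFin A) (hB : IsFin B) : IsFin (un A B) := by
  refine fin_induction hB (fun B => IsFin (ZFTych.un A B)) ?_ fun b x _ _ h => ?_
  · rwa [show ZFTych.un A (emp M) = A from mem_ext fun x => by simp]
  · rw [show ZFTych.un A (ZFTych.adj b x) = ZFTych.adj (ZFTych.un A b) x from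
      mem_ext fun y => by simp [or_assoc]]
    exact h.adj

end

section

variable {M : Type u} [setLang.Structure M] [hM : Fact (IsZFModel M)]

/-! ### The natural numbers of a model -/

theorem not_mem_of_mem {a b : M} (h : a ∈ᴹ b) : ¬ b ∈ᴹ a := by
  intro h'
  obtain ⟨x, hx, hx'⟩ := hM.out.foundation (upair a b) ⟨a, by simp⟩
  rcases mem_upair.1 hx with rfl | rfl
  · exact hx' b h' (by simp)
  · exact hx' a h (by simp)

theorem not_mem_self (a : M) : ¬ a ∈ᴹ a := fun h => not_mem_of_mem h h

/-- The successor `n ∪ {n}`. -/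
noncomputable def suc (n : M) : M := adj n n

@[simp] theorem mem_suc {x n : M} : x ∈ᴹ suc n ↔ x ∈ᴹ n ∨ x = n := by simp [suc]

instance defMap_suc {E : Type u} [Ctx M E] (f : E → M) [DefMap M f] :
    DefMap M (fun e => suc (f e)) := by unfold suc; infer_instance

instance : DefMap M (suc : M → M) := defMap_suc (fun x => x)

theorem suc_ne_emp (n : M) : suc n ≠ emp M := fun h => not_mem_emp (h ▸ mem_suc.2 (.inr rfl))

theorem suc_inj {m n : M} (h : suc m = suc n) : m = n := by
  have h1 : m ∈ᴹ suc n := h ▸ mem_suc.2 (.inr rfl)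
  have h2 : n ∈ᴹ suc m := h ▸ mem_suc.2 (.inr rfl)
  rcases mem_suc.1 h1 with h1 | h1
  · rcases mem_suc.1 h2 with h2 | h2
    · exact (not_mem_of_mem h1 h2).elim
    · exact h2.symm
  · exact h1

theorem isInductive_iff {w : M} :
    IsInductive w ↔ emp M ∈ᴹ w ∧ ∀ n, n ∈ᴹ w → suc n ∈ᴹ w := by
  simp [IsInductive, isEmp_iff, isAdjoin_iff, suc]

variable (M) in
/-- The set of natural numbers. -/
noncomputable def omega : M :=
  sep hM.out.infinity.choose (fun n => ∀ v, IsInductive v → n ∈ᴹ v)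

theorem isOmega_iff {w : M} : IsOmega w ↔ w = omega M := by
  have h : IsOmega (omega M) := fun n => by
    rw [omega, mem_sep]
    exact ⟨fun h => h.2, fun h => ⟨h _ hM.out.infinity.choose_spec, h⟩⟩
  refine ⟨fun hw => mem_ext fun n => by rw [hw n, h n], fun e => e ▸ h⟩

theorem isNat_iff {n : M} : IsNat n ↔ n ∈ᴹ omega M := by simp [IsNat, isOmega_iff]

theorem emp_mem_omega : emp M ∈ᴹ omega M :=
  (isOmega_iff.2 rfl _).2 fun _ hv => (isInductive_iff.1 hv).1

theorem suc_mem_omega {n : M} (hn : n ∈ᴹ omega M) : suc n ∈ᴹ omega M :=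
  (isOmega_iff.2 rfl _).2 fun v hv =>
    (isInductive_iff.1 hv).2 _ ((isOmega_iff.2 rfl n).1 hn v hv)

/-- Induction on the natural numbers of the model, for definable predicates. -/
theorem nat_induction (P : M → Prop) [DefPred M P] (h0 : P (emp M))
    (hs : ∀ n, n ∈ᴹ omega M → P n → P (suc n)) {n : M} (hn : n ∈ᴹ omega M) : P n := by
  refine (mem_sep.1 ((isOmega_iff.2 rfl n).1 hn (sep (omega M) P) (isInductive_iff.2 ?_))).2
  refine ⟨mem_sep.2 ⟨emp_mem_omega, h0⟩, fun m hm => ?_⟩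
  rw [mem_sep] at hm ⊢
  exact ⟨suc_mem_omega hm.1, hs m hm.1 hm.2⟩

/-- `a × b`. -/
noncomputable def cart (a b : M) : M :=
  sep (pow (pow (un a b))) (fun p => ∃ x y, x ∈ᴹ a ∧ y ∈ᴹ b ∧ p = pr x y)

theorem mem_cart {a b x y : M} : pr x y ∈ᴹ cart a b ↔ x ∈ᴹ a ∧ y ∈ᴹ b := by
  rw [cart, mem_sep]
  constructor
  · rintro ⟨_, x', y', hx, hy, h⟩
    obtain ⟨rfl, rfl⟩ := pr_inj.1 h
    exact ⟨hx, hy⟩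
  · rintro ⟨hx, hy⟩
    refine ⟨?_, x, y, hx, hy, rfl⟩
    rw [mem_pow]
    intro q hq
    rw [mem_pow]
    intro z hz
    rw [pr, mem_upair] at hq
    rcases hq with rfl | rfl <;> rw [mem_upair] at hz <;> rcases hz with rfl | rfl <;> simp [hx, hy]

/-- Definite descriptions: the union of `{z ∈ A | P z}` is the unique `z ∈ A` with `P z`. -/
theorem sU_sep_eq {A y : M} {P : M → Prop} [DefPred M P] (hy : y ∈ᴹ A ∧ P y)
    (hu : ∀ z, z ∈ᴹ A → P z → z = y) : sU (sep A P) = y := by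
  refine mem_ext fun x => ?_
  simp only [mem_sU, mem_sep]
  constructor
  · rintro ⟨z, ⟨h1, h2⟩, hx⟩
    exact hu z h1 h2 ▸ hx
  · exact fun hx => ⟨y, hy, hx⟩

/-- Recursion on the natural numbers of the model. -/
theorem exists_rec (z : M) (s : M → M) [hs : DefMap M s] (A : M) (hz : z ∈ᴹ A)
    (hsA : ∀ a, a ∈ᴹ A → s a ∈ᴹ A) :
    ∃ g, IsFam g (omega M) ∧ ap g (emp M) = z ∧
      ∀ n, n ∈ᴹ omega M → ap g n ∈ᴹ A ∧ ap g (suc n) = s (ap g n) := by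
  have hs' {E : Type u} [Ctx M E] (f : E → M) [DefMap M f] : DefMap M (fun e => s (f e)) :=
    hs.comp f
  let R : M → M → Prop := fun n y => ∀ K, pr (emp M) z ∈ᴹ K →
    (∀ m a, m ∈ᴹ omega M → a ∈ᴹ A → pr m a ∈ᴹ K → pr (suc m) (s a) ∈ᴹ K) → pr n y ∈ᴹ K
  have hR : DefPred M (fun p : M × M => R p.1 p.2) := by infer_instance
  have hR' {E : Type u} [Ctx M E] (f g : E → M) [DefMap M f] [DefMap M g] :
    DefPred M (fun e => R (f e) (g e)) := DefPred.subst₂ f g hR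
  have hRn (n : M) : DefPred M (R n) := hR' (fun _ => n) (fun y => y)
  have R0 : R (emp M) z := fun K h _ => h
  have Rs : ∀ m a, m ∈ᴹ omega M → a ∈ᴹ A → R m a → R (suc m) (s a) :=
    fun m a hm ha h K h0 h1 => h1 m a hm ha (h K h0 h1)
  -- `R n y` holds only for the reasons that put it into the least closed relation.
  have inv : ∀ n y, R n y → y ∈ᴹ A ∧ ((n = emp M ∧ y = z) ∨
      ∃ m a, m ∈ᴹ omega M ∧ a ∈ᴹ A ∧ R m a ∧ n = suc m ∧ y = s a) := by
    intro n y h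
    have h1 := h (sep (cart (omega M) A) (fun p => ∃ n y, p = pr n y ∧ R n y ∧
      ((n = emp M ∧ y = z) ∨
        ∃ m a, m ∈ᴹ omega M ∧ a ∈ᴹ A ∧ R m a ∧ n = suc m ∧ y = s a))) ?_ ?_
    · obtain ⟨h1, n', y', e, -, h2⟩ := mem_sep.1 h1
      obtain ⟨rfl, rfl⟩ := pr_inj.1 e
      exact ⟨(mem_cart.1 h1).2, h2⟩
    · exact mem_sep.2 ⟨mem_cart.2 ⟨emp_mem_omega, hz⟩, _, _, rfl, R0, .inl ⟨rfl, rfl⟩⟩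
    · intro m a hm ha hma
      obtain ⟨-, m', a', e, h2, -⟩ := mem_sep.1 hma
      obtain ⟨rfl, rfl⟩ := pr_inj.1 e
      exact mem_sep.2 ⟨mem_cart.2 ⟨suc_mem_omega hm, hsA a ha⟩, _, _, rfl, Rs _ _ hm ha h2,
        .inr ⟨_, _, hm, ha, h2, rfl, rfl⟩⟩
  clear_value R
  have ex : ∀ n, n ∈ᴹ omega M → ∃ y, y ∈ᴹ A ∧ R n y ∧ ∀ y', R n y' → y' = y := by
    intro n hn
    refine nat_induction (fun n => ∃ y, y ∈ᴹ A ∧ R n y ∧ ∀ y', R n y' → y' = y) ?_ ?_ hn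
    · refine ⟨z, hz, R0, fun y' h => ?_⟩
      rcases (inv _ _ h).2 with h | ⟨m, a, _, _, _, h, _⟩
      · exact h.2
      · exact (suc_ne_emp _ h.symm).elim
    · rintro n hn ⟨y, hy, hR, hu⟩
      refine ⟨s y, hsA y hy, Rs n y hn hy hR, fun y' h => ?_⟩
      rcases (inv _ _ h).2 with h | ⟨m, a, _, _, h1, h2, h3⟩
      · exact (suc_ne_emp _ h.1).elim
      · rw [h3, hu a (suc_inj h2 ▸ h1)]
  have val : ∀ n y, n ∈ᴹ omega M → R n y → sU (sep A (R n)) = y := by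
    intro n y hn hy
    obtain ⟨y', hy', hR, hu⟩ := ex n hn
    rw [hu y hy]
    exact sU_sep_eq ⟨hy', hR⟩ fun z _ hz => hu z hz
  have vm : ∀ n, n ∈ᴹ omega M → sU (sep A (R n)) ∈ᴹ A ∧ R n (sU (sep A (R n))) := by
    intro n hn
    obtain ⟨y', hy', hR, -⟩ := ex n hn
    rw [val n y' hn hR]
    exact ⟨hy', hR⟩
  refine ⟨lam (omega M) (fun n => sU (sep A (R n))), isFam_lam, ?_, fun n hn => ?_⟩
  · rw [ap_lam emp_mem_omega]
    exact val _ _ emp_mem_omega R0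
  · rw [ap_lam hn, ap_lam (suc_mem_omega hn)]
    exact ⟨(vm n hn).1, val _ _ (suc_mem_omega hn) (Rs _ _ hn (vm n hn).1 (vm n hn).2)⟩

/-- If the relation `S` is the graph of a definable map `s` on a set `A` that contains `z` and is
closed under `s`, then `NatRec z S` is the graph of a function on the natural numbers. -/
theorem natRec_iff {z : M} {S : M → M → Prop} (s : M → M) [hs : DefMap M s] (A : M) (hz : z ∈ᴹ A)
    (hsA : ∀ a, a ∈ᴹ A → s a ∈ᴹ A) (hS : ∀ a b, a ∈ᴹ A → (S a b ↔ b = s a)) :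
    ∃ g, IsFam g (omega M) ∧ ap g (emp M) = z ∧
      (∀ n, n ∈ᴹ omega M → ap g n ∈ᴹ A ∧ ap g (suc n) = s (ap g n)) ∧
      ∀ n k, NatRec z S n k ↔ n ∈ᴹ omega M ∧ k = ap g n := by
  obtain ⟨g, hg, hg0, hgs⟩ := exists_rec z s A hz hsA
  refine ⟨g, hg, hg0, hgs, fun n k => ⟨?_, ?_⟩⟩
  · rintro ⟨w, g', hw, hg', h0, hs', hn, hk⟩
    rw [isOmega_iff] at hw
    subst hw
    refine ⟨hn, ?_⟩
    rw [← (app_eq hg' hn).1 hk]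
    refine nat_induction (fun n => ap g' n = ap g n) ?_ (fun n hn h => ?_) hn
    · rw [hg0]
      exact (app_eq hg' emp_mem_omega).1 (h0 _ isEmp_emp)
    · have h1 := hs' n (suc n) _ _ hn (isAdjoin_iff.2 rfl) (app_ap hg' hn)
        (app_ap hg' (suc_mem_omega hn))
      rw [h, hS _ _ (hgs n hn).1] at h1
      rw [h1, (hgs n hn).2]
  · rintro ⟨hn, rfl⟩
    refine ⟨omega M, g, isOmega_iff.2 rfl, hg, fun e he => ?_, fun i j a b hi hj ha hb => ?_, hn,
      app_ap hg hn⟩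
    · rw [isEmp_iff.1 he, app_eq hg emp_mem_omega, hg0]
    · rw [isAdjoin_iff] at hj
      rw [app_eq hg hi] at ha
      have hsi : j ∈ᴹ omega M := hj ▸ suc_mem_omega hi
      rw [app_eq hg hsi] at hb
      rw [← ha, ← hb, hS _ _ (hgs i hi).1, ← (hgs i hi).2, hj, suc]

/-! ### Arithmetic of the natural numbers of a model -/

/-- `m + n`. -/
noncomputable def nadd (m n : M) : M := sU (sep (omega M) (fun k => NatAdd m n k))

/-- `m * n`. -/
noncomputable def nmul (m n : M) : M := sU (sep (omega M) (fun k => NatMul m n k))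

section

variable {E : Type u} [Ctx M E] (f g : E → M) [DefMap M f] [DefMap M g]

instance defMap_nadd : DefMap M (fun e => nadd (f e) (g e)) :=
  .subst₂ f g (by unfold nadd; infer_instance)
instance defMap_nmul : DefMap M (fun e => nmul (f e) (g e)) :=
  .subst₂ f g (by unfold nmul; infer_instance)

end

instance (a : M) : DefMap M (nadd a) := defMap_nadd (fun _ => a) (fun x => x)
instance (a : M) : DefMap M (nmul a) := defMap_nmul (fun _ => a) (fun x => x)

theorem natAdd_spec {m : M} (hm : m ∈ᴹ omega M) :
    (∀ n k, NatAdd m n k ↔ n ∈ᴹ omega M ∧ k = nadd m n) ∧ nadd m (emp M) = m ∧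
      ∀ n, n ∈ᴹ omega M → nadd m n ∈ᴹ omega M ∧ nadd m (suc n) = suc (nadd m n) := by
  obtain ⟨g, hg, hg0, hgs, h⟩ := natRec_iff (S := fun a b => IsAdjoin b a a) suc (omega M) hm
    (fun _ => suc_mem_omega) (fun a b _ => isAdjoin_iff)
  have e : ∀ n, n ∈ᴹ omega M → nadd m n = ap g n := fun n hn =>
    sU_sep_eq ⟨(hgs n hn).1, (h n _).2 ⟨hn, rfl⟩⟩ fun k _ hk => ((h n k).1 hk).2
  refine ⟨fun n k => (h n k).trans (and_congr_right fun hn => by rw [e n hn]), ?_, fun n hn => ?_⟩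
  · rw [e _ emp_mem_omega, hg0]
  · rw [e n hn, e _ (suc_mem_omega hn)]
    exact hgs n hn

theorem natMul_spec {m : M} (hm : m ∈ᴹ omega M) :
    (∀ n k, NatMul m n k ↔ n ∈ᴹ omega M ∧ k = nmul m n) ∧ nmul m (emp M) = emp M ∧
      ∀ n, n ∈ᴹ omega M → nmul m n ∈ᴹ omega M ∧ nmul m (suc n) = nadd (nmul m n) m := by
  obtain ⟨g, hg, hg0, hgs, h'⟩ := natRec_iff (S := fun a b => NatAdd a m b) (fun a => nadd a m)
    (omega M) emp_mem_omega (fun a ha => ((natAdd_spec ha).2.2 m hm).1)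
    (fun a b ha => ((natAdd_spec ha).1 m b).trans (and_iff_right hm))
  have h : ∀ n k, NatMul m n k ↔ n ∈ᴹ omega M ∧ k = ap g n := fun n k => by
    rw [← h' n k]; simp [NatMul, isEmp_iff]
  have e : ∀ n, n ∈ᴹ omega M → nmul m n = ap g n := fun n hn =>
    sU_sep_eq ⟨(hgs n hn).1, (h n _).2 ⟨hn, rfl⟩⟩ fun k _ hk => ((h n k).1 hk).2
  refine ⟨fun n k => (h n k).trans (and_congr_right fun hn => by rw [e n hn]), ?_, fun n hn => ?_⟩
  · rw [e _ emp_mem_omega, hg0]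
  · rw [e n hn, e _ (suc_mem_omega hn)]
    exact hgs n hn

variable (M) in
/-- The type of natural numbers of the model. -/
def Nt : Type u := {n : M // n ∈ᴹ omega M}

namespace Nt

theorem ext_iff {m n : Nt M} : m = n ↔ m.1 = n.1 := Subtype.ext_iff

/-- The next natural number. -/
noncomputable def succ (n : Nt M) : Nt M := ⟨suc n.1, suc_mem_omega n.2⟩

noncomputable instance : Zero (Nt M) := ⟨⟨emp M, emp_mem_omega⟩⟩
noncomputable instance : One (Nt M) := ⟨succ 0⟩
noncomputable instance : Add (Nt M) := ⟨fun m n => ⟨nadd m.1 n.1, ((natAdd_spec m.2).2.2 _ n.2).1⟩⟩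
noncomputable instance : Mul (Nt M) := ⟨fun m n => ⟨nmul m.1 n.1, ((natMul_spec m.2).2.2 _ n.2).1⟩⟩
instance : LT (Nt M) := ⟨fun m n => m.1 ∈ᴹ n.1⟩
instance : LE (Nt M) := ⟨fun m n => m.1 ∈ᴹ n.1 ∨ m.1 = n.1⟩

/-- Induction on `Nt M`, for predicates that are given by a definable predicate on `M`. -/
theorem ind {P : Nt M → Prop} (Q : M → Prop) [DefPred M Q] (hQ : ∀ n, P n ↔ Q n.1) (h0 : P 0)
    (hs : ∀ n, P n → P n.succ) (n : Nt M) : P n :=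
  (hQ n).2 <| nat_induction Q ((hQ 0).1 h0)
    (fun n hn h => (hQ (succ ⟨n, hn⟩)).1 (hs ⟨n, hn⟩ ((hQ ⟨n, hn⟩).2 h))) n.2

theorem add_zero' (m : Nt M) : m + 0 = m := Subtype.ext (natAdd_spec m.2).2.1
theorem add_succ (m n : Nt M) : m + n.succ = (m + n).succ :=
  Subtype.ext ((natAdd_spec m.2).2.2 _ n.2).2
theorem mul_zero' (m : Nt M) : m * 0 = 0 := Subtype.ext (natMul_spec m.2).2.1
theorem mul_succ (m n : Nt M) : m * n.succ = m * n + m :=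
  Subtype.ext ((natMul_spec m.2).2.2 _ n.2).2
theorem add_one' (m : Nt M) : m + 1 = m.succ := by
  rw [show (1 : Nt M) = succ 0 from rfl, add_succ, add_zero']

theorem zero_add' (n : Nt M) : 0 + n = n :=
  ind (P := fun n => 0 + n = n)
    (fun n => nadd (0 : Nt M).1 n = n) (fun _ => Nt.ext_iff) (add_zero' 0)
    (fun n h => by rw [add_succ, h]) n

theorem succ_add (m n : Nt M) : m.succ + n = (m + n).succ :=
  ind (P := fun n => m.succ + n = (m + n).succ)
    (fun n => nadd m.succ.1 n = suc (nadd m.1 n)) (fun _ => Nt.ext_iff)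
    (by rw [add_zero', add_zero']) (fun n h => by rw [add_succ, h, add_succ]) n

theorem add_comm' (m n : Nt M) : m + n = n + m :=
  ind (P := fun n => m + n = n + m)
    (fun n => nadd m.1 n = nadd n m.1) (fun _ => Nt.ext_iff)
    (by rw [add_zero', zero_add']) (fun n h => by rw [add_succ, h, succ_add]) n

theorem add_assoc' (a b c : Nt M) : a + b + c = a + (b + c) :=
  ind (P := fun c => a + b + c = a + (b + c))
    (fun c => nadd (a + b).1 c = nadd a.1 (nadd b.1 c)) (fun _ => Nt.ext_iff)
    (by rw [add_zero', add_zero']) (fun n h => by rw [add_succ, h, add_succ, add_succ]) c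

noncomputable instance : AddCommMonoid (Nt M) where
  add_assoc := add_assoc'
  zero_add := zero_add'
  add_zero := add_zero'
  add_comm := add_comm'
  nsmul := nsmulRec

theorem zero_mul' (n : Nt M) : 0 * n = 0 :=
  ind (P := fun n => 0 * n = 0)
    (fun n => nmul (0 : Nt M).1 n = (0 : Nt M).1) (fun _ => Nt.ext_iff) (mul_zero' 0)
    (fun n h => by rw [mul_succ, h, add_zero]) n

theorem succ_mul (m n : Nt M) : m.succ * n = m * n + n :=
  ind (P := fun n => m.succ * n = m * n + n)
    (fun n => nmul m.succ.1 n = nadd (nmul m.1 n) n) (fun _ => Nt.ext_iff)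
    (by rw [mul_zero', mul_zero', add_zero])
    (fun n h => by rw [mul_succ, h, mul_succ, add_succ, add_succ, add_right_comm]) n

theorem mul_comm' (m n : Nt M) : m * n = n * m :=
  ind (P := fun n => m * n = n * m)
    (fun n => nmul m.1 n = nmul n m.1) (fun _ => Nt.ext_iff)
    (by rw [mul_zero', zero_mul']) (fun n h => by rw [mul_succ, h, succ_mul]) n

theorem mul_add' (a b c : Nt M) : a * (b + c) = a * b + a * c :=
  ind (P := fun c => a * (b + c) = a * b + a * c)
    (fun c => nmul a.1 (nadd b.1 c) = nadd (a * b).1 (nmul a.1 c)) (fun _ => Nt.ext_iff)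
    (by rw [add_zero, mul_zero', add_zero])
    (fun n h => by rw [add_succ, mul_succ, h, mul_succ, add_assoc]) c

theorem mul_assoc' (a b c : Nt M) : a * b * c = a * (b * c) :=
  ind (P := fun c => a * b * c = a * (b * c))
    (fun c => nmul (a * b).1 c = nmul a.1 (nmul b.1 c)) (fun _ => Nt.ext_iff)
    (by rw [mul_zero', mul_zero', mul_zero'])
    (fun n h => by rw [mul_succ, h, mul_succ, mul_add']) c

theorem mul_one' (a : Nt M) : a * 1 = a := by
  rw [show (1 : Nt M) = succ 0 from rfl, mul_succ, mul_zero', zero_add]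

noncomputable instance : CommSemiring (Nt M) where
  mul_assoc := mul_assoc'
  one_mul a := by rw [mul_comm', mul_one']
  mul_one := mul_one'
  mul_comm := mul_comm'
  zero_mul := zero_mul'
  mul_zero := mul_zero'
  left_distrib := mul_add'
  right_distrib a b c := by rw [mul_comm', mul_add', mul_comm' c, mul_comm' c]

theorem lt_succ {m n : Nt M} : m < n.succ ↔ m < n ∨ m = n :=
  mem_suc.trans (or_congr_right Nt.ext_iff.symm)

theorem not_lt_zero (n : Nt M) : ¬ n < 0 := not_mem_emp

theorem lt_irrefl' (n : Nt M) : ¬ n < n := not_mem_self _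

theorem le_iff {m n : Nt M} : m ≤ n ↔ m < n ∨ m = n := or_congr_right Nt.ext_iff.symm

theorem lt_trans' {a b c : Nt M} (h : a < b) (h' : b < c) : a < c :=
  ind (P := fun c => b < c → a < c) (fun c => b.1 ∈ᴹ c → a.1 ∈ᴹ c) (fun _ => Iff.rfl)
    (fun h => (not_lt_zero _ h).elim)
    (fun _ h1 h2 => by
      rcases lt_succ.1 h2 with h2 | rfl
      · exact lt_succ.2 (.inl (h1 h2))
      · exact lt_succ.2 (.inl h)) c h'

theorem succ_le {m n : Nt M} (h : m < n) : m.succ < n ∨ m.succ = n :=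
  ind (P := fun n => m < n → m.succ < n ∨ m.succ = n)
    (fun n => m.1 ∈ᴹ n → m.succ.1 ∈ᴹ n ∨ m.succ.1 = n)
    (fun _ => imp_congr_right fun _ => or_congr_right Nt.ext_iff)
    (fun h => (not_lt_zero _ h).elim)
    (fun _ h1 h2 => by
      rcases lt_succ.1 h2 with h2 | rfl
      · exact .inl (lt_succ.2 (h1 h2))
      · exact .inr rfl) n h

theorem zero_le' (n : Nt M) : 0 < n ∨ 0 = n :=
  ind (P := fun n => 0 < n ∨ 0 = n)
    (fun n => (0 : Nt M).1 ∈ᴹ n ∨ (0 : Nt M).1 = n)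
    (fun _ => or_congr_right Nt.ext_iff) (.inr rfl)
    (fun _ h => .inl (lt_succ.2 h)) n

theorem trichotomy (m n : Nt M) : m < n ∨ m = n ∨ n < m :=
  ind (P := fun n => m < n ∨ m = n ∨ n < m) (fun n => m.1 ∈ᴹ n ∨ m.1 = n ∨ n ∈ᴹ m.1)
    (fun _ => or_congr_right (or_congr_left Nt.ext_iff))
    (by rcases zero_le' m with h | h
        · exact .inr (.inr h)
        · exact .inr (.inl h.symm))
    (fun _ h => by
      rcases h with h | rfl | h
      · exact .inl (lt_succ.2 (.inl h))
      · exact .inl (lt_succ.2 (.inr rfl))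
      · rcases succ_le h with h | h
        · exact .inr (.inr h)
        · exact .inr (.inl h.symm)) n

open Classical in
noncomputable instance : LinearOrder (Nt M) where
  le_refl _ := .inr rfl
  le_trans a b c h h' := by
    rw [le_iff] at *
    rcases h with h | rfl
    · rcases h' with h' | rfl
      · exact .inl (lt_trans' h h')
      · exact .inl h
    · exact h'
  le_antisymm a b h h' := by
    rw [le_iff] at *
    rcases h with h | rfl
    · rcases h' with h' | h'
      · exact (lt_irrefl' _ (lt_trans' h h')).elim
      · exact h'.symm
    · rfl
  le_total a b := by
    rw [le_iff, le_iff]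
    rcases trichotomy a b with h | h | h
    exacts [.inl (.inl h), .inl (.inr h), .inr (.inl h)]
  lt_iff_le_not_ge a b := by
    rw [le_iff, le_iff]
    constructor
    · refine fun h => ⟨.inl h, ?_⟩
      rintro (h' | rfl)
      · exact lt_irrefl' _ (lt_trans' h h')
      · exact lt_irrefl' _ h
    · rintro ⟨h | rfl, h'⟩
      · exact h
      · exact (h' (.inr rfl)).elim
  toDecidableLE := Classical.decRel _

theorem succ_lt_succ {m n : Nt M} (h : m < n) : m.succ < n.succ := lt_succ.2 (succ_le h)

theorem add_lt_add_right' {m n : Nt M} (h : m < n) (k : Nt M) : m + k < n + k :=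
  ind (P := fun k => m + k < n + k) (fun k => nadd m.1 k ∈ᴹ nadd n.1 k) (fun _ => Iff.rfl)
    (by rwa [add_zero, add_zero]) (fun k h => by rw [add_succ, add_succ]; exact succ_lt_succ h) k

theorem mul_lt_mul_succ {m n : Nt M} (h : m < n) (k : Nt M) : m * k.succ < n * k.succ :=
  ind (P := fun k => m * k.succ < n * k.succ) (fun k => nmul m.1 (suc k) ∈ᴹ nmul n.1 (suc k))
    (fun _ => Iff.rfl)
    (by rwa [show succ (0 : Nt M) = 1 from rfl, mul_one, mul_one])
    (fun k hk => by
      rw [mul_succ m, mul_succ n]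
      refine lt_trans (add_lt_add_right' hk m) ?_
      rw [add_comm, add_comm _ n]
      exact add_lt_add_right' h _) k

theorem eq_zero_or_succ (n : Nt M) : n = 0 ∨ ∃ k : Nt M, n = k.succ :=
  ind (P := fun n => n = 0 ∨ ∃ k : Nt M, n = k.succ)
    (fun n => n = (0 : Nt M).1 ∨ ∃ k, k ∈ᴹ omega M ∧ n = suc k)
    (fun _ => or_congr Nt.ext_iff
      ⟨fun ⟨k, h⟩ => ⟨k.1, k.2, congrArg (·.1) h⟩, fun ⟨k, hk, h⟩ => ⟨⟨k, hk⟩, Subtype.ext h⟩⟩)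
    (.inl rfl) (fun k _ => .inr ⟨k, rfl⟩) n

instance : IsStrictOrderedRing (Nt M) where
  add_le_add_left a b h c := by
    rcases h.lt_or_eq with h | rfl
    · exact (add_lt_add_right' h c).le
    · exact le_rfl
  le_of_add_le_add_left a b c h := by
    by_contra h'
    have := add_lt_add_right' (not_le.1 h') a
    rw [add_comm, add_comm b] at this
    exact this.not_ge h
  zero_le_one := le_iff.2 (zero_le' 1)
  exists_pair_ne := ⟨0, 1, fun h => suc_ne_emp (emp M) (congrArg (·.1) h).symm⟩
  mul_lt_mul_of_pos_left a ha b c h := by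
    rcases eq_zero_or_succ a with rfl | ⟨k, rfl⟩
    · exact (lt_irrefl' _ ha).elim
    · rw [mul_comm, mul_comm _ c]
      exact mul_lt_mul_succ h k
  mul_lt_mul_of_pos_right a ha b c h := by
    rcases eq_zero_or_succ a with rfl | ⟨k, rfl⟩
    · exact (lt_irrefl' _ ha).elim
    · exact mul_lt_mul_succ h k

theorem zero_le (n : Nt M) : 0 ≤ n := le_iff.2 (zero_le' n)

theorem exists_add_of_le {m n : Nt M} (h : m ≤ n) : ∃ k : Nt M, n = m + k := by
  have := ind (P := fun n => m ≤ n → ∃ k : Nt M, n = m + k)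
    (fun n => (m.1 ∈ᴹ n ∨ m.1 = n) → ∃ k, k ∈ᴹ omega M ∧ n = nadd m.1 k)
    (fun _ => imp_congr Iff.rfl
      ⟨fun ⟨k, h⟩ => ⟨k.1, k.2, congrArg (·.1) h⟩, fun ⟨k, hk, h⟩ => ⟨⟨k, hk⟩, Subtype.ext h⟩⟩)
    (fun h => ⟨0, by rw [add_zero]; exact le_antisymm (zero_le m) h⟩)
    (fun _ hn h => by
      rcases le_iff.1 h with h | rfl
      · obtain ⟨k, rfl⟩ := hn (le_iff.2 (lt_succ.1 h))
        exact ⟨k.succ, (add_succ m k).symm⟩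
      · exact ⟨0, (add_zero _).symm⟩)
  exact this n h

instance : ExistsAddOfLE (Nt M) := ⟨exists_add_of_le⟩

theorem lt_succ_iff {m n : Nt M} : m < n.succ ↔ m ≤ n := lt_succ.trans le_iff.symm

end Nt

/-! ### Values of fractions -/

variable (M) in
/-- A pair of natural numbers of the model that forms a fraction. -/
structure Fr where
  /-- The numerator. -/
  num : Nt M
  /-- The denominator. -/
  den : Nt M
  pos : 0 < den

namespace Fr

/-- Equality of the values of fractions. -/
instance setoid : Setoid (Fr M) where
  r f g := f.num * g.den = g.num * f.den
  iseqv :=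
    { refl := fun _ => rfl
      symm := fun h => h.symm
      trans := fun {f g h} e e' => by
        refine mul_right_cancel₀ g.pos.ne' ?_
        linear_combination h.den * e + f.den * e' }

theorem equiv_iff {f g : Fr M} : f ≈ g ↔ f.num * g.den = g.num * f.den := Iff.rfl

/-- The sum `p / q + p' / q' = (p * q' + p' * q) / (q * q')`. -/
noncomputable def add (f g : Fr M) : Fr M :=
  ⟨f.num * g.den + g.num * f.den, f.den * g.den, mul_pos f.pos g.pos⟩

theorem le_congr {f g f' g' : Fr M} (hf : f ≈ f') (hg : g ≈ g')
    (h : f.num * g.den ≤ g.num * f.den) : f'.num * g'.den ≤ g'.num * f'.den := by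
  rw [equiv_iff] at hf hg
  refine le_of_mul_le_mul_right ?_ (mul_pos f.pos g.pos)
  calc f'.num * g'.den * (f.den * g.den) = f.num * g.den * (f'.den * g'.den) := by
        linear_combination (g.den * g'.den) * hf.symm
    _ ≤ g.num * f.den * (f'.den * g'.den) :=
        mul_le_mul_of_nonneg_right h (mul_pos f'.pos g'.pos).le
    _ = _ := by linear_combination (f.den * f'.den) * hg

end Fr

variable (M) in
/-- The values of fractions, that is, the non-negative rational numbers of the model. -/
def NRat : Type u := Quotient (Fr.setoid (M := M))

/-- The value of a fraction. -/
def Fr.val (f : Fr M) : NRat M := Quotient.mk _ f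

namespace NRat

theorem val_eq {f g : Fr M} : f.val = g.val ↔ f.num * g.den = g.num * f.den := Quotient.eq

theorem exists_val (x : NRat M) : ∃ f : Fr M, f.val = x := Quotient.exists_rep x

noncomputable instance : Zero (NRat M) := ⟨Fr.val ⟨0, 1, zero_lt_one⟩⟩
noncomputable instance : One (NRat M) := ⟨Fr.val ⟨1, 1, zero_lt_one⟩⟩

noncomputable instance : Add (NRat M) :=
  ⟨Quotient.map₂ Fr.add fun f f' hf g g' hg => by
    rw [Fr.equiv_iff] at *
    simp only [Fr.add]
    linear_combination (g.den * g'.den) * hf + (f.den * f'.den) * hg⟩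

instance : LE (NRat M) :=
  ⟨Quotient.lift₂ (fun f g => f.num * g.den ≤ g.num * f.den) fun _ _ _ _ hf hg =>
    propext ⟨Fr.le_congr hf hg, Fr.le_congr (Setoid.symm hf) (Setoid.symm hg)⟩⟩

theorem val_add (f g : Fr M) : f.val + g.val = (f.add g).val := rfl

theorem val_le {f g : Fr M} : f.val ≤ g.val ↔ f.num * g.den ≤ g.num * f.den := Iff.rfl

noncomputable instance : LinearOrder (NRat M) where
  le_refl x := by
    obtain ⟨f, rfl⟩ := exists_val x
    exact val_le.2 le_rfl
  le_trans x y z h h' := by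
    obtain ⟨f, rfl⟩ := exists_val x
    obtain ⟨g, rfl⟩ := exists_val y
    obtain ⟨k, rfl⟩ := exists_val z
    rw [val_le] at *
    refine le_of_mul_le_mul_right ?_ g.pos
    calc f.num * k.den * g.den = f.num * g.den * k.den := by ring
      _ ≤ g.num * f.den * k.den := mul_le_mul_of_nonneg_right h k.pos.le
      _ = g.num * k.den * f.den := by ring
      _ ≤ k.num * g.den * f.den := mul_le_mul_of_nonneg_right h' f.pos.le
      _ = _ := by ring
  le_antisymm x y h h' := by
    obtain ⟨f, rfl⟩ := exists_val x
    obtain ⟨g, rfl⟩ := exists_val y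
    rw [val_le] at *
    exact val_eq.2 (le_antisymm h h')
  le_total x y := by
    obtain ⟨f, rfl⟩ := exists_val x
    obtain ⟨g, rfl⟩ := exists_val y
    exact le_total (f.num * g.den) (g.num * f.den)
  toDecidableLE := Classical.decRel _

theorem val_lt {f g : Fr M} : f.val < g.val ↔ f.num * g.den < g.num * f.den := by
  rw [← not_le, val_le, not_le]

noncomputable instance : AddCommMonoid (NRat M) where
  add_assoc x y z := by
    obtain ⟨f, rfl⟩ := exists_val x
    obtain ⟨g, rfl⟩ := exists_val y
    obtain ⟨k, rfl⟩ := exists_val z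
    simp only [val_add, val_eq, Fr.add]
    ring
  zero_add x := by
    obtain ⟨f, rfl⟩ := exists_val x
    refine val_eq.2 ?_
    simp only [Fr.add]
    ring
  add_zero x := by
    obtain ⟨f, rfl⟩ := exists_val x
    refine val_eq.2 ?_
    simp only [Fr.add]
    ring
  add_comm x y := by
    obtain ⟨f, rfl⟩ := exists_val x
    obtain ⟨g, rfl⟩ := exists_val y
    simp only [val_add, val_eq, Fr.add]
    ring
  nsmul := nsmulRec

instance : IsOrderedCancelAddMonoid (NRat M) where
  add_le_add_left x y h z := by
    obtain ⟨f, rfl⟩ := exists_val x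
    obtain ⟨g, rfl⟩ := exists_val y
    obtain ⟨k, rfl⟩ := exists_val z
    simp only [val_add, val_le, Fr.add] at *
    calc (f.num * k.den + k.num * f.den) * (g.den * k.den)
        = f.num * g.den * (k.den * k.den) + k.num * f.den * (g.den * k.den) := by ring
      _ ≤ g.num * f.den * (k.den * k.den) + k.num * f.den * (g.den * k.den) :=
        add_le_add_left (mul_le_mul_of_nonneg_right h (mul_pos k.pos k.pos).le) _
      _ = _ := by ring
  le_of_add_le_add_left z x y h := by
    obtain ⟨f, rfl⟩ := exists_val x
    obtain ⟨g, rfl⟩ := exists_val y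
    obtain ⟨k, rfl⟩ := exists_val z
    simp only [val_add, val_le, Fr.add] at *
    refine le_of_mul_le_mul_right (a := k.den * k.den) ?_ (mul_pos k.pos k.pos)
    refine le_of_add_le_add_left (a := k.num * f.den * (g.den * k.den)) ?_
    linear_combination h

theorem zero_le (x : NRat M) : 0 ≤ x := by
  obtain ⟨f, rfl⟩ := exists_val x
  refine val_le.2 ?_
  rw [zero_mul]
  exact Nt.zero_le _

theorem zero_lt_one : (0 : NRat M) < 1 := val_lt.2 (by simp)

theorem val_same_add (a b m : Nt M) (h : 0 < m) :
    Fr.val ⟨a, m, h⟩ + Fr.val ⟨b, m, h⟩ = Fr.val ⟨a + b, m, h⟩ := by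
  rw [val_add, val_eq, Fr.add]
  ring

theorem val_self (m : Nt M) (h : 0 < m) : Fr.val ⟨m, m, h⟩ = 1 := val_eq.2 (mul_comm _ _)

theorem val_same_le {a b m : Nt M} (h : 0 < m) :
    Fr.val ⟨a, m, h⟩ ≤ Fr.val ⟨b, m, h⟩ ↔ a ≤ b := by
  rw [val_le]
  exact mul_le_mul_iff_left₀ h

theorem val_same_lt {a b m : Nt M} (h : 0 < m) :
    Fr.val ⟨a, m, h⟩ < Fr.val ⟨b, m, h⟩ ↔ a < b := by
  rw [← not_le, val_same_le, not_le]

/-- Any two values have a common denominator. -/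
theorem exists_common (x y : NRat M) : ∃ (a b m : Nt M) (h : 0 < m),
    x = Fr.val ⟨a, m, h⟩ ∧ y = Fr.val ⟨b, m, h⟩ := by
  obtain ⟨f, rfl⟩ := exists_val x
  obtain ⟨g, rfl⟩ := exists_val y
  exact ⟨f.num * g.den, g.num * f.den, f.den * g.den, mul_pos f.pos g.pos,
    val_eq.2 (by ring), val_eq.2 (by ring)⟩

theorem exists_add_of_le {x y : NRat M} (h : x ≤ y) : ∃ z, y = x + z := by
  obtain ⟨a, b, m, hm, rfl, rfl⟩ := exists_common x y
  obtain ⟨k, rfl⟩ := Nt.exists_add_of_le ((val_same_le hm).1 h)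
  exact ⟨_, (val_same_add a k m hm).symm⟩

theorem exists_half (x : NRat M) : ∃ y, y + y = x := by
  obtain ⟨f, rfl⟩ := exists_val x
  refine ⟨Fr.val ⟨f.num, f.den + f.den, add_pos f.pos f.pos⟩, ?_⟩
  rw [val_same_add, val_eq]
  ring

theorem exists_between {x y : NRat M} (h : x < y) : ∃ z, x < z ∧ z < y := by
  obtain ⟨d, rfl⟩ := exists_add_of_le h.le
  obtain ⟨e, rfl⟩ := exists_half d
  exact ⟨x + e, by grind, by grind⟩

end NRat

/-! ### Fractions of the model -/

variable (M) in
/-- The set of all fractions. -/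
noncomputable def fracs : M := sep (cart (omega M) (omega M)) (fun f => ∃ p q, IsFrac f p q)

/-- The code of a fraction. -/
noncomputable def Fr.code (f : Fr M) : M := pr f.num.1 f.den.1

theorem isFrac_iff {x p q : M} : IsFrac x p q ↔
    ∃ f : Fr M, x = f.code ∧ p = f.num.1 ∧ q = f.den.1 := by
  simp only [IsFrac, isNat_iff, isEmp_iff, isPair_iff]
  constructor
  · rintro ⟨hp, hq, h0, rfl⟩
    refine ⟨⟨⟨p, hp⟩, ⟨q, hq⟩, ?_⟩, rfl, rfl, rfl⟩
    exact (Nt.zero_le' ⟨q, hq⟩).resolve_right fun h => h0 (congrArg (·.1) h).symm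
  · rintro ⟨f, rfl, rfl, rfl⟩
    exact ⟨f.num.2, f.den.2, fun h => f.pos.ne' (Subtype.ext h), rfl⟩

theorem Fr.code_inj {f g : Fr M} (h : f.code = g.code) : f = g := by
  obtain ⟨a, b, _⟩ := f
  obtain ⟨c, d, _⟩ := g
  obtain ⟨h1, h2⟩ := pr_inj.1 h
  obtain rfl : a = c := Subtype.ext h1
  obtain rfl : b = d := Subtype.ext h2
  rfl

theorem mem_fracs {x : M} : x ∈ᴹ fracs M ↔ ∃ f : Fr M, f.code = x := by
  rw [fracs, mem_sep]
  constructor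
  · rintro ⟨-, _, _, h⟩
    obtain ⟨f, rfl, -⟩ := isFrac_iff.1 h
    exact ⟨f, rfl⟩
  · rintro ⟨f, rfl⟩
    exact ⟨mem_cart.2 ⟨f.num.2, f.den.2⟩, _, _, isFrac_iff.2 ⟨f, rfl, rfl, rfl⟩⟩

@[simp] theorem code_mem (f : Fr M) : f.code ∈ᴹ fracs M := mem_fracs.2 ⟨f, rfl⟩

open Classical in
/-- The value of (the code of) a fraction; `0` for other sets. -/
noncomputable def fval (x : M) : NRat M := if h : ∃ f : Fr M, f.code = x then h.choose.val else 0

@[simp] theorem fval_code (f : Fr M) : fval f.code = f.val := by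
  have h : ∃ g : Fr M, g.code = f.code := ⟨f, rfl⟩
  rw [fval, dif_pos h, Fr.code_inj h.choose_spec]

theorem exists_fval (x : NRat M) : ∃ f, f ∈ᴹ fracs M ∧ fval f = x := by
  obtain ⟨f, rfl⟩ := NRat.exists_val x
  exact ⟨f.code, code_mem f, fval_code f⟩

theorem natMul_iff {a b : Nt M} {k : M} : NatMul a.1 b.1 k ↔ k = (a * b).1 :=
  ((natMul_spec a.2).1 _ _).trans (and_iff_right b.2)

theorem natAdd_iff {a b : Nt M} {k : M} : NatAdd a.1 b.1 k ↔ k = (a + b).1 :=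
  ((natAdd_spec a.2).1 _ _).trans (and_iff_right b.2)

theorem fracLe_iff {x y : M} :
    FracLe x y ↔ x ∈ᴹ fracs M ∧ y ∈ᴹ fracs M ∧ fval x ≤ fval y := by
  constructor
  · rintro ⟨p, q, p', q', s, t, hf, hg, hs, ht, h⟩
    obtain ⟨f, rfl, rfl, rfl⟩ := isFrac_iff.1 hf
    obtain ⟨g, rfl, rfl, rfl⟩ := isFrac_iff.1 hg
    rw [natMul_iff] at hs ht
    subst hs ht
    rw [fval_code, fval_code]
    exact ⟨code_mem f, code_mem g, NRat.val_le.2 h⟩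
  · rintro ⟨hx, hy, h⟩
    obtain ⟨f, rfl⟩ := mem_fracs.1 hx
    obtain ⟨g, rfl⟩ := mem_fracs.1 hy
    rw [fval_code, fval_code] at h
    exact ⟨_, _, _, _, _, _, isFrac_iff.2 ⟨f, rfl, rfl, rfl⟩, isFrac_iff.2 ⟨g, rfl, rfl, rfl⟩,
      natMul_iff.2 rfl, natMul_iff.2 rfl, NRat.val_le.1 h⟩

theorem fracLt_iff {x y : M} :
    FracLt x y ↔ x ∈ᴹ fracs M ∧ y ∈ᴹ fracs M ∧ fval x < fval y := by
  constructor
  · rintro ⟨p, q, p', q', s, t, hf, hg, hs, ht, h⟩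
    obtain ⟨f, rfl, rfl, rfl⟩ := isFrac_iff.1 hf
    obtain ⟨g, rfl, rfl, rfl⟩ := isFrac_iff.1 hg
    rw [natMul_iff] at hs ht
    subst hs ht
    rw [fval_code, fval_code]
    exact ⟨code_mem f, code_mem g, NRat.val_lt.2 h⟩
  · rintro ⟨hx, hy, h⟩
    obtain ⟨f, rfl⟩ := mem_fracs.1 hx
    obtain ⟨g, rfl⟩ := mem_fracs.1 hy
    rw [fval_code, fval_code] at h
    exact ⟨_, _, _, _, _, _, isFrac_iff.2 ⟨f, rfl, rfl, rfl⟩, isFrac_iff.2 ⟨g, rfl, rfl, rfl⟩,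
      natMul_iff.2 rfl, natMul_iff.2 rfl, NRat.val_lt.1 h⟩

theorem fracAdd_spec {x y z : M} (h : FracAdd x y z) :
    x ∈ᴹ fracs M ∧ y ∈ᴹ fracs M ∧ z ∈ᴹ fracs M ∧ fval z = fval x + fval y := by
  obtain ⟨p, q, p', q', a, b, n, d, hf, hg, ha, hb, hn, hd, hz⟩ := h
  obtain ⟨f, rfl, rfl, rfl⟩ := isFrac_iff.1 hf
  obtain ⟨g, rfl, rfl, rfl⟩ := isFrac_iff.1 hg
  obtain ⟨k, rfl, rfl, rfl⟩ := isFrac_iff.1 hz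
  rw [natMul_iff] at ha hb hd
  subst ha hb
  rw [natAdd_iff] at hn
  obtain rfl : k = f.add g := by
    obtain ⟨_, _, _⟩ := k
    obtain rfl := Subtype.ext hn
    obtain rfl := Subtype.ext hd
    rfl
  simp [NRat.val_add]

theorem exists_fracAdd {x y : M} (hx : x ∈ᴹ fracs M) (hy : y ∈ᴹ fracs M) :
    ∃ z, FracAdd x y z ∧ z ∈ᴹ fracs M ∧ fval z = fval x + fval y := by
  obtain ⟨f, rfl⟩ := mem_fracs.1 hx
  obtain ⟨g, rfl⟩ := mem_fracs.1 hy
  have : FracAdd f.code g.code (f.add g).code :=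
    ⟨_, _, _, _, _, _, _, _, isFrac_iff.2 ⟨f, rfl, rfl, rfl⟩, isFrac_iff.2 ⟨g, rfl, rfl, rfl⟩,
      natMul_iff.2 rfl, natMul_iff.2 rfl, natAdd_iff.2 rfl, natMul_iff.2 rfl,
      isFrac_iff.2 ⟨f.add g, rfl, rfl, rfl⟩⟩
  exact ⟨_, this, (fracAdd_spec this).2.2⟩

theorem isFracOne_spec {x : M} (h : IsFracOne x) : x ∈ᴹ fracs M ∧ fval x = 1 := by
  obtain ⟨n, h⟩ := h
  obtain ⟨⟨a, b, hb⟩, rfl, rfl, h⟩ := isFrac_iff.1 h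
  obtain rfl : a = b := Subtype.ext h
  exact ⟨code_mem _, by rw [fval_code, NRat.val_self]⟩

variable (M) in
theorem exists_isFracOne : ∃ x : M, IsFracOne x :=
  ⟨_, _, isFrac_iff.2 ⟨⟨1, 1, zero_lt_one⟩, rfl, rfl, rfl⟩⟩

theorem fracLtOne_iff {x : M} : FracLtOne x ↔ x ∈ᴹ fracs M ∧ fval x < 1 := by
  constructor
  · rintro ⟨o, ho, h⟩
    rw [fracLt_iff, (isFracOne_spec ho).2] at h
    exact ⟨h.1, h.2.2⟩
  · rintro ⟨hx, h⟩
    obtain ⟨o, ho⟩ := exists_isFracOne M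
    refine ⟨o, ho, fracLt_iff.2 ⟨hx, (isFracOne_spec ho).1, ?_⟩⟩
    rwa [(isFracOne_spec ho).2]

/-! ### Cuts -/

theorem isCut_iff {c : M} : IsCut c ↔ (∀ f, f ∈ᴹ c → f ∈ᴹ fracs M ∧ fval f < 1) ∧
    (∀ f g, f ∈ᴹ c → g ∈ᴹ fracs M → fval g ≤ fval f → g ∈ᴹ c) ∧
    ∀ f, f ∈ᴹ c → ∃ g, g ∈ᴹ c ∧ fval f < fval g := by
  simp only [IsCut, fracLtOne_iff, fracLe_iff, fracLt_iff]
  constructor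
  · rintro ⟨h1, h2, h3⟩
    refine ⟨h1, fun f g hf hg h => h2 f g hf ⟨hg, (h1 f hf).1, h⟩, fun f hf => ?_⟩
    obtain ⟨g, hg, h⟩ := h3 f hf
    exact ⟨g, hg, h.2.2⟩
  · rintro ⟨h1, h2, h3⟩
    refine ⟨h1, fun f g hf h => h2 f g hf h.1 h.2.2, fun f hf => ?_⟩
    obtain ⟨g, hg, h⟩ := h3 f hf
    exact ⟨g, hg, (h1 f hf).1, (h1 g hg).1, h⟩

theorem IsCut.fracs {c f : M} (hc : IsCut c) (hf : f ∈ᴹ c) : f ∈ᴹ ZFTych.fracs M :=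
  ((isCut_iff.1 hc).1 f hf).1

theorem IsCut.lt_one {c f : M} (hc : IsCut c) (hf : f ∈ᴹ c) : fval f < 1 :=
  ((isCut_iff.1 hc).1 f hf).2

theorem IsCut.down {c f g : M} (hc : IsCut c) (hf : f ∈ᴹ c) (hg : g ∈ᴹ ZFTych.fracs M)
    (h : fval g ≤ fval f) : g ∈ᴹ c :=
  (isCut_iff.1 hc).2.1 f g hf hg h

theorem IsCut.exists_gt {c f : M} (hc : IsCut c) (hf : f ∈ᴹ c) :
    ∃ g, g ∈ᴹ c ∧ fval f < fval g :=
  (isCut_iff.1 hc).2.2 f hf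

theorem IsCut.lt_of_not_mem {c f g : M} (hc : IsCut c) (hf : f ∈ᴹ c) (hg : g ∈ᴹ ZFTych.fracs M)
    (h : ¬ g ∈ᴹ c) : fval f < fval g := by
  by_contra h'
  exact h (hc.down hf hg (not_lt.1 h'))

theorem isCut_emp : IsCut (emp M) :=
  isCut_iff.2 ⟨fun _ h => (not_mem_emp h).elim, fun _ _ h => (not_mem_emp h).elim,
    fun _ h => (not_mem_emp h).elim⟩

/-- The cut of a fraction. -/
noncomputable def cutOf (g : M) : M := sep (fracs M) (fun f => FracLt f g)

theorem mem_cutOf {f g : M} (hg : g ∈ᴹ fracs M) :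
    f ∈ᴹ cutOf g ↔ f ∈ᴹ fracs M ∧ fval f < fval g := by
  rw [cutOf, mem_sep, fracLt_iff]
  tauto

theorem isCut_cutOf {g : M} (hg : g ∈ᴹ fracs M) (h1 : fval g ≤ 1) : IsCut (cutOf g) := by
  refine isCut_iff.2 ⟨fun f hf => ?_, fun f k hf hk h => ?_, fun f hf => ?_⟩
  · rw [mem_cutOf hg] at hf
    exact ⟨hf.1, hf.2.trans_le h1⟩
  · rw [mem_cutOf hg] at hf ⊢
    exact ⟨hk, h.trans_lt hf.2⟩
  · rw [mem_cutOf hg] at hf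
    obtain ⟨y, h1, h2⟩ := NRat.exists_between hf.2
    obtain ⟨k, hk, rfl⟩ := exists_fval y
    exact ⟨k, (mem_cutOf hg).2 ⟨hk, h2⟩, h1⟩

variable (M) in
/-- The cut `1`. -/
noncomputable def one : M := sep (fracs M) FracLtOne

theorem mem_one {f : M} : f ∈ᴹ one M ↔ f ∈ᴹ fracs M ∧ fval f < 1 := by
  rw [one, mem_sep, fracLtOne_iff]
  tauto

theorem isOne_iff {c : M} : IsOne c ↔ c = one M := by
  have : ∀ f : M, f ∈ᴹ one M ↔ FracLtOne f := fun f => by rw [mem_one, fracLtOne_iff]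
  exact ⟨fun h => mem_ext fun f => by rw [h f, this], fun h f => by rw [h, this]⟩

theorem isCut_one : IsCut (one M) := by
  obtain ⟨o, ho, h1⟩ := exists_fval (1 : NRat M)
  rw [show one M = cutOf o from mem_ext fun f => by rw [mem_one, mem_cutOf ho, h1]]
  exact isCut_cutOf ho h1.le

variable (M) in
/-- The fraction `0 / 1`. -/
noncomputable def zf : M := Fr.code ⟨0, 1, zero_lt_one⟩

@[simp] theorem zf_mem : zf M ∈ᴹ fracs M := code_mem _

@[simp] theorem fval_zf : fval (zf M) = 0 := fval_code _

theorem zf_mem_one : zf M ∈ᴹ one M := mem_one.2 ⟨zf_mem, by rw [fval_zf]; exact NRat.zero_lt_one⟩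

theorem IsCut.zf_mem {c f : M} (hc : IsCut c) (hf : f ∈ᴹ c) : zf M ∈ᴹ c :=
  hc.down hf ZFTych.zf_mem (by rw [fval_zf]; exact NRat.zero_le _)

/-- `a ⊕ b`. -/
noncomputable def oplus (a b : M) : M :=
  sep (fracs M) (fun f => FracLtOne f ∧
    (f ∈ᴹ a ∨ f ∈ᴹ b ∨ ∃ x y s, x ∈ᴹ a ∧ y ∈ᴹ b ∧ FracAdd x y s ∧ FracLe f s))

/-- `a ⊙ b`. -/
noncomputable def odot (a b : M) : M :=
  sep (fracs M) (fun f => ∃ x y s o t, x ∈ᴹ a ∧ y ∈ᴹ b ∧ FracAdd x y s ∧ IsFracOne o ∧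
    FracAdd f o t ∧ FracLe t s)

section

variable {E : Type u} [Ctx M E] (f g : E → M) [DefMap M f] [DefMap M g]

instance defMap_oplus : DefMap M (fun e => oplus (f e) (g e)) :=
  .subst₂ f g (by unfold oplus; infer_instance)

instance defMap_odot : DefMap M (fun e => odot (f e) (g e)) :=
  .subst₂ f g (by unfold odot; infer_instance)

end


theorem isOplus_iff {a b c : M} : IsOplus c a b ↔ c = oplus a b := by
  have : IsOplus (oplus a b) a b := fun f => by
    rw [oplus, mem_sep]
    exact ⟨fun h => h.2, fun h => ⟨(fracLtOne_iff.1 h.1).1, h⟩⟩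
  exact ⟨fun h => mem_ext fun f => by rw [h f, this f], fun h => h ▸ this⟩

theorem isOdot_iff {a b c : M} : IsOdot c a b ↔ c = odot a b := by
  have : IsOdot (odot a b) a b := fun f => by
    rw [odot, mem_sep]
    refine ⟨fun h => h.2, fun h => ⟨?_, h⟩⟩
    obtain ⟨x, y, s, o, t, -, -, -, -, h, -⟩ := h
    exact (fracAdd_spec h).1
  exact ⟨fun h => mem_ext fun f => by rw [h f, this f], fun h => h ▸ this⟩

theorem mem_oplus {a b f : M} (ha : IsCut a) (hb : IsCut b) : f ∈ᴹ oplus a b ↔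
    f ∈ᴹ fracs M ∧ fval f < 1 ∧
      (f ∈ᴹ a ∨ f ∈ᴹ b ∨ ∃ x y, x ∈ᴹ a ∧ y ∈ᴹ b ∧ fval f ≤ fval x + fval y) := by
  rw [isOplus_iff.2 rfl f, fracLtOne_iff, and_assoc]
  refine and_congr_right fun hf => and_congr_right fun _ => or_congr_right <| or_congr_right ?_
  constructor
  · rintro ⟨x, y, s, hx, hy, hs, h⟩
    exact ⟨x, y, hx, hy, (fracAdd_spec hs).2.2.2 ▸ (fracLe_iff.1 h).2.2⟩
  · rintro ⟨x, y, hx, hy, h⟩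
    obtain ⟨s, hs, hs', e⟩ := exists_fracAdd (ha.fracs hx) (hb.fracs hy)
    exact ⟨x, y, s, hx, hy, hs, fracLe_iff.2 ⟨hf, hs', e ▸ h⟩⟩

theorem mem_odot {a b f : M} (ha : IsCut a) (hb : IsCut b) : f ∈ᴹ odot a b ↔
    f ∈ᴹ fracs M ∧ ∃ x y, x ∈ᴹ a ∧ y ∈ᴹ b ∧ fval f + 1 ≤ fval x + fval y := by
  rw [isOdot_iff.2 rfl f]
  constructor
  · rintro ⟨x, y, s, o, t, hx, hy, hs, ho, ht, h⟩
    refine ⟨(fracAdd_spec ht).1, x, y, hx, hy, ?_⟩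
    rw [← (fracAdd_spec hs).2.2.2, ← (isFracOne_spec ho).2, ← (fracAdd_spec ht).2.2.2]
    exact (fracLe_iff.1 h).2.2
  · rintro ⟨hf, x, y, hx, hy, h⟩
    obtain ⟨s, hs, hs', e⟩ := exists_fracAdd (ha.fracs hx) (hb.fracs hy)
    obtain ⟨o, ho⟩ := exists_isFracOne M
    obtain ⟨t, ht, ht', e'⟩ := exists_fracAdd hf (isFracOne_spec ho).1
    refine ⟨x, y, s, o, t, hx, hy, hs, ho, ht, fracLe_iff.2 ⟨ht', hs', ?_⟩⟩
    rwa [e, e', (isFracOne_spec ho).2]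

theorem isCut_oplus {a b : M} (ha : IsCut a) (hb : IsCut b) : IsCut (oplus a b) := by
  refine isCut_iff.2 ⟨fun f hf => ?_, fun f g hf hg h => ?_, fun f hf => ?_⟩
  · rw [mem_oplus ha hb] at hf
    exact ⟨hf.1, hf.2.1⟩
  · rw [mem_oplus ha hb] at hf ⊢
    refine ⟨hg, h.trans_lt hf.2.1, ?_⟩
    rcases hf.2.2 with h1 | h1 | ⟨x, y, hx, hy, h1⟩
    · exact .inl (ha.down h1 hg h)
    · exact .inr (.inl (hb.down h1 hg h))
    · exact .inr (.inr ⟨x, y, hx, hy, h.trans h1⟩)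
  · rw [mem_oplus ha hb] at hf
    rcases hf.2.2 with h1 | h1 | ⟨x, y, hx, hy, h1⟩
    · obtain ⟨g, hg, h⟩ := ha.exists_gt h1
      exact ⟨g, (mem_oplus ha hb).2 ⟨ha.fracs hg, ha.lt_one hg, .inl hg⟩, h⟩
    · obtain ⟨g, hg, h⟩ := hb.exists_gt h1
      exact ⟨g, (mem_oplus ha hb).2 ⟨hb.fracs hg, hb.lt_one hg, .inr (.inl hg)⟩, h⟩
    · obtain ⟨x', hx', h⟩ := ha.exists_gt hx
      have h2 : fval f < fval x' + fval y := by grind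
      obtain ⟨z, hz, hz'⟩ := NRat.exists_between (lt_min h2 hf.2.1)
      obtain ⟨g, hg, rfl⟩ := exists_fval z
      rw [lt_min_iff] at hz'
      exact ⟨g, (mem_oplus ha hb).2 ⟨hg, hz'.2, .inr (.inr ⟨x', y, hx', hy, hz'.1.le⟩)⟩, hz⟩

theorem isCut_odot {a b : M} (ha : IsCut a) (hb : IsCut b) : IsCut (odot a b) := by
  refine isCut_iff.2 ⟨fun f hf => ?_, fun f g hf hg h => ?_, fun f hf => ?_⟩
  · obtain ⟨h, x, y, hx, hy, h1⟩ := (mem_odot ha hb).1 hf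
    have := ha.lt_one hx
    have := hb.lt_one hy
    exact ⟨h, by grind⟩
  · obtain ⟨_, x, y, hx, hy, h1⟩ := (mem_odot ha hb).1 hf
    exact (mem_odot ha hb).2 ⟨hg, x, y, hx, hy, by grind⟩
  · obtain ⟨_, x, y, hx, hy, h1⟩ := (mem_odot ha hb).1 hf
    obtain ⟨x', hx', h⟩ := ha.exists_gt hx
    obtain ⟨d, hd⟩ := NRat.exists_add_of_le h1
    obtain ⟨e, he⟩ := NRat.exists_add_of_le h.le
    have he0 : 0 < e := by grind
    have hd0 := NRat.zero_le d
    obtain ⟨g, hg, hg'⟩ := exists_fval (fval f + d + e)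
    exact ⟨g, (mem_odot ha hb).2 ⟨hg, x', y, hx', hy, by grind⟩, by grind⟩

theorem mem_oplus_left {a b f : M} (ha : IsCut a) (hb : IsCut b) (hf : f ∈ᴹ a) : f ∈ᴹ oplus a b :=
  (mem_oplus ha hb).2 ⟨ha.fracs hf, ha.lt_one hf, .inl hf⟩

theorem mem_oplus_right {a b f : M} (ha : IsCut a) (hb : IsCut b) (hf : f ∈ᴹ b) :
    f ∈ᴹ oplus a b :=
  (mem_oplus ha hb).2 ⟨hb.fracs hf, hb.lt_one hf, .inr (.inl hf)⟩

/-- `⊕` takes the value `1` as soon as the summands have elements of sum at least `1`. -/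
theorem oplus_eq_one {a b x y : M} (ha : IsCut a) (hb : IsCut b) (hx : x ∈ᴹ a) (hy : y ∈ᴹ b)
    (h : 1 ≤ fval x + fval y) : oplus a b = one M := by
  refine mem_ext fun f => ?_
  rw [mem_oplus ha hb, mem_one]
  refine and_congr_right fun _ => ⟨fun h => h.1, fun h1 => ⟨h1, .inr (.inr ⟨x, y, hx, hy, ?_⟩)⟩⟩
  exact h1.le.trans h

theorem zf_not_mem_oplus {a b : M} (ha : IsCut a) (hb : IsCut b) (h : ¬ zf M ∈ᴹ a)
    (h' : ¬ zf M ∈ᴹ b) : ¬ zf M ∈ᴹ oplus a b := by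
  rw [mem_oplus ha hb]
  rintro ⟨-, -, h1 | h1 | ⟨x, y, hx, -, -⟩⟩
  exacts [h h1, h' h1, h (ha.zf_mem hx)]

theorem odot_one_one : odot (one M) (one M) = one M := by
  refine mem_ext fun f => ?_
  rw [mem_odot isCut_one isCut_one, mem_one]
  refine and_congr_right fun hf => ⟨?_, fun h => ?_⟩
  · rintro ⟨x, y, hx, hy, h⟩
    have := isCut_one.lt_one hx
    have := isCut_one.lt_one hy
    grind
  · obtain ⟨d, hd⟩ := NRat.exists_add_of_le h.le
    obtain ⟨e, rfl⟩ := NRat.exists_half d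
    have he : 0 < e := by grind
    obtain ⟨x, hx, hx'⟩ := exists_fval (fval f + e)
    have : x ∈ᴹ one M := mem_one.2 ⟨hx, by grind⟩
    exact ⟨x, x, this, this, by grind⟩

variable (M) in
theorem exists_half_frac : ∃ r, r ∈ᴹ one M ∧ fval r + fval r = 1 := by
  obtain ⟨y, hy⟩ := NRat.exists_half (1 : NRat M)
  obtain ⟨r, hr, rfl⟩ := exists_fval y
  have := NRat.zero_lt_one (M := M)
  exact ⟨r, mem_one.2 ⟨hr, by grind⟩, hy⟩

/-- The cut of a truncated difference exists as a set. -/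
theorem exists_truncSub (c e : M) : ∃ d, IsTruncSub d c e := by
  refine ⟨sep (fracs M) (fun f => ∃ g s, ¬ g ∈ᴹ e ∧ FracAdd f g s ∧ s ∈ᴹ c), fun f => ?_⟩
  rw [mem_sep]
  refine ⟨fun h => h.2, fun h => ⟨?_, h⟩⟩
  obtain ⟨g, s, -, h, -⟩ := h
  exact (fracAdd_spec h).1

theorem isTruncSub_iff {c d e f : M} (hc : IsCut c) (h : IsTruncSub d c e) : f ∈ᴹ d ↔
    f ∈ᴹ fracs M ∧ ∃ g, g ∈ᴹ fracs M ∧ ¬ g ∈ᴹ e ∧ ∃ s, s ∈ᴹ c ∧ fval s = fval f + fval g := by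
  rw [h f]
  constructor
  · rintro ⟨g, s, hg, hs, hsc⟩
    have := fracAdd_spec hs
    exact ⟨this.1, g, this.2.1, hg, s, hsc, this.2.2.2⟩
  · rintro ⟨hf, g, hg, hge, s, hs, e⟩
    obtain ⟨t, ht, ht', e'⟩ := exists_fracAdd hf hg
    exact ⟨g, t, hge, ht, hc.down hs ht' (by rw [e, e'])⟩

/-! ### Fuzzy sets -/

variable (M) in
/-- The set of all cuts. -/
noncomputable def cuts : M := sep (pow (fracs M)) IsCut

theorem mem_cuts {c : M} : c ∈ᴹ cuts M ↔ IsCut c := by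
  rw [cuts, mem_sep, mem_pow]
  exact ⟨fun h => h.2, fun h => ⟨fun _ hf => h.fracs hf, h⟩⟩

theorem isFuzzy_iff {α X : M} :
    IsFuzzy α X ↔ IsFam α X ∧ ∀ x, x ∈ᴹ X → IsCut (ap α x) := by
  refine and_congr_right fun h => ⟨fun h' x hx => h' x _ (app_ap h hx), fun h' x a hxa => ?_⟩
  have hx := app_dom h hxa
  exact (app_eq h hx).1 hxa ▸ h' x hx

theorem IsFuzzy.cut {α X x : M} (h : IsFuzzy α X) (hx : x ∈ᴹ X) : IsCut (ap α x) :=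
  (isFuzzy_iff.1 h).2 x hx

theorem isFuzzy_lam {X : M} {f : M → M} [DefMap M f] (h : ∀ x, x ∈ᴹ X → IsCut (f x)) :
    IsFuzzy (lam X f) X :=
  isFuzzy_iff.2 ⟨isFam_lam, fun x hx => by rw [ap_lam hx]; exact h x hx⟩

/-- The set of all fuzzy subsets of `X`. -/
noncomputable def fuz (X : M) : M := sep (famBound X (cuts M)) (fun α => IsFuzzy α X)

theorem mem_fuz {α X : M} : α ∈ᴹ fuz X ↔ IsFuzzy α X := by
  rw [fuz, mem_sep]
  exact ⟨fun h => h.2, fun h => ⟨mem_famBound h.1 fun i hi => mem_cuts.2 (h.cut hi), h⟩⟩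

theorem isConst_iff {α c X : M} :
    IsConst α c X ↔ IsFuzzy α X ∧ ∀ x, x ∈ᴹ X → ap α x = c :=
  and_congr_right fun h => forall₂_congr fun _ hx => app_eq h.1 hx

theorem isConst_lam {c X : M} (hc : IsCut c) : IsConst (lam X fun _ => c) c X :=
  isConst_iff.2 ⟨isFuzzy_lam fun _ _ => hc, fun _ hx => ap_lam hx⟩

theorem isPointwise_iff {op : M → M → M → Prop} {γ α β X : M} (hα : IsFuzzy α X)
    (hβ : IsFuzzy β X) : IsPointwise op γ α β X ↔
      IsFuzzy γ X ∧ ∀ x, x ∈ᴹ X → op (ap γ x) (ap α x) (ap β x) := by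
  refine and_congr_right fun hγ => forall₂_congr fun x hx => ?_
  simp [app_eq hα.1 hx, app_eq hβ.1 hx, app_eq hγ.1 hx]

theorem isJoin_iff {γ Γ X : M} (hΓ : ∀ α, α ∈ᴹ Γ → IsFuzzy α X) : IsJoin γ Γ X ↔
    IsFuzzy γ X ∧ ∀ x, x ∈ᴹ X → ∀ f, f ∈ᴹ ap γ x ↔ ∃ α, α ∈ᴹ Γ ∧ f ∈ᴹ ap α x := by
  refine and_congr_right fun hγ => forall₂_congr fun x hx => ?_
  simp only [app_eq hγ.1 hx, exists_eq_left']
  refine forall_congr' fun f => iff_congr Iff.rfl <| exists_congr fun α => ?_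
  constructor
  · rintro ⟨a, h, h1, h2⟩
    exact ⟨h, (app_eq (hΓ α h).1 hx).1 h1 ▸ h2⟩
  · rintro ⟨h, h2⟩
    exact ⟨_, h, app_ap (hΓ α h).1 hx, h2⟩

theorem constLeJoin_iff {c B X : M} (hB : ∀ α, α ∈ᴹ B → IsFuzzy α X) : ConstLeJoin c B X ↔
    ∀ x, x ∈ᴹ X → ∀ f, f ∈ᴹ c → ∃ μ, μ ∈ᴹ B ∧ f ∈ᴹ ap μ x := by
  refine forall₄_congr fun x hx f _ => exists_congr fun μ => ?_
  constructor
  · rintro ⟨a, h, h1, h2⟩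
    exact ⟨h, (app_eq (hB μ h).1 hx).1 h1 ▸ h2⟩
  · rintro ⟨h, h2⟩
    exact ⟨_, h, app_ap (hB μ h).1 hx, h2⟩

theorem isPullback_iff {γ α i I Xi P : M} (hP : ∀ s, s ∈ᴹ P → IsFam s I ∧ ap s i ∈ᴹ Xi)
    (hi : i ∈ᴹ I) (hα : IsFuzzy α Xi) : IsPullback γ α i P ↔
      IsFuzzy γ P ∧ ∀ s, s ∈ᴹ P → ap γ s = ap α (ap s i) := by
  refine and_congr_right fun hγ => forall₂_congr fun s hs => ?_
  simp [app_eq (hP s hs).1 hi, app_eq hα.1 (hP s hs).2, app_eq hγ.1 hs, eq_comm]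

theorem isCovering_iff {Γ X : M} (hΓ : ∀ α, α ∈ᴹ Γ → IsFuzzy α X) : IsCovering Γ X ↔
    ∀ x, x ∈ᴹ X → ∀ f, f ∈ᴹ one M → ∃ α, α ∈ᴹ Γ ∧ f ∈ᴹ ap α x := by
  constructor
  · rintro ⟨c, u, hc, hu, hj⟩ x hx f hf
    rw [isOne_iff] at hc
    subst hc
    exact (((isJoin_iff hΓ).1 hj).2 x hx f).1 (by rwa [(isConst_iff.1 hu).2 x hx])
  · intro h
    refine ⟨one M, _, isOne_iff.2 rfl, isConst_lam isCut_one, (isJoin_iff hΓ).2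
      ⟨(isConst_lam isCut_one).1, fun x hx f => ?_⟩⟩
    rw [ap_lam hx]
    refine ⟨h x hx f, ?_⟩
    rintro ⟨α, hα, hf⟩
    have := (hΓ α hα).cut hx
    exact mem_one.2 ⟨this.fracs hf, this.lt_one hf⟩

/-! ### Choice and the Bourbaki–Witt fixed point theorem -/

/-- Choice from a definable family of non-empty sets. -/
theorem AxiomOfChoice.exists_choice (hAC : AxiomOfChoice M) (I : M) (G : M → M) [hG : DefMap M G]
    (h : ∀ i, i ∈ᴹ I → ∃ x, x ∈ᴹ G i) :
    ∃ s, IsFam s I ∧ ∀ i, i ∈ᴹ I → ap s i ∈ᴹ G i := by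
  by_cases hI : IsEmp I
  · exact ⟨lam I G, isFam_lam, fun i hi => (hI i hi).elim⟩
  · obtain ⟨P, hP, hne⟩ := hAC I (lam I G) hI isFam_lam fun i A hi hA => by
      rw [(app_lam.1 hA).2]
      exact not_isEmp_iff.2 (h i hi)
    obtain ⟨s, hs⟩ := not_isEmp_iff.1 hne
    obtain ⟨h1, h2⟩ := ((isProduct_iff isFam_lam).1 hP s).1 hs
    exact ⟨s, h1, fun i hi => by simpa only [ap_lam hi] using h2 i hi⟩

/-- `C` is a non-empty chain for inclusion. -/
def IsIncChain (C : M) : Prop :=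
  (∃ x, x ∈ᴹ C) ∧ ∀ x y, x ∈ᴹ C → y ∈ᴹ C → Incl x y ∨ Incl y x

instance {E : Type u} [Ctx M E] (f : E → M) [DefMap M f] : DefPred M (fun e => IsIncChain (f e)) :=
  .subst₁ f (by unfold IsIncChain; infer_instance)

/-- The Bourbaki–Witt theorem: an inflationary self-map of a set of sets that is closed under
unions of non-empty chains has a fixed point. -/
theorem exists_fixed_point (Z : M) (f : M → M) [hf : DefMap M f] {z : M} (hz : z ∈ᴹ Z)
    (hfZ : ∀ x, x ∈ᴹ Z → f x ∈ᴹ Z) (hinfl : ∀ x, x ∈ᴹ Z → Incl x (f x))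
    (hchain : ∀ C, Incl C Z → IsIncChain C → sU C ∈ᴹ Z) : ∃ x, x ∈ᴹ Z ∧ f x = x := by
  have hf' {E : Type u} [Ctx M E] (g : E → M) [DefMap M g] : DefMap M (fun e => f (g e)) :=
    hf.comp g
  -- The tower is the least set that contains `z` and is closed under `f` and unions of chains.
  let Adm : M → Prop := fun T => z ∈ᴹ T ∧ (∀ x, x ∈ᴹ T → f x ∈ᴹ T) ∧
    ∀ C, Incl C T → IsIncChain C → sU C ∈ᴹ T
  have hAdm : DefPred M Adm := by infer_instance
  have hAdm' {E : Type u} [Ctx M E] (g : E → M) [DefMap M g] : DefPred M (fun e => Adm (g e)) :=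
    hAdm.comp g
  have hAdmZ : Adm Z := ⟨hz, hfZ, hchain⟩
  obtain ⟨T, hT⟩ : ∃ T : M, ∀ x, x ∈ᴹ T ↔ x ∈ᴹ Z ∧ ∀ S, Adm S → x ∈ᴹ S :=
    ⟨sep Z (fun x => ∀ S, Adm S → x ∈ᴹ S), fun x => mem_sep⟩
  have hTA : Adm T := by
    refine ⟨(hT _).2 ⟨hz, fun S hS => hS.1⟩, fun x hx => ?_, fun C hC hc => ?_⟩
    · rw [hT] at hx ⊢
      exact ⟨hfZ x hx.1, fun S hS => hS.2.1 x (hx.2 S hS)⟩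
    · exact (hT _).2 ⟨hchain C (fun x hx => ((hT x).1 (hC x hx)).1) hc,
        fun S hS => hS.2.2 C (fun x hx => ((hT x).1 (hC x hx)).2 S hS) hc⟩
  have hTZ : Incl T Z := fun x hx => ((hT x).1 hx).1
  have hmin : ∀ S, Adm S → Incl T S := fun S hS x hx => ((hT x).1 hx).2 S hS
  have hzT : ∀ x, x ∈ᴹ T → Incl z x := fun x hx => by
    refine (mem_sep.1 (hmin (sep T (fun x => Incl z x)) ⟨?_, fun x hx => ?_, fun C hC hc => ?_⟩ x
      hx)).2
    · exact mem_sep.2 ⟨hTA.1, Incl.refl z⟩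
    · rw [mem_sep] at hx ⊢
      exact ⟨hTA.2.1 x hx.1, hx.2.trans (hinfl x (hTZ x hx.1))⟩
    · refine mem_sep.2 ⟨hTA.2.2 C (fun y hy => (mem_sep.1 (hC y hy)).1) hc, fun y hy => ?_⟩
      obtain ⟨c, hcC⟩ := hc.1
      exact mem_sU.2 ⟨c, hcC, (mem_sep.1 (hC c hcC)).2 y hy⟩
  let Ext : M → Prop := fun c => ∀ x, x ∈ᴹ T → Incl x c → ¬ x = c → Incl (f x) c
  have hExt : DefPred M Ext := by infer_instance
  have compare : ∀ c, c ∈ᴹ T → Ext c → ∀ x, x ∈ᴹ T → Incl x c ∨ Incl (f c) x := by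
    intro c hc he x hx
    refine (mem_sep.1 (hmin (sep T (fun x => Incl x c ∨ Incl (f c) x))
      ⟨?_, fun x hx => ?_, fun C hC hch => ?_⟩ x hx)).2
    · exact mem_sep.2 ⟨hTA.1, .inl (hzT c hc)⟩
    · rw [mem_sep] at hx ⊢
      refine ⟨hTA.2.1 x hx.1, ?_⟩
      rcases hx.2 with h | h
      · by_cases e : x = c
        · exact .inr (e ▸ Incl.refl _)
        · exact .inl (he x hx.1 h e)
      · exact .inr (h.trans (hinfl x (hTZ x hx.1)))
    · refine mem_sep.2 ⟨hTA.2.2 C (fun y hy => (mem_sep.1 (hC y hy)).1) hch, ?_⟩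
      by_cases h : ∃ y, y ∈ᴹ C ∧ Incl (f c) y
      · obtain ⟨y, hy, h⟩ := h
        exact .inr fun w hw => mem_sU.2 ⟨y, hy, h w hw⟩
      · refine .inl fun w hw => ?_
        obtain ⟨y, hy, hw⟩ := mem_sU.1 hw
        exact ((mem_sep.1 (hC y hy)).2.resolve_right fun h' => h ⟨y, hy, h'⟩) w hw
  have ext : ∀ c, c ∈ᴹ T → Ext c := by
    intro c hc
    refine (mem_sep.1 (hmin (sep T Ext) ⟨?_, fun c hc => ?_, fun C hC hch => ?_⟩ c hc)).2
    · exact mem_sep.2 ⟨hTA.1, fun x hx h hne => (hne (h.antisymm (hzT x hx))).elim⟩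
    · rw [mem_sep] at hc ⊢
      refine ⟨hTA.2.1 c hc.1, fun x hx h hne => ?_⟩
      rcases compare c hc.1 hc.2 x hx with h1 | h1
      · by_cases e : x = c
        · exact e ▸ Incl.refl _
        · exact (hc.2 x hx h1 e).trans (hinfl c (hTZ c hc.1))
      · exact (hne (h.antisymm h1)).elim
    · refine mem_sep.2 ⟨hTA.2.2 C (fun y hy => (mem_sep.1 (hC y hy)).1) hch,
        fun x hx h hne => ?_⟩
      by_cases h' : ∀ c, c ∈ᴹ C → Incl c x
      · refine (hne (h.antisymm fun w hw => ?_)).elim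
        obtain ⟨y, hy, hw⟩ := mem_sU.1 hw
        exact h' y hy w hw
      · push Not at h'
        obtain ⟨c, hcC, hcx⟩ := h'
        obtain ⟨hcT, hce⟩ := mem_sep.1 (hC c hcC)
        rcases compare c hcT hce x hx with h1 | h1
        · exact (hce x hx h1 fun e => hcx (e ▸ Incl.refl _)).trans
            fun w hw => mem_sU.2 ⟨c, hcC, hw⟩
        · exact (hcx ((hinfl c (hTZ c hcT)).trans h1)).elim
  have htop : sU T ∈ᴹ T := hTA.2.2 T (Incl.refl T) ⟨⟨z, hTA.1⟩, fun x y hx hy =>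
    (compare y hy (ext y hy) x hx).imp id fun h => (hinfl y (hTZ y hy)).trans h⟩
  refine ⟨sU T, hTZ _ htop, Incl.antisymm (fun w hw => ?_) (hinfl _ (hTZ _ htop))⟩
  exact mem_sU.2 ⟨_, hTA.2.1 _ htop, hw⟩

/-! ### Ultrafilters -/

/-- `F` is a proper filter of subsets of `X`. -/
def IsFilter (X F : M) : Prop :=
  (∀ A, A ∈ᴹ F → Incl A X) ∧ (∀ A, A ∈ᴹ F → ∃ x, x ∈ᴹ A) ∧ X ∈ᴹ F ∧
    (∀ A B, A ∈ᴹ F → Incl A B → Incl B X → B ∈ᴹ F) ∧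
    ∀ A B, A ∈ᴹ F → B ∈ᴹ F → sep A (fun x => x ∈ᴹ B) ∈ᴹ F

instance {E : Type u} [Ctx M E] (f g : E → M) [DefMap M f] [DefMap M g] :
    DefPred M (fun e => IsFilter (f e) (g e)) :=
  .subst₂ f g (by unfold IsFilter; infer_instance)

instance (X : M) : DefPred M (IsFilter X) :=
  inferInstanceAs (DefPred M fun F => IsFilter ((fun _ : M => X) F) ((fun F : M => F) F))

/-- `U` is an ultrafilter on `X`. -/
def IsUltra (X U : M) : Prop :=
  IsFilter X U ∧ ∀ A, Incl A X → A ∈ᴹ U ∨ sep X (fun x => ¬ x ∈ᴹ A) ∈ᴹ U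

/-- Every proper filter is contained in an ultrafilter. -/
theorem AxiomOfChoice.exists_ultra_of_filter (hAC : AxiomOfChoice M) {X F : M}
    (hF : IsFilter X F) : ∃ U, IsUltra X U ∧ Incl F U := by
  let Z := sep (pow (pow X)) (fun G => IsFilter X G ∧ Incl F G)
  have hZ : ∀ G, G ∈ᴹ Z ↔ IsFilter X G ∧ Incl F G := fun G => by
    rw [mem_sep, mem_pow]
    exact ⟨fun h => h.2, fun h => ⟨fun A hA => mem_pow.2 (h.1.1 A hA), h⟩⟩
  clear_value Z
  obtain ⟨s, -, hs⟩ := hAC.exists_choice Z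
    (fun G => sep Z (fun H => Incl G H ∧ (H = G → ∀ H', H' ∈ᴹ Z → Incl G H' → H' = G)))
    (fun G hG => by
      by_cases h : ∃ H, H ∈ᴹ Z ∧ Incl G H ∧ H ≠ G
      · obtain ⟨H, h1, h2, h3⟩ := h
        exact ⟨H, mem_sep.2 ⟨h1, h2, fun e => (h3 e).elim⟩⟩
      · refine ⟨G, mem_sep.2 ⟨hG, Incl.refl G, fun _ H' h1 h2 => ?_⟩⟩
        by_contra h3
        exact h ⟨H', h1, h2, h3⟩)
  simp only [mem_sep] at hs
  obtain ⟨U, hU, hfix⟩ := exists_fixed_point Z (ap s) ((hZ F).2 ⟨hF, Incl.refl F⟩)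
    (fun G hG => (hs G hG).1) (fun G hG => (hs G hG).2.1) (by
      rintro C hC ⟨⟨G, hG⟩, hch⟩
      have hC' := fun G hG => (hZ G).1 (hC G hG)
      refine (hZ _).2 ⟨⟨fun A hA => ?_, fun A hA => ?_, ?_, fun A B hA => ?_,
        fun A B hA hB => ?_⟩, fun A hA => mem_sU.2 ⟨G, hG, (hC' G hG).2 A hA⟩⟩
      · obtain ⟨G, hG, hA⟩ := mem_sU.1 hA
        exact (hC' G hG).1.1 A hA
      · obtain ⟨G, hG, hA⟩ := mem_sU.1 hA
        exact (hC' G hG).1.2.1 A hA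
      · exact mem_sU.2 ⟨G, hG, (hC' G hG).1.2.2.1⟩
      · obtain ⟨G, hG, hA⟩ := mem_sU.1 hA
        exact fun h h' => mem_sU.2 ⟨G, hG, (hC' G hG).1.2.2.2.1 A B hA h h'⟩
      · obtain ⟨G, hG, hA⟩ := mem_sU.1 hA
        obtain ⟨H, hH, hB⟩ := mem_sU.1 hB
        rcases hch G H hG hH with h | h
        · exact mem_sU.2 ⟨H, hH, (hC' H hH).1.2.2.2.2 A B (h A hA) hB⟩
        · exact mem_sU.2 ⟨G, hG, (hC' G hG).1.2.2.2.2 A B hA (h B hB)⟩)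
  -- The chosen map moves every filter that is not maximal.
  have hmax := (hs U hU).2.2 hfix
  obtain ⟨hUF, hFU⟩ := (hZ U).1 hU
  refine ⟨U, ⟨hUF, fun A hA => ?_⟩, hFU⟩
  by_cases h : ∃ D, D ∈ᴹ U ∧ ∀ x, x ∈ᴹ D → ¬ x ∈ᴹ A
  · obtain ⟨D, hD, h⟩ := h
    exact .inr (hUF.2.2.2.1 D _ hD (fun x hx => mem_sep.2 ⟨hUF.1 D hD x hx, h x hx⟩)
      fun x hx => (mem_sep.1 hx).1)
  · push Not at h
    left
    -- The filter generated by `U` and `A` is proper, hence equal to `U`.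
    let V := sep (pow X) (fun C => ∃ D, D ∈ᴹ U ∧ ∀ x, x ∈ᴹ D → x ∈ᴹ A → x ∈ᴹ C)
    have hV : ∀ C, C ∈ᴹ V ↔ Incl C X ∧ ∃ D, D ∈ᴹ U ∧ ∀ x, x ∈ᴹ D → x ∈ᴹ A → x ∈ᴹ C :=
      fun C => by rw [mem_sep, mem_pow]
    have hUV : Incl U V := fun C hC => (hV C).2 ⟨hUF.1 C hC, C, hC, fun x hx _ => hx⟩
    have hVU : V = U := by
      refine hmax V ((hZ V).2 ⟨⟨fun C hC => ((hV C).1 hC).1, fun C hC => ?_, hUV _ hUF.2.2.1,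
        fun C C' hC hCC hC' => ?_, fun C C' hC hC' => ?_⟩, hFU.trans hUV⟩) hUV
      · obtain ⟨-, D, hD, h1⟩ := (hV C).1 hC
        obtain ⟨x, hx, hxA⟩ := h D hD
        exact ⟨x, h1 x hx hxA⟩
      · obtain ⟨-, D, hD, h1⟩ := (hV C).1 hC
        exact (hV C').2 ⟨hC', D, hD, fun x hx hxA => hCC x (h1 x hx hxA)⟩
      · obtain ⟨h0, D, hD, h1⟩ := (hV C).1 hC
        obtain ⟨-, D', hD', h1'⟩ := (hV C').1 hC'
        refine (hV _).2 ⟨fun x hx => h0 x (mem_sep.1 hx).1, _, hUF.2.2.2.2 D D' hD hD',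
          fun x hx hxA => ?_⟩
        rw [mem_sep] at hx ⊢
        exact ⟨h1 x hx.1 hxA, h1' x hx.2 hxA⟩
    rw [← hVU, hV]
    exact ⟨hA, X, hUF.2.2.1, fun x _ hx => hx⟩

/-- If any finitely many of the sets `{x ∈ X | R μ x}`, `μ ∈ B`, have a common element, then some
ultrafilter contains them all. -/
theorem AxiomOfChoice.exists_ultra (hAC : AxiomOfChoice M) (X B : M) (R : M → M → Prop)
    [hR : DefPred M (fun p : M × M => R p.1 p.2)]
    (h : ∀ B', Incl B' B → IsFin B' → ∃ x, x ∈ᴹ X ∧ ∀ μ, μ ∈ᴹ B' → R μ x) :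
    ∃ U, IsUltra X U ∧ ∀ μ, μ ∈ᴹ B → sep X (R μ) ∈ᴹ U := by
  have hR' {E : Type u} [Ctx M E] (f g : E → M) [DefMap M f] [DefMap M g] :
    DefPred M (fun e => R (f e) (g e)) := DefPred.subst₂ f g hR
  have hR1 (μ : M) : DefPred M (R μ) := hR' (fun _ => μ) (fun x => x)
  let F := sep (pow X) (fun A => ∃ B', Incl B' B ∧ IsFin B' ∧
    ∀ x, x ∈ᴹ X → (∀ μ, μ ∈ᴹ B' → R μ x) → x ∈ᴹ A)
  have hF : ∀ A, A ∈ᴹ F ↔ Incl A X ∧ ∃ B', Incl B' B ∧ IsFin B' ∧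
      ∀ x, x ∈ᴹ X → (∀ μ, μ ∈ᴹ B' → R μ x) → x ∈ᴹ A := fun A => by rw [mem_sep, mem_pow]
  clear_value F
  obtain ⟨U, hU, hFU⟩ := hAC.exists_ultra_of_filter (X := X) (F := F)
    ⟨fun A hA => ((hF A).1 hA).1, fun A hA => by
      obtain ⟨-, B', h1, h2, h3⟩ := (hF A).1 hA
      obtain ⟨x, hx, h4⟩ := h B' h1 h2
      exact ⟨x, h3 x hx h4⟩,
    (hF X).2 ⟨Incl.refl X, emp M, fun _ h => (not_mem_emp h).elim, isFin_emp, fun x hx _ => hx⟩,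
    fun A C hA hAC hC => by
      obtain ⟨-, B', h1, h2, h3⟩ := (hF A).1 hA
      exact (hF C).2 ⟨hC, B', h1, h2, fun x hx h4 => hAC x (h3 x hx h4)⟩,
    fun A C hA hC => by
      obtain ⟨h0, B', h1, h2, h3⟩ := (hF A).1 hA
      obtain ⟨-, B'', h1', h2', h3'⟩ := (hF C).1 hC
      refine (hF _).2 ⟨fun x hx => h0 x (mem_sep.1 hx).1, un B' B'', fun μ hμ => ?_, h2.un h2',
        fun x hx h4 => mem_sep.2 ⟨h3 x hx fun μ hμ => h4 μ (mem_un.2 (.inl hμ)),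
          h3' x hx fun μ hμ => h4 μ (mem_un.2 (.inr hμ))⟩⟩
      exact (mem_un.1 hμ).elim (h1 μ) (h1' μ)⟩
  refine ⟨U, hU, fun μ hμ => hFU _ ((hF _).2 ⟨fun x hx => (mem_sep.1 hx).1, adj (emp M) μ,
    fun ν hν => ?_, isFin_sing μ, fun x hx h4 => mem_sep.2 ⟨hx, h4 μ (mem_adj.2 (.inr rfl))⟩⟩)⟩
  rcases mem_adj.1 hν with h | rfl
  · exact (not_mem_emp h).elim
  · exact hμ

namespace IsUltra

variable {X U : M} {P Q : M → Prop} [DefPred M P] [DefPred M Q]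

theorem mono (hU : IsUltra X U) (hP : sep X P ∈ᴹ U) (h : ∀ x, x ∈ᴹ X → P x → Q x) :
    sep X Q ∈ᴹ U :=
  hU.1.2.2.2.1 _ _ hP
    (fun x hx => mem_sep.2 ⟨(mem_sep.1 hx).1, h x (mem_sep.1 hx).1 (mem_sep.1 hx).2⟩)
    fun _ hx => (mem_sep.1 hx).1

theorem of_forall (hU : IsUltra X U) (h : ∀ x, x ∈ᴹ X → P x) : sep X P ∈ᴹ U := by
  rw [show sep X P = X from mem_ext fun x => mem_sep.trans (and_iff_left_of_imp (h x))]
  exact hU.1.2.2.1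

theorem and (hU : IsUltra X U) (hP : sep X P ∈ᴹ U) (hQ : sep X Q ∈ᴹ U) :
    sep X (fun x => P x ∧ Q x) ∈ᴹ U := by
  have := hU.1.2.2.2.2 _ _ hP hQ
  rwa [show sep (sep X P) (fun x => x ∈ᴹ sep X Q) = sep X (fun x => P x ∧ Q x) from
    mem_ext fun x => by simp only [mem_sep]; tauto] at this

theorem exists_mem (hU : IsUltra X U) (hP : sep X P ∈ᴹ U) : ∃ x, x ∈ᴹ X ∧ P x := by
  obtain ⟨x, hx⟩ := hU.1.2.1 _ hP
  exact ⟨x, mem_sep.1 hx⟩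

theorem not_of_not (hU : IsUltra X U) (hP : ¬ sep X P ∈ᴹ U) : sep X (fun x => ¬ P x) ∈ᴹ U := by
  have := (hU.2 (sep X P) fun x hx => (mem_sep.1 hx).1).resolve_left hP
  rwa [show sep X (fun x => ¬ x ∈ᴹ sep X P) = sep X (fun x => ¬ P x) from
    mem_ext fun x => by simp only [mem_sep]; tauto] at this

theorem or (hU : IsUltra X U) (h : sep X (fun x => P x ∨ Q x) ∈ᴹ U) :
    sep X P ∈ᴹ U ∨ sep X Q ∈ᴹ U := by
  by_contra! h'
  obtain ⟨x, -, ⟨h1, h2⟩, h3⟩ := hU.exists_mem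
    (hU.and (hU.and (hU.not_of_not h'.1) (hU.not_of_not h'.2)) h)
  tauto

theorem exists_of_fin (hU : IsUltra X U) {B : M} (hB : IsFin B) (R : M → M → Prop)
    [hR : DefPred M (fun p : M × M => R p.1 p.2)] (h : ∀ μ, μ ∈ᴹ B → sep X (R μ) ∈ᴹ U) :
    ∃ x, x ∈ᴹ X ∧ ∀ μ, μ ∈ᴹ B → R μ x := by
  have hR' {E : Type u} [Ctx M E] (f g : E → M) [DefMap M f] [DefMap M g] :
    DefPred M (fun e => R (f e) (g e)) := DefPred.subst₂ f g hR
  have hR1 (μ : M) : DefPred M (R μ) := hR' (fun _ => μ) (fun x => x)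
  refine hU.exists_mem (P := fun x => ∀ μ, μ ∈ᴹ B → R μ x) ?_
  refine fin_induction hB (fun B => sep X (fun x => ∀ μ, μ ∈ᴹ B → R μ x) ∈ᴹ U) ?_ ?_
  · exact hU.of_forall fun _ _ μ hμ => (not_mem_emp hμ).elim
  · intro b μ _ hμ hb
    refine hU.mono (hU.and hb (h μ hμ)) fun x _ hx ν hν => ?_
    rcases mem_adj.1 hν with h | rfl
    · exact hx.1 ν h
    · exact hx.2

end IsUltra

/-- The image in `Y` of an ultrafilter `U` on a set `P` of families, under evaluation at `i`. -/
noncomputable def evalUltra (P U i Y : M) : M :=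
  sep (pow Y) (fun A => sep P (fun s => ap s i ∈ᴹ A) ∈ᴹ U)

instance {E : Type u} [Ctx M E] (P U : M) (f g : E → M) [DefMap M f] [DefMap M g] :
    DefMap M (fun e => evalUltra P U (f e) (g e)) :=
  .subst₂ f g (by unfold evalUltra; infer_instance)

theorem mem_evalUltra {P U i Y A : M} :
    A ∈ᴹ evalUltra P U i Y ↔ Incl A Y ∧ sep P (fun s => ap s i ∈ᴹ A) ∈ᴹ U := by
  rw [evalUltra, mem_sep, mem_pow]

theorem IsUltra.sep_mem_evalUltra {P U i Y : M} (hU : IsUltra P U)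
    (h : ∀ s, s ∈ᴹ P → ap s i ∈ᴹ Y) {R Q : M → Prop} [DefPred M R] [DefPred M Q]
    (hR : sep P R ∈ᴹ U) (hRQ : ∀ s, s ∈ᴹ P → R s → Q (ap s i)) :
    sep Y Q ∈ᴹ evalUltra P U i Y :=
  mem_evalUltra.2 ⟨fun _ hx => (mem_sep.1 hx).1,
    hU.mono hR fun s hs h' => mem_sep.2 ⟨h s hs, hRQ s hs h'⟩⟩

theorem IsUltra.evalUltra {P U i Y : M} (hU : IsUltra P U) (h : ∀ s, s ∈ᴹ P → ap s i ∈ᴹ Y) :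
    IsUltra Y (evalUltra P U i Y) := by
  refine ⟨⟨fun A hA => (mem_evalUltra.1 hA).1, fun A hA => ?_,
    mem_evalUltra.2 ⟨Incl.refl Y, hU.of_forall h⟩, fun A B hA hAB hB => ?_, fun A B hA hB => ?_⟩,
    fun A hA => ?_⟩
  · obtain ⟨s, -, hs⟩ := hU.exists_mem (mem_evalUltra.1 hA).2
    exact ⟨_, hs⟩
  · exact mem_evalUltra.2 ⟨hB, hU.mono (mem_evalUltra.1 hA).2 fun s _ hs => hAB _ hs⟩
  · rw [mem_evalUltra] at hA hB ⊢
    refine ⟨fun x hx => hA.1 x (mem_sep.1 hx).1, hU.mono (hU.and hA.2 hB.2) fun s _ hs => ?_⟩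
    exact mem_sep.2 hs
  · by_cases h' : sep P (fun s => ap s i ∈ᴹ A) ∈ᴹ U
    · exact .inl (mem_evalUltra.2 ⟨hA, h'⟩)
    · exact .inr (hU.sep_mem_evalUltra h (hU.not_of_not h') fun _ _ h => h)

/-- Limits in all factors of a product are chosen simultaneously: `L i V x` stands for "`x` is a
limit in the factor `i` of the ultrafilter `V`". -/
theorem AxiomOfChoice.exists_mem_product (hAC : AxiomOfChoice M) {I X P U : M} (hX : IsFam X I)
    (hP : IsProduct P I X) (hU : IsUltra P U) (L : M → M → M → Prop)
    [hL : DefPred M (fun p : (M × M) × M => L p.1.1 p.1.2 p.2)]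
    (h : ∀ i, i ∈ᴹ I → ∀ V, IsUltra (ap X i) V → ∃ x, x ∈ᴹ ap X i ∧ L i V x) :
    ∃ s, s ∈ᴹ P ∧ ∀ i, i ∈ᴹ I → L i (evalUltra P U i (ap X i)) (ap s i) := by
  have hL' {E : Type u} [Ctx M E] (f g h : E → M) [DefMap M f] [DefMap M g] [DefMap M h] :
    DefPred M (fun e => L (f e) (g e) (h e)) := DefPred.subst₃ f g h hL
  have hL1 (i V : M) : DefPred M (L i V) := hL' (fun _ => i) (fun _ => V) (fun x => x)
  rw [isProduct_iff hX] at hP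
  obtain ⟨s, hs, hs'⟩ := hAC.exists_choice I
    (fun i => sep (ap X i) (L i (evalUltra P U i (ap X i)))) fun i hi => by
      obtain ⟨x, hx, h'⟩ := h i hi _ (hU.evalUltra fun s hs => ((hP s).1 hs).2 i hi)
      exact ⟨x, mem_sep.2 ⟨hx, h'⟩⟩
  exact ⟨s, (hP s).2 ⟨hs, fun i hi => (mem_sep.1 (hs' i hi)).1⟩,
    fun i hi => (mem_sep.1 (hs' i hi)).2⟩

/-! ### Choice implies the Tychonoff theorem -/

/-- In a compact space every ultrafilter has a limit. -/
theorem IsCompactTop.exists_limit {Y T V : M} (hT : IsCompactTop Y T) (hV : IsUltra Y V) :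
    ∃ x, x ∈ᴹ Y ∧ ∀ a, a ∈ᴹ T → sep Y (fun y => ¬ y ∈ᴹ a) ∈ᴹ V → ¬ x ∈ᴹ a := by
  by_contra! hno
  obtain ⟨S, hS, hfin, hcov⟩ := hT (sep T fun a => sep Y (fun y => ¬ y ∈ᴹ a) ∈ᴹ V)
    (fun a ha => (mem_sep.1 ha).1) fun x hx => by
      obtain ⟨a, ha, h1, h2⟩ := hno x hx
      exact ⟨a, mem_sep.2 ⟨ha, h1⟩, h2⟩
  obtain ⟨x, hx, h⟩ := hV.exists_of_fin hfin (fun a y => ¬ y ∈ᴹ a)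
    fun a ha => (mem_sep.1 (hS a ha)).2
  obtain ⟨a, ha, hxa⟩ := hcov x hx
  exact h a ha hxa

/-- The topological Tychonoff theorem. -/
theorem AxiomOfChoice.classicalTychonoff (hAC : AxiomOfChoice M) : ClassicalTychonoff M := by
  intro I X T hX hT h P O hP hO
  have hc : ∀ i, i ∈ᴹ I → IsCompactTop (ap X i) (ap T i) :=
    fun i hi => (h i _ _ hi (app_ap hX hi) (app_ap hT hi)).2
  have hPi := (isProduct_iff hX).1 hP
  intro S hSO hcov
  by_contra! hno
  obtain ⟨U, hU, hUS⟩ := hAC.exists_ultra P S (fun u s => ¬ s ∈ᴹ u) fun S' h1 h2 => by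
    have := hno S' h1 h2
    simp only [Covers] at this
    push Not at this
    exact this
  obtain ⟨s, hs, hlim⟩ := hAC.exists_mem_product hX hP hU
    (fun i V x => ∀ a, a ∈ᴹ ap T i → sep (ap X i) (fun y => ¬ y ∈ᴹ a) ∈ᴹ V → ¬ x ∈ᴹ a)
    fun i hi V hV => (hc i hi).exists_limit hV
  -- The sets that do not separate `s` from `U` form a topology.
  let O' := sep (pow P) (fun u => sep P (fun t => ¬ t ∈ᴹ u) ∈ᴹ U → ¬ s ∈ᴹ u)
  have hO' : ∀ u, u ∈ᴹ O' ↔ Incl u P ∧ (sep P (fun t => ¬ t ∈ᴹ u) ∈ᴹ U → ¬ s ∈ᴹ u) := fun u => by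
    rw [mem_sep, mem_pow]
  clear_value O'
  have hOO' : Incl O O' := by
    refine hO.2.2 O' ⟨fun u hu => ((hO' u).1 hu).1, fun e he => ?_, ?_, fun Γ u hΓ hu => ?_,
      fun a b u ha hb hu => ?_⟩ fun i Ti a u hi hTi ha hu => ?_
    · exact (hO' e).2 ⟨fun x hx => (he x hx).elim, fun _ => he s⟩
    · refine (hO' P).2 ⟨Incl.refl P, fun h => ?_⟩
      obtain ⟨t, ht, h⟩ := hU.exists_mem h
      exact (h ht).elim
    · refine (hO' u).2 ⟨fun x hx => ?_, fun h hsu => ?_⟩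
      · obtain ⟨y, hy, hxy⟩ := (hu x).1 hx
        exact ((hO' y).1 (hΓ y hy)).1 x hxy
      · obtain ⟨y, hy, hsy⟩ := (hu s).1 hsu
        exact ((hO' y).1 (hΓ y hy)).2
          (hU.mono h fun t _ ht hty => ht ((hu t).2 ⟨y, hy, hty⟩)) hsy
    · rw [hO'] at ha hb ⊢
      refine ⟨fun x hx => ha.1 x ((hu x).1 hx).1, fun h hsu => ?_⟩
      rcases hU.or (hU.mono h fun t _ ht => not_and_or.1 ((hu t).not.1 ht)) with h' | h'
      · exact ha.2 h' ((hu s).1 hsu).1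
      · exact hb.2 h' ((hu s).1 hsu).2
    · obtain rfl := (app_eq hT hi).1 hTi
      have hu' : ∀ t, t ∈ᴹ P → (t ∈ᴹ u ↔ ap t i ∈ᴹ a) := fun t ht => by
        simp [hu t, ht, app_eq ((hPi t).1 ht).1 hi]
      refine (hO' u).2 ⟨fun t ht => ((hu t).1 ht).1, fun h hsu => ?_⟩
      refine hlim i hi a ha ?_ ((hu' s hs).1 hsu)
      exact hU.sep_mem_evalUltra (fun t ht => ((hPi t).1 ht).2 i hi) h
        fun t ht h' => (hu' t ht).not.1 h'
  obtain ⟨u, hu, hsu⟩ := hcov s hs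
  exact ((hO' u).1 (hOO' u (hSO u hu))).2 (hUS u hu) hsu

/-! ### Choice implies the Tychonoff theorem for fuzzy spaces in the sense of Lowen -/

/-- The unit interval is archimedean: if `η ∈ c` is positive, some multiple `h` of `η` satisfies
`h + η ∈ c` and `h + 2 η ∉ c`. -/
theorem IsCut.exists_step {c e : M} (hc : IsCut c) (he : e ∈ᴹ c) (h0 : 0 < fval e) :
    ∃ h, h ∈ᴹ ZFTych.fracs M ∧ (∃ f, f ∈ᴹ c ∧ fval f = fval h + fval e) ∧
      ∀ f, f ∈ᴹ ZFTych.fracs M → fval f = fval h + fval e + fval e → ¬ f ∈ᴹ c := by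
  by_contra! hno
  obtain ⟨⟨b, m, hm⟩, rfl⟩ := mem_fracs.1 (hc.fracs he)
  rw [fval_code] at *
  have hb : 0 < b := by
    rw [← NRat.val_same_lt hm]
    refine lt_of_le_of_lt (le_of_eq ?_) h0
    exact NRat.val_eq.2 (by simp)
  have hmul (n : Nt M) : Fr.code ⟨n.succ * b, m, hm⟩ ∈ᴹ c := by
    refine Nt.ind (P := fun n => Fr.code ⟨n.succ * b, m, hm⟩ ∈ᴹ c)
      (fun n => pr (nmul (suc n) b.1) m.1 ∈ᴹ c) (fun _ => Iff.rfl) ?_ (fun n hn => ?_) n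
    · rwa [show (0 : Nt M).succ * b = b from by rw [Nt.succ_mul, zero_mul, zero_add]]
    · obtain ⟨f, hf, hf', hfc⟩ := hno (Fr.code ⟨n * b, m, hm⟩) (code_mem _) ⟨_, hn, by
        rw [fval_code, fval_code, NRat.val_same_add, Nt.succ_mul]⟩
      rw [fval_code, NRat.val_same_add, NRat.val_same_add] at hf'
      refine hc.down hfc (code_mem _) ?_
      rw [hf', fval_code, Nt.succ_mul, Nt.succ_mul]
  have h1 := hc.lt_one (hmul m)
  rw [fval_code, ← NRat.val_self m hm, NRat.val_same_lt, Nt.succ_mul] at h1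
  have : m * 1 ≤ m * b := mul_le_mul_of_nonneg_left (by
    obtain rfl | ⟨k, rfl⟩ := Nt.eq_zero_or_succ b
    · exact (lt_irrefl _ hb).elim
    · rw [← Nt.add_one']; exact le_add_of_nonneg_left (Nt.zero_le k)) hm.le
  rw [mul_one] at this
  exact absurd (this.trans (le_add_of_nonneg_right (Nt.zero_le b))) (not_le.2 h1)

/-- Fuzzy compactness in terms of two fractions `h < g`, which are elements of cuts, instead of
the cuts `c` and `ε`. -/
theorem isFuzzyCompact_iff {X D : M} (hD : ∀ α, α ∈ᴹ D → IsFuzzy α X) :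
    IsFuzzyCompact X D ↔ ∀ h g B, h ∈ᴹ fracs M → g ∈ᴹ fracs M → fval h < fval g → fval g < 1 →
      Incl B D → (∀ x, x ∈ᴹ X → ∃ μ, μ ∈ᴹ B ∧ g ∈ᴹ ap μ x) →
        ∃ B', Incl B' B ∧ IsFin B' ∧ ∀ x, x ∈ᴹ X → ∃ μ, μ ∈ᴹ B' ∧ h ∈ᴹ ap μ x := by
  constructor
  · intro H h g B hh hg hlt hg1 hBD hB
    have hBf : ∀ α, α ∈ᴹ B → IsFuzzy α X := fun α hα => hD α (hBD α hα)
    obtain ⟨d, hd⟩ := NRat.exists_add_of_le hlt.le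
    obtain ⟨y, rfl⟩ := NRat.exists_half d
    have hy : 0 < y := by grind
    obtain ⟨r, hr, rfl⟩ := exists_fval y
    obtain ⟨s, hs, hs'⟩ := exists_fval (fval h + fval r)
    obtain ⟨B', d, h1, h2, hd, h3⟩ := H (cutOf g) B (isCut_cutOf hg hg1.le) hBD
      ((constLeJoin_iff hBf).2 fun x hx f hf => by
        obtain ⟨μ, hμ, h'⟩ := hB x hx
        rw [mem_cutOf hg] at hf
        exact ⟨μ, hμ, ((hBf μ hμ).cut hx).down h' hf.1 hf.2.le⟩)
      (cutOf r) (isCut_cutOf hr (by have := NRat.zero_le (fval h); grind))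
      (not_isEmp_iff.2 ⟨zf M, (mem_cutOf hr).2 ⟨zf_mem, by rwa [fval_zf]⟩⟩)
    refine ⟨B', h1, h2, fun x hx =>
      (constLeJoin_iff fun α hα => hBf α (h1 α hα)).1 h3 x hx h ?_⟩
    rw [isTruncSub_iff (isCut_cutOf hg hg1.le) hd]
    refine ⟨hh, r, hr, fun h' => lt_irrefl _ ((mem_cutOf hr).1 h').2, s, ?_, hs'⟩
    exact (mem_cutOf hg).2 ⟨hs, by grind⟩
  · intro H c B hc hBD hB ε hε hne
    have hBf : ∀ α, α ∈ᴹ B → IsFuzzy α X := fun α hα => hD α (hBD α hα)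
    obtain ⟨e₀, he₀⟩ := not_isEmp_iff.1 hne
    obtain ⟨e, he, hlt⟩ := hε.exists_gt he₀
    have hpos : 0 < fval e := (NRat.zero_le _).trans_lt hlt
    obtain ⟨y, hy⟩ := NRat.exists_half (fval e)
    obtain ⟨η, hη, rfl⟩ := exists_fval y
    have hη0 : 0 < fval η := by grind
    obtain ⟨d, hd⟩ := exists_truncSub c ε
    by_cases hηc : η ∈ᴹ c
    · obtain ⟨h, hh, ⟨g, hg, hgh⟩, hno⟩ := hc.exists_step hηc hη0
      obtain ⟨B', h1, h2, h3⟩ := H h g B hh (hc.fracs hg) (by grind) (hc.lt_one hg) hBD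
        fun x hx => (constLeJoin_iff hBf).1 hB x hx g hg
      refine ⟨B', d, h1, h2, hd, (constLeJoin_iff fun α hα => hBf α (h1 α hα)).2
        fun x hx f hf => ?_⟩
      obtain ⟨μ, hμ, h'⟩ := h3 x hx
      refine ⟨μ, hμ, ((hBf μ (h1 μ hμ)).cut hx).down h' ((isTruncSub_iff hc hd).1 hf).1 ?_⟩
      obtain ⟨-, k, hk, hkε, s, hs, hsk⟩ := (isTruncSub_iff hc hd).1 hf
      have := hε.lt_of_not_mem he hk hkε
      obtain ⟨t, ht, ht'⟩ := exists_fval (fval h + fval η + fval η)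
      have := hc.lt_of_not_mem hs ht (hno t ht ht')
      grind
    · refine ⟨emp M, d, fun x hx => (not_mem_emp hx).elim, isFin_emp, hd, fun x hx f hf => ?_⟩
      obtain ⟨-, k, hk, hkε, s, hs, hsk⟩ := (isTruncSub_iff hc hd).1 hf
      have := hε.lt_of_not_mem he hk hkε
      have := hc.lt_of_not_mem hs hη hηc
      have := NRat.zero_le (fval f)
      grind

/-- In a fuzzy compact space, for fractions `h < g`, every ultrafilter has a limit. -/
theorem IsFuzzyCompact.exists_limit {Y T V h g : M} (hTf : ∀ α, α ∈ᴹ T → IsFuzzy α Y)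
    (hT : IsFuzzyCompact Y T) (hV : IsUltra Y V) (hh : h ∈ᴹ fracs M) (hg : g ∈ᴹ fracs M)
    (hlt : fval h < fval g) (hg1 : fval g < 1) :
    ∃ x, x ∈ᴹ Y ∧ ∀ α, α ∈ᴹ T → sep Y (fun y => ¬ h ∈ᴹ ap α y) ∈ᴹ V → ¬ g ∈ᴹ ap α x := by
  by_contra! hno
  obtain ⟨B, hB, hfin, hcov⟩ := (isFuzzyCompact_iff hTf).1 hT h g
    (sep T fun α => sep Y (fun y => ¬ h ∈ᴹ ap α y) ∈ᴹ V) hh hg hlt hg1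
    (fun α hα => (mem_sep.1 hα).1) fun x hx => by
      obtain ⟨α, hα, h1, h2⟩ := hno x hx
      exact ⟨α, mem_sep.2 ⟨hα, h1⟩, h2⟩
  obtain ⟨x, hx, h'⟩ := hV.exists_of_fin hfin (fun α y => ¬ h ∈ᴹ ap α y)
    fun α hα => (mem_sep.1 (hB α hα)).2
  obtain ⟨α, hα, hxα⟩ := hcov x hx
  exact h' α hα hxα

/-- The Tychonoff theorem for fuzzy spaces in the sense of Lowen. -/
theorem AxiomOfChoice.lowenTychonoff (hAC : AxiomOfChoice M) : LowenTychonoff M := by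
  intro I X T hX hT h P O hP hO
  have hc : ∀ i, i ∈ᴹ I → IsLowenTop (ap X i) (ap T i) ∧ IsFuzzyCompact (ap X i) (ap T i) :=
    fun i hi => h i _ _ hi (app_ap hX hi) (app_ap hT hi)
  have hPi := (isProduct_iff hX).1 hP
  refine (isFuzzyCompact_iff hO.1.1).2 fun h g B hh hg hlt hg1 hBO hcov => ?_
  by_contra! hno
  obtain ⟨U, hU, hUB⟩ := hAC.exists_ultra P B (fun μ s => ¬ h ∈ᴹ ap μ s) hno
  obtain ⟨s, hs, hlim⟩ := hAC.exists_mem_product hX hP hU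
    (fun i V x => ∀ α, α ∈ᴹ ap T i → sep (ap X i) (fun y => ¬ h ∈ᴹ ap α y) ∈ᴹ V → ¬ g ∈ᴹ ap α x)
    fun i hi V hV => (hc i hi).2.exists_limit (hc i hi).1.1 hV hh hg hlt hg1
  -- The fuzzy sets for which `s` is a limit of `U` form a fuzzy topology.
  let O' := sep (fuz P) (fun μ => sep P (fun t => ¬ h ∈ᴹ ap μ t) ∈ᴹ U → ¬ g ∈ᴹ ap μ s)
  have hO' : ∀ μ, μ ∈ᴹ O' ↔
      IsFuzzy μ P ∧ (sep P (fun t => ¬ h ∈ᴹ ap μ t) ∈ᴹ U → ¬ g ∈ᴹ ap μ s) := fun u => by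
    rw [mem_sep, mem_fuz]
  clear_value O'
  have hOO' : Incl O O' := by
    refine hO.2.2 O' ⟨fun μ hμ => ((hO' μ).1 hμ).1, fun c μ hc hμ => ?_, fun Γ γ hΓ hγ => ?_,
      fun α β γ hα hβ hγ => ?_⟩ fun i Ti α γ hi hTi hα hγ => ?_
    · rw [isConst_iff] at hμ
      refine (hO' μ).2 ⟨hμ.1, fun h' h'' => ?_⟩
      obtain ⟨t, ht, h'⟩ := hU.exists_mem h'
      rw [hμ.2 t ht] at h'
      rw [hμ.2 s hs] at h''
      exact h' (hc.down h'' hh hlt.le)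
    · rw [isJoin_iff fun μ hμ => ((hO' μ).1 (hΓ μ hμ)).1] at hγ
      refine (hO' γ).2 ⟨hγ.1, fun h' h'' => ?_⟩
      obtain ⟨μ, hμ, h''⟩ := (hγ.2 s hs g).1 h''
      exact ((hO' μ).1 (hΓ μ hμ)).2
        (hU.mono h' fun t ht h1 h2 => h1 ((hγ.2 t ht h).2 ⟨μ, hμ, h2⟩)) h''
    · rw [hO'] at hα hβ ⊢
      rw [isPointwise_iff hα.1 hβ.1] at hγ
      refine ⟨hγ.1, fun h' h'' => ?_⟩
      have h'' := (hγ.2 s hs g).1 h''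
      rcases hU.or (hU.mono h' fun t ht h1 => not_and_or.1 ((hγ.2 t ht h).not.1 h1)) with h1 | h1
      · exact hα.2 h1 h''.1
      · exact hβ.2 h1 h''.2
    · obtain rfl := (app_eq hT hi).1 hTi
      rw [isPullback_iff (fun t ht => ⟨((hPi t).1 ht).1, ((hPi t).1 ht).2 i hi⟩) hi
        ((hc i hi).1.1 α hα)] at hγ
      refine (hO' γ).2 ⟨hγ.1, fun h' => ?_⟩
      rw [hγ.2 s hs]
      refine hlim i hi α hα ?_
      exact hU.sep_mem_evalUltra (fun t ht => ((hPi t).1 ht).2 i hi) h'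
        fun t ht h' => by rwa [hγ.2 t ht] at h'
  obtain ⟨μ, hμ, hsμ⟩ := hcov s hs
  exact ((hO' μ).1 (hOO' μ (hBO μ hμ))).2 (hUB μ hμ) hsμ

/-! ### Choice implies the Tychonoff theorem for MV-topological spaces -/

theorem not_mem_odot_self {a p q : M} (ha : IsCut a) (hp : p ∈ᴹ fracs M) (h : ¬ p ∈ᴹ a)
    (hpq : fval p + fval p ≤ fval q + 1) : ¬ q ∈ᴹ odot a a := by
  rw [mem_odot ha ha]
  rintro ⟨-, x, y, hx, hy, h'⟩
  have := ha.lt_of_not_mem hx hp h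
  have := ha.lt_of_not_mem hy hp h
  grind

theorem not_mem_oplus_self {a p q : M} (ha : IsCut a) (hp : p ∈ᴹ fracs M) (h : ¬ p ∈ᴹ a)
    (hpq : fval p + fval p ≤ fval q) : ¬ q ∈ᴹ oplus a a := by
  have := NRat.zero_le (fval p)
  have hq : ¬ q ∈ᴹ a := fun hq => by
    have := ha.lt_of_not_mem hq hp h
    grind
  rw [mem_oplus ha ha]
  rintro ⟨-, -, h' | h' | ⟨x, y, hx, hy, h'⟩⟩
  · exact hq h'
  · exact hq h'
  · have := ha.lt_of_not_mem hx hp h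
    have := ha.lt_of_not_mem hy hp h
    grind

theorem isPointwise_oplus {X α β : M} (hα : IsFuzzy α X) (hβ : IsFuzzy β X) :
    IsPointwise IsOplus (lam X fun x => oplus (ap α x) (ap β x)) α β X :=
  (isPointwise_iff hα hβ).2 ⟨isFuzzy_lam fun _ hx => isCut_oplus (hα.cut hx) (hβ.cut hx),
    fun x hx => by rw [isOplus_iff, ap_lam hx]⟩

theorem isPointwise_odot {X α β : M} (hα : IsFuzzy α X) (hβ : IsFuzzy β X) :
    IsPointwise IsOdot (lam X fun x => odot (ap α x) (ap β x)) α β X :=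
  (isPointwise_iff hα hβ).2 ⟨isFuzzy_lam fun _ hx => isCut_odot (hα.cut hx) (hβ.cut hx),
    fun x hx => by rw [isOdot_iff, ap_lam hx]⟩

theorem IsMVTop.lam_odot {X O α : M} (hO : IsMVTop X O) (hα : α ∈ᴹ O) :
    lam X (fun x => odot (ap α x) (ap α x)) ∈ᴹ O :=
  hO.2.2.2.2.1 α α _ hα hα (isPointwise_odot (hO.1 α hα) (hO.1 α hα))

theorem IsMVTop.lam_oplus {X O α : M} (hO : IsMVTop X O) (hα : α ∈ᴹ O) :
    lam X (fun x => oplus (ap α x) (ap α x)) ∈ᴹ O :=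
  hO.2.2.2.2.2.1 α α _ hα hα (isPointwise_oplus (hO.1 α hα) (hO.1 α hα))

/-- `x` is a weak limit of the ultrafilter `V`: the open fuzzy sets that vanish on a set of `V`
are bounded away from `1` at `x`. -/
def IsWeakLimit (Y T V x : M) : Prop :=
  x ∈ᴹ Y ∧ ∃ f, f ∈ᴹ one M ∧
    ∀ α, α ∈ᴹ T → sep Y (fun y => ¬ zf M ∈ᴹ ap α y) ∈ᴹ V → ¬ f ∈ᴹ ap α x

/-- Compactness yields weak limits. -/
theorem IsCompactMV.exists_isWeakLimit {Y T V : M} (hTf : ∀ α, α ∈ᴹ T → IsFuzzy α Y)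
    (hT : IsCompactMV Y T) (hV : IsUltra Y V) : ∃ x, IsWeakLimit Y T V x := by
  let Γ := sep T fun α => sep Y (fun y => ¬ zf M ∈ᴹ ap α y) ∈ᴹ V
  have hΓ : ∀ α, α ∈ᴹ Γ ↔ α ∈ᴹ T ∧ sep Y (fun y => ¬ zf M ∈ᴹ ap α y) ∈ᴹ V := fun α => mem_sep
  clear_value Γ
  have hΓf : ∀ α, α ∈ᴹ Γ → IsFuzzy α Y := fun α hα => hTf α ((hΓ α).1 hα).1
  have hno : ¬ IsCovering Γ Y := fun hcov => by
    obtain ⟨c, u, hc, hu, hsum⟩ := hT Γ (fun α hα => ((hΓ α).1 hα).1) hcov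
    obtain rfl := isOne_iff.1 hc
    have := hsum (sep (fuz Y) fun δ => sep Y (fun y => ¬ zf M ∈ᴹ ap δ y) ∈ᴹ V)
      (fun z ζ hz hζ => by
        rw [isConst_iff] at hζ
        exact mem_sep.2 ⟨mem_fuz.2 hζ.1, hV.of_forall fun y hy => by
          rw [hζ.2 y hy]; exact hz _⟩)
      (fun δ α γ hδ hα hγ => by
        rw [mem_sep, mem_fuz] at hδ ⊢
        rw [isPointwise_iff hδ.1 (hΓf α hα)] at hγ
        refine ⟨hγ.1, hV.mono (hV.and hδ.2 ((hΓ α).1 hα).2) fun y hy h => ?_⟩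
        rw [isOplus_iff.1 (hγ.2 y hy)]
        exact zf_not_mem_oplus (hδ.1.cut hy) ((hΓf α hα).cut hy) h.1 h.2)
    obtain ⟨y, hy, h⟩ := hV.exists_mem (mem_sep.1 this).2
    rw [(isConst_iff.1 hu).2 y hy] at h
    exact h zf_mem_one
  rw [isCovering_iff hΓf] at hno
  push Not at hno
  obtain ⟨x, hx, f, hf, h⟩ := hno
  exact ⟨x, hx, f, hf, fun α hα h' => h α ((hΓ α).2 ⟨hα, h'⟩)⟩

/-- The gap `b - a ≥ 1` is doubled, so `j`, which bounds what it lacks to `m`, decreases. -/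
theorem Nt.gap_doubles {a b a' b' m j : Nt M} (hab : a < b)
    (hd : b' + (a + a) = (b + b) + a') (hj : m + a ≤ b + (j + 1)) :
    a' < b' ∧ m + a' ≤ b' + j := by
  obtain ⟨k, rfl⟩ := Nt.exists_add_of_le (Nt.le_iff.2 (Nt.succ_le hab))
  rw [← Nt.add_one'] at hd hj
  obtain rfl : b' = a' + (k + 1 + (k + 1)) :=
    add_right_cancel (b := a + a) (hd.trans (by ring))
  refine ⟨lt_add_of_pos_right _ (add_pos_of_nonneg_of_pos (add_nonneg (Nt.zero_le k) zero_le_one)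
    (add_pos_of_nonneg_of_pos (Nt.zero_le k) one_pos)), ?_⟩
  have hj : m ≤ k + 1 + (j + 1) := le_of_add_le_add_right (a := a) (hj.trans_eq (by ring))
  calc m + a' ≤ k + 1 + (j + 1) + a' := by gcongr
    _ ≤ k + 1 + (j + 1) + a' + k := le_add_of_nonneg_right (Nt.zero_le k)
    _ = a' + (k + 1 + (k + 1)) + j := by ring

section

variable {Y T V x : M}

/-- If `α x = 1`, then `α` cannot be bounded away from `1` on a set of `V`: replacing `α` by
`α ⊙ α` doubles the distance of the bound from `1`, until `α` vanishes there. -/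
theorem IsWeakLimit.not_of_eq_one (h : IsWeakLimit Y T V x) (hT : IsMVTop Y T) (hV : IsUltra Y V)
    {a m : Nt M} (hm : 0 < m) (ham : a < m) {α : M} (hα : α ∈ᴹ T) (h1 : ap α x = one M) :
    ¬ sep Y (fun y => ¬ Fr.code ⟨a, m, hm⟩ ∈ᴹ ap α y) ∈ᴹ V := by
  obtain ⟨hx, f, hf, h0⟩ := h
  have key : ∀ a α, a < m → α ∈ᴹ T → ap α x = one M →
      sep Y (fun y => ¬ Fr.code ⟨a, m, hm⟩ ∈ᴹ ap α y) ∈ᴹ V → ∃ a' α', a' < a ∧ α' ∈ᴹ T ∧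
        ap α' x = one M ∧ sep Y (fun y => ¬ Fr.code ⟨a', m, hm⟩ ∈ᴹ ap α' y) ∈ᴹ V := by
    intro a α ham hα h1 h
    have hα' := hT.lam_odot hα
    have h1' : ap (lam Y fun y => odot (ap α y) (ap α y)) x = one M := by
      rw [ap_lam hx, h1, odot_one_one]
    rcases le_total (a + a) m with h2 | h2
    · refine (h0 _ hα' (hV.mono h fun y hy h => ?_) (h1'.symm ▸ hf)).elim
      rw [ap_lam hy]
      refine not_mem_odot_self ((hT.1 α hα).cut hy) (code_mem _) h ?_
      rw [fval_code, fval_zf, zero_add, NRat.val_same_add, ← NRat.val_self m hm]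
      exact (NRat.val_same_le hm).2 h2
    · obtain ⟨a', ha'⟩ := Nt.exists_add_of_le h2
      refine ⟨a', _, ?_, hα', h1', hV.mono h fun y hy h => ?_⟩
      · by_contra! h3
        exact absurd ha' (add_lt_add_of_lt_of_le ham h3).ne
      · rw [ap_lam hy]
        refine not_mem_odot_self ((hT.1 α hα).cut hy) (code_mem _) h ?_
        rw [fval_code, fval_code, NRat.val_same_add, ← NRat.val_self m hm, NRat.val_same_add, ha',
          add_comm]
  refine Nt.ind (P := fun n => ∀ a, a ≤ n → a < m → ∀ α, α ∈ᴹ T → ap α x = one M →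
      ¬ sep Y (fun y => ¬ Fr.code ⟨a, m, hm⟩ ∈ᴹ ap α y) ∈ᴹ V)
    (fun n => ∀ a, a ∈ᴹ omega M → a ∈ᴹ n ∨ a = n → a ∈ᴹ m.1 → ∀ α, α ∈ᴹ T → ap α x = one M →
      ¬ sep Y (fun y => ¬ pr a m.1 ∈ᴹ ap α y) ∈ᴹ V)
    (fun n => ⟨fun h a ha hn => h ⟨a, ha⟩ (hn.imp id fun h => h), fun h a hn => h a.1 a.2 hn⟩)
    ?_ ?_ a a le_rfl ham α hα h1
  · intro a ha ham α hα h1 h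
    obtain ⟨a', α', ha', -⟩ := key a α ham hα h1 h
    exact Nt.not_lt_zero _ (ha'.trans_le ha)
  · intro n ih a ha ham α hα h1 h
    obtain ⟨a', α', ha', hα', h1', h'⟩ := key a α ham hα h1 h
    exact ih a' (Nt.lt_succ_iff.1 (ha'.trans_le ha)) (ha'.trans ham) α' hα' h1' h'

/-- A weak limit is a limit: if `α x` exceeds a bound of `α` on a set of `V`, then replacing `α`
by `α ⊕ α` or `α ⊙ α` doubles the gap between the value and the bound, until `α x = 1`. -/
theorem IsWeakLimit.isLimit (h : IsWeakLimit Y T V x) (hT : IsMVTop Y T) (hV : IsUltra Y V)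
    {α p : M} (hα : α ∈ᴹ T) (hp : p ∈ᴹ fracs M) (hpV : sep Y (fun y => ¬ p ∈ᴹ ap α y) ∈ᴹ V) :
    ¬ p ∈ᴹ ap α x := by
  intro hpx
  have hx := h.1
  obtain ⟨q, hq, hpq⟩ := ((hT.1 α hα).cut hx).exists_gt hpx
  obtain ⟨a, b, m, hm, ha, hb⟩ := NRat.exists_common (fval p) (fval q)
  suffices H : ∀ j a b α, α ∈ᴹ T → a < b → m + a ≤ b + j → Fr.code ⟨b, m, hm⟩ ∈ᴹ ap α x →
      ¬ sep Y (fun y => ¬ Fr.code ⟨a, m, hm⟩ ∈ᴹ ap α y) ∈ᴹ V by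
    refine H (m + a) a b α hα ?_ (le_add_of_nonneg_left (Nt.zero_le b)) ?_ ?_
    · rwa [ha, hb, NRat.val_same_lt] at hpq
    · exact ((hT.1 α hα).cut hx).down hq (code_mem _) (by rw [hb, fval_code])
    · refine hV.mono hpV fun y hy h h' => h (((hT.1 α hα).cut hy).down h' hp ?_)
      rw [ha, fval_code]
  have key : ∀ a b α, α ∈ᴹ T → a < b → Fr.code ⟨b, m, hm⟩ ∈ᴹ ap α x →
      sep Y (fun y => ¬ Fr.code ⟨a, m, hm⟩ ∈ᴹ ap α y) ∈ᴹ V → b < m ∧ ∃ a' b' α', α' ∈ᴹ T ∧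
        b' + (a + a) = (b + b) + a' ∧ Fr.code ⟨b', m, hm⟩ ∈ᴹ ap α' x ∧
        sep Y (fun y => ¬ Fr.code ⟨a', m, hm⟩ ∈ᴹ ap α' y) ∈ᴹ V := by
    intro a b α hα hab hb ha
    have hcut : ∀ y, y ∈ᴹ Y → IsCut (ap α y) := fun y hy => (hT.1 α hα).cut hy
    have hbm : b < m := by
      have := (hcut x hx).lt_one hb
      rwa [fval_code, ← NRat.val_self m hm, NRat.val_same_lt] at this
    refine ⟨hbm, ?_⟩
    rcases le_or_gt m (a + a) with h2 | h2
    · obtain ⟨a', ha'⟩ := Nt.exists_add_of_le h2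
      obtain ⟨b', hb'⟩ := Nt.exists_add_of_le (h2.trans (add_le_add hab.le hab.le))
      refine ⟨a', b', _, hT.lam_odot hα, by rw [ha', hb']; ring, ?_, hV.mono ha fun y hy h => ?_⟩
      · rw [ap_lam hx, mem_odot (hcut x hx) (hcut x hx)]
        refine ⟨code_mem _, _, _, hb, hb, ?_⟩
        rw [fval_code, fval_code, NRat.val_same_add, ← NRat.val_self m hm, NRat.val_same_add, hb',
          add_comm]
      · rw [ap_lam hy]
        refine not_mem_odot_self (hcut y hy) (code_mem _) h ?_
        rw [fval_code, fval_code, NRat.val_same_add, ← NRat.val_self m hm, NRat.val_same_add, ha',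
          add_comm]
    · have ha' : sep Y (fun y => ¬ Fr.code ⟨a + a, m, hm⟩ ∈ᴹ
          ap (lam Y fun y => oplus (ap α y) (ap α y)) y) ∈ᴹ V := hV.mono ha fun y hy h => by
        rw [ap_lam hy]
        refine not_mem_oplus_self (hcut y hy) (code_mem _) h ?_
        rw [fval_code, fval_code, NRat.val_same_add]
      rcases lt_or_ge (b + b) m with h3 | h3
      · refine ⟨a + a, b + b, _, hT.lam_oplus hα, rfl, ?_, ha'⟩
        rw [ap_lam hx, mem_oplus (hcut x hx) (hcut x hx)]
        refine ⟨code_mem _, ?_, .inr (.inr ⟨_, _, hb, hb, ?_⟩)⟩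
        · rwa [fval_code, ← NRat.val_self m hm, NRat.val_same_lt]
        · rw [fval_code, fval_code, NRat.val_same_add]
      · refine (h.not_of_eq_one hT hV hm h2 (hT.lam_oplus hα) ?_ ha').elim
        rw [ap_lam hx]
        refine oplus_eq_one (hcut x hx) (hcut x hx) hb hb ?_
        rw [fval_code, NRat.val_same_add, ← NRat.val_self m hm]
        exact (NRat.val_same_le hm).2 h3
  intro j
  refine Nt.ind (P := fun j => ∀ a b α, α ∈ᴹ T → a < b → m + a ≤ b + j →
      Fr.code ⟨b, m, hm⟩ ∈ᴹ ap α x → ¬ sep Y (fun y => ¬ Fr.code ⟨a, m, hm⟩ ∈ᴹ ap α y) ∈ᴹ V)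
    (fun j => ∀ a b α, a ∈ᴹ omega M → b ∈ᴹ omega M → α ∈ᴹ T → a ∈ᴹ b →
      nadd m.1 a ∈ᴹ nadd b j ∨ nadd m.1 a = nadd b j → pr b m.1 ∈ᴹ ap α x →
      ¬ sep Y (fun y => ¬ pr a m.1 ∈ᴹ ap α y) ∈ᴹ V)
    (fun n => ⟨fun h a b α ha hb => h ⟨a, ha⟩ ⟨b, hb⟩ α, fun h a b α => h a.1 b.1 α a.2 b.2⟩)
    ?_ ?_ j
  · intro a b α hα hab hj hb ha
    obtain ⟨hbm, -⟩ := key a b α hα hab hb ha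
    rw [add_zero] at hj
    exact absurd (hj.trans_lt hbm) (not_lt.2 (le_add_of_nonneg_right (Nt.zero_le a)))
  · intro j ih a b α hα hab hj hb ha
    obtain ⟨hbm, a', b', α', hα', hd, hb', ha'⟩ := key a b α hα hab hb ha
    rw [← Nt.add_one'] at hj
    obtain ⟨h1, h2⟩ := Nt.gap_doubles hab hd hj
    exact ih a' b' α' hα' h1 h2 hb' ha'

/-- In a compact MV-topological space every ultrafilter has a limit. -/
theorem IsCompactMV.exists_limit (hT : IsMVTop Y T) (hc : IsCompactMV Y T) (hV : IsUltra Y V) :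
    ∃ x, x ∈ᴹ Y ∧ ∀ α, α ∈ᴹ T → ∀ p, p ∈ᴹ fracs M →
      sep Y (fun y => ¬ p ∈ᴹ ap α y) ∈ᴹ V → ¬ p ∈ᴹ ap α x := by
  obtain ⟨x, hx⟩ := hc.exists_isWeakLimit hT.1 hV
  exact ⟨x, hx.1, fun α hα p hp h => hx.isLimit hT hV hα hp h⟩

end

instance {E : Type u} [Ctx M E] (f g h : E → M) [DefMap M f] [DefMap M g] [DefMap M h] :
    DefPred M (fun e => IsFiniteSum (f e) (g e) (h e)) :=
  .subst₃ f g h (by unfold IsFiniteSum IsPointwise; infer_instance)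

theorem IsFiniteSum.lam_oplus {σ α Γ X : M} (h : IsFiniteSum σ Γ X) (hσ : IsFuzzy σ X)
    (hα : α ∈ᴹ Γ) (hαf : IsFuzzy α X) :
    IsFiniteSum (lam X fun x => oplus (ap σ x) (ap α x)) Γ X :=
  fun D h0 hD => hD σ α _ (h D h0 hD) hα (isPointwise_oplus hσ hαf)

theorem oplus_one_left {a : M} (ha : IsCut a) : oplus (one M) a = one M := by
  refine mem_ext fun f => ⟨fun hf => ?_, fun hf => mem_oplus_left isCut_one ha hf⟩
  have := isCut_oplus isCut_one ha
  exact mem_one.2 ⟨this.fracs hf, this.lt_one hf⟩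

/-- For finitely many elements of `Γ`, some finite sum is `1` wherever one of them exceeds a
fraction `r ≥ 1 / 2`. -/
theorem exists_isFiniteSum {Γ X B r : M} (hΓ : ∀ α, α ∈ᴹ Γ → IsFuzzy α X) (hB : IsFin B)
    (hBΓ : Incl B Γ) (hr : 1 ≤ fval r + fval r) : ∃ σ, IsFiniteSum σ Γ X ∧ IsFuzzy σ X ∧
      ∀ x, x ∈ᴹ X → (∃ α, α ∈ᴹ B ∧ r ∈ᴹ ap α x) → ap σ x = one M := by
  refine fin_induction hB (fun B => ∃ σ, IsFiniteSum σ Γ X ∧ IsFuzzy σ X ∧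
      ∀ x, x ∈ᴹ X → (∃ α, α ∈ᴹ B ∧ r ∈ᴹ ap α x) → ap σ x = one M) ?_ ?_
  · refine ⟨lam X fun _ => emp M, fun D h0 _ => h0 _ _ isEmp_emp (isConst_lam isCut_emp),
      isFuzzy_lam fun _ _ => isCut_emp, ?_⟩
    rintro x - ⟨α, hα, -⟩
    exact (not_mem_emp hα).elim
  · rintro b α - hα ⟨σ, hσ, hσf, h⟩
    have hα := hBΓ α hα
    have hαf := hΓ α hα
    -- The new summand is added twice.
    have h1 := hσ.lam_oplus hσf hα hαf
    have h1f := (isPointwise_oplus hσf hαf).1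
    refine ⟨_, h1.lam_oplus h1f hα hαf, (isPointwise_oplus h1f hαf).1, ?_⟩
    rintro x hx ⟨β, hβ, hr'⟩
    have hcα := hαf.cut hx
    have hcσ := hσf.cut hx
    rw [ap_lam hx, ap_lam hx]
    rcases mem_adj.1 hβ with hβ | rfl
    · rw [h x hx ⟨β, hβ, hr'⟩, oplus_one_left hcα, oplus_one_left hcα]
    · exact oplus_eq_one (isCut_oplus hcσ hcα) hcα (mem_oplus_right hcσ hcα hr') hr' hr

/-- The Tychonoff theorem for MV-topological spaces. -/
theorem AxiomOfChoice.mvTychonoff (hAC : AxiomOfChoice M) : MVTychonoff M := by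
  intro I X T hX hT h P O hP hO
  have hc : ∀ i, i ∈ᴹ I → IsMVTop (ap X i) (ap T i) ∧ IsCompactMV (ap X i) (ap T i) :=
    fun i hi => h i _ _ hi (app_ap hX hi) (app_ap hT hi)
  have hPi := (isProduct_iff hX).1 hP
  intro Γ hΓO hcov
  by_contra hno
  have hΓf : ∀ α, α ∈ᴹ Γ → IsFuzzy α P := fun α hα => hO.1.1 α (hΓO α hα)
  obtain ⟨r, hr, hr1⟩ := exists_half_frac M
  obtain ⟨U, hU, hUΓ⟩ := hAC.exists_ultra P Γ (fun α s => ¬ r ∈ᴹ ap α s) fun B hB hfin => by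
    by_contra! h'
    obtain ⟨σ, h1, h2, h3⟩ := exists_isFiniteSum hΓf hfin hB hr1.ge
    exact hno ⟨one M, σ, isOne_iff.2 rfl, isConst_iff.2 ⟨h2, fun x hx => h3 x hx (h' x hx)⟩, h1⟩
  obtain ⟨s, hs, hlim⟩ := hAC.exists_mem_product hX hP hU
    (fun i V x => ∀ α, α ∈ᴹ ap T i → ∀ p, p ∈ᴹ fracs M →
      sep (ap X i) (fun y => ¬ p ∈ᴹ ap α y) ∈ᴹ V → ¬ p ∈ᴹ ap α x)
    fun i hi V hV => (hc i hi).2.exists_limit (hc i hi).1 hV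
  -- The fuzzy sets for which `s` is a limit of `U` form an MV-topology.
  let O' := sep (fuz P) (fun μ => ∀ p, p ∈ᴹ fracs M →
    sep P (fun t => ¬ p ∈ᴹ ap μ t) ∈ᴹ U → ¬ p ∈ᴹ ap μ s)
  have hO' : ∀ μ, μ ∈ᴹ O' ↔ IsFuzzy μ P ∧ ∀ p, p ∈ᴹ fracs M →
      sep P (fun t => ¬ p ∈ᴹ ap μ t) ∈ᴹ U → ¬ p ∈ᴹ ap μ s := fun u => by rw [mem_sep, mem_fuz]
  have hmem : ∀ μ, μ ∈ᴹ O' → ∀ p, p ∈ᴹ ap μ s → sep P (fun t => p ∈ᴹ ap μ t) ∈ᴹ U := by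
    intro μ hμ p hp
    rw [hO'] at hμ
    by_contra h'
    exact hμ.2 p ((hμ.1.cut hs).fracs hp) (hU.not_of_not h') hp
  clear_value O'
  have hOO' : Incl O O' := by
    refine hO.2.2 O' ⟨fun μ hμ => ((hO' μ).1 hμ).1, fun z μ hz hμ => ?_, fun c μ hc hμ => ?_,
      fun Δ γ hΔ hγ => ?_, fun α β γ hα hβ hγ => ?_, fun α β γ hα hβ hγ => ?_,
      fun α β γ hα hβ hγ => ?_⟩ fun i Ti α γ hi hTi hα hγ => ?_
    · rw [isConst_iff] at hμ
      refine (hO' μ).2 ⟨hμ.1, fun p _ _ => ?_⟩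
      rw [hμ.2 s hs]
      exact hz p
    · rw [isConst_iff] at hμ
      refine (hO' μ).2 ⟨hμ.1, fun p _ hp => ?_⟩
      obtain ⟨t, ht, hp⟩ := hU.exists_mem hp
      rwa [hμ.2 s hs, ← hμ.2 t ht]
    · rw [isJoin_iff fun μ hμ => ((hO' μ).1 (hΔ μ hμ)).1] at hγ
      refine (hO' γ).2 ⟨hγ.1, fun p hp h' h'' => ?_⟩
      obtain ⟨μ, hμ, h''⟩ := (hγ.2 s hs p).1 h''
      exact ((hO' μ).1 (hΔ μ hμ)).2 p hp
        (hU.mono h' fun t ht h1 h2 => h1 ((hγ.2 t ht p).2 ⟨μ, hμ, h2⟩)) h''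
    · have hα' := ((hO' α).1 hα).1
      have hβ' := ((hO' β).1 hβ).1
      rw [isPointwise_iff hα' hβ'] at hγ
      simp only [isOdot_iff] at hγ
      refine (hO' γ).2 ⟨hγ.1, fun p hp h' h'' => ?_⟩
      rw [hγ.2 s hs, mem_odot (hα'.cut hs) (hβ'.cut hs)] at h''
      obtain ⟨-, x, y, hx, hy, hxy⟩ := h''
      obtain ⟨t, ht, ⟨h1, h2⟩, h3⟩ :=
        hU.exists_mem (hU.and (hU.and (hmem α hα x hx) (hmem β hβ y hy)) h')
      rw [hγ.2 t ht, mem_odot (hα'.cut ht) (hβ'.cut ht)] at h3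
      exact h3 ⟨hp, x, y, h1, h2, hxy⟩
    · have hα' := ((hO' α).1 hα).1
      have hβ' := ((hO' β).1 hβ).1
      rw [isPointwise_iff hα' hβ'] at hγ
      simp only [isOplus_iff] at hγ
      refine (hO' γ).2 ⟨hγ.1, fun p hp h' h'' => ?_⟩
      rw [hγ.2 s hs, mem_oplus (hα'.cut hs) (hβ'.cut hs)] at h''
      obtain ⟨-, hp1, hx | hy | ⟨x, y, hx, hy, hxy⟩⟩ := h''
      · obtain ⟨t, ht, h1, h3⟩ := hU.exists_mem (hU.and (hmem α hα p hx) h')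
        rw [hγ.2 t ht] at h3
        exact h3 (mem_oplus_left (hα'.cut ht) (hβ'.cut ht) h1)
      · obtain ⟨t, ht, h1, h3⟩ := hU.exists_mem (hU.and (hmem β hβ p hy) h')
        rw [hγ.2 t ht] at h3
        exact h3 (mem_oplus_right (hα'.cut ht) (hβ'.cut ht) h1)
      · obtain ⟨t, ht, ⟨h1, h2⟩, h3⟩ :=
          hU.exists_mem (hU.and (hU.and (hmem α hα x hx) (hmem β hβ y hy)) h')
        rw [hγ.2 t ht, mem_oplus (hα'.cut ht) (hβ'.cut ht)] at h3
        exact h3 ⟨hp, hp1, .inr (.inr ⟨x, y, h1, h2, hxy⟩)⟩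
    · have hα' := ((hO' α).1 hα).1
      have hβ' := ((hO' β).1 hβ).1
      rw [isPointwise_iff hα' hβ'] at hγ
      refine (hO' γ).2 ⟨hγ.1, fun p hp h' h'' => ?_⟩
      have h'' := (hγ.2 s hs p).1 h''
      obtain ⟨t, ht, ⟨h1, h2⟩, h3⟩ :=
        hU.exists_mem (hU.and (hU.and (hmem α hα p h''.1) (hmem β hβ p h''.2)) h')
      exact h3 ((hγ.2 t ht p).2 ⟨h1, h2⟩)
    · obtain rfl := (app_eq hT hi).1 hTi
      rw [isPullback_iff (fun t ht => ⟨((hPi t).1 ht).1, ((hPi t).1 ht).2 i hi⟩) hi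
        ((hc i hi).1.1 α hα)] at hγ
      refine (hO' γ).2 ⟨hγ.1, fun p hp h' => ?_⟩
      rw [hγ.2 s hs]
      refine hlim i hi α hα p hp ?_
      exact hU.sep_mem_evalUltra (fun t ht => ((hPi t).1 ht).2 i hi) h'
        fun t ht h' => by rwa [hγ.2 t ht] at h'
  obtain ⟨α, hα, hsα⟩ := (isCovering_iff hΓf).1 hcov s hs r hr
  exact ((hO' α).1 (hOO' α (hΓO α hα))).2 r (isCut_one.fracs hr) (hUΓ α hα) hsα

/-! ### The product topologies exist -/

section

variable {E : Type u} [Ctx M E] (f g h k : E → M) [DefMap M f] [DefMap M g] [DefMap M h]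
  [DefMap M k]

instance : DefPred M (fun e => IsJoin (f e) (g e) (h e)) :=
  .subst₃ f g h (by unfold IsJoin; infer_instance)
instance : DefPred M (fun e => IsPullback (f e) (g e) (h e) (k e)) :=
  .subst₄ f g h k (by unfold IsPullback; infer_instance)
instance : DefPred M (fun e => IsTopology (f e) (g e)) :=
  .subst₂ f g (by unfold IsTopology; infer_instance)
instance : DefPred M (fun e => ContainsPreimages (f e) (g e) (h e) (k e)) :=
  .subst₄ f g h k (by unfold ContainsPreimages; infer_instance)
instance : DefPred M (fun e => ContainsPullbacks (f e) (g e) (h e) (k e)) :=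
  .subst₄ f g h k (by unfold ContainsPullbacks; infer_instance)
instance : DefPred M (fun e => IsLowenTop (f e) (g e)) :=
  .subst₂ f g (by unfold IsLowenTop IsPointwise; infer_instance)
instance : DefPred M (fun e => IsMVTop (f e) (g e)) :=
  .subst₂ f g (by unfold IsMVTop IsPointwise; infer_instance)

end

theorem exists_isProductTop (I T P : M) : ∃ O, IsProductTop O I T P := by
  let O := sep (pow P) fun u => ∀ O', IsTopology P O' → ContainsPreimages O' I T P → u ∈ᴹ O'
  have hO : ∀ u, u ∈ᴹ O ↔ Incl u P ∧
      ∀ O', IsTopology P O' → ContainsPreimages O' I T P → u ∈ᴹ O' := fun u => by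
    rw [mem_sep, mem_pow]
  clear_value O
  refine ⟨O, ⟨fun u hu => ((hO u).1 hu).1, fun e he => ?_, ?_, fun S u hS hu => ?_,
    fun a b u ha hb hu => ?_⟩, fun i Ti a u hi hTi ha hu => ?_, fun O' h1 h2 u hu => ?_⟩
  · exact (hO e).2 ⟨fun x hx => (he x hx).elim, fun O' h _ => h.2.1 e he⟩
  · exact (hO P).2 ⟨Incl.refl P, fun O' h _ => h.2.2.1⟩
  · refine (hO u).2 ⟨fun x hx => ?_,
      fun O' h h' => h.2.2.2.1 S u (fun v hv => ((hO v).1 (hS v hv)).2 O' h h') hu⟩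
    obtain ⟨v, hv, hx⟩ := (hu x).1 hx
    exact ((hO v).1 (hS v hv)).1 x hx
  · rw [hO] at ha hb ⊢
    exact ⟨fun x hx => ha.1 x ((hu x).1 hx).1,
      fun O' h h' => h.2.2.2.2 a b u (ha.2 O' h h') (hb.2 O' h h') hu⟩
  · exact (hO u).2 ⟨fun s hs => ((hu s).1 hs).1, fun O' _ h' => h' i Ti a u hi hTi ha hu⟩
  · exact ((hO u).1 hu).2 O' h1 h2

theorem exists_isProductLowen (I T P : M) : ∃ O, IsProductLowen O I T P := by
  let O := sep (fuz P) fun μ => ∀ O', IsLowenTop P O' → ContainsPullbacks O' I T P → μ ∈ᴹ O'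
  have hO : ∀ μ, μ ∈ᴹ O ↔ IsFuzzy μ P ∧
      ∀ O', IsLowenTop P O' → ContainsPullbacks O' I T P → μ ∈ᴹ O' := fun μ => by
    rw [mem_sep, mem_fuz]
  clear_value O
  have h' : ∀ O', IsLowenTop P O' → ContainsPullbacks O' I T P → Incl O O' :=
    fun O' h1 h2 u hu => ((hO u).1 hu).2 O' h1 h2
  refine ⟨O, ⟨fun μ hμ => ((hO μ).1 hμ).1, fun c α hc hα => ?_, fun Γ γ hΓ hγ => ?_,
    fun α β γ hα hβ hγ => ?_⟩, fun i Ti α γ hi hTi hα hγ => ?_, h'⟩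
  · exact (hO α).2 ⟨hα.1, fun O' h _ => h.2.1 c α hc hα⟩
  · exact (hO γ).2 ⟨hγ.1, fun O' h1 h2 => h1.2.2.1 Γ γ (hΓ.trans (h' O' h1 h2)) hγ⟩
  · exact (hO γ).2 ⟨hγ.1, fun O' h1 h2 =>
      h1.2.2.2 α β γ (h' O' h1 h2 α hα) (h' O' h1 h2 β hβ) hγ⟩
  · exact (hO γ).2 ⟨hγ.1, fun O' _ h => h i Ti α γ hi hTi hα hγ⟩

theorem exists_isProductMV (I T P : M) : ∃ O, IsProductMV O I T P := by
  let O := sep (fuz P) fun μ => ∀ O', IsMVTop P O' → ContainsPullbacks O' I T P → μ ∈ᴹ O'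
  have hO : ∀ μ, μ ∈ᴹ O ↔ IsFuzzy μ P ∧
      ∀ O', IsMVTop P O' → ContainsPullbacks O' I T P → μ ∈ᴹ O' := fun μ => by
    rw [mem_sep, mem_fuz]
  clear_value O
  have h' : ∀ O', IsMVTop P O' → ContainsPullbacks O' I T P → Incl O O' :=
    fun O' h1 h2 u hu => ((hO u).1 hu).2 O' h1 h2
  refine ⟨O, ⟨fun μ hμ => ((hO μ).1 hμ).1, fun z α hz hα => ?_, fun c α hc hα => ?_,
    fun Γ γ hΓ hγ => ?_, fun α β γ hα hβ hγ => ?_, fun α β γ hα hβ hγ => ?_,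
    fun α β γ hα hβ hγ => ?_⟩, fun i Ti α γ hi hTi hα hγ => ?_, h'⟩
  · exact (hO α).2 ⟨hα.1, fun O' h _ => h.2.1 z α hz hα⟩
  · exact (hO α).2 ⟨hα.1, fun O' h _ => h.2.2.1 c α hc hα⟩
  · exact (hO γ).2 ⟨hγ.1, fun O' h1 h2 => h1.2.2.2.1 Γ γ (hΓ.trans (h' O' h1 h2)) hγ⟩
  · exact (hO γ).2 ⟨hγ.1, fun O' h1 h2 =>
      h1.2.2.2.2.1 α β γ (h' O' h1 h2 α hα) (h' O' h1 h2 β hβ) hγ⟩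
  · exact (hO γ).2 ⟨hγ.1, fun O' h1 h2 =>
      h1.2.2.2.2.2.1 α β γ (h' O' h1 h2 α hα) (h' O' h1 h2 β hβ) hγ⟩
  · exact (hO γ).2 ⟨hγ.1, fun O' h1 h2 =>
      h1.2.2.2.2.2.2 α β γ (h' O' h1 h2 α hα) (h' O' h1 h2 β hβ) hγ⟩
  · exact (hO γ).2 ⟨hγ.1, fun O' _ h => h i Ti α γ hi hTi hα hγ⟩

/-! ### Each Tychonoff theorem implies choice -/

/-- Choice follows if, after adding a new point `w` to all members of a family of non-empty sets,
some element of the product avoids `w` in all components. -/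
theorem axiomOfChoice_of_exists (H : ∀ I F w P : M, (∀ i, i ∈ᴹ I → ∃ x, x ∈ᴹ ap F i) →
    (∀ i, i ∈ᴹ I → ¬ w ∈ᴹ ap F i) → IsProduct P I (lam I fun i => adj (ap F i) w) →
      ∃ s, s ∈ᴹ P ∧ ∀ i, i ∈ᴹ I → ¬ ap s i = w) : AxiomOfChoice M := by
  intro I F _ hF hne
  obtain ⟨w, hw⟩ := exists_not_mem (sU (img I (ap F)))
  obtain ⟨s, hs, hsw⟩ := H I F w (prod I (lam I fun i => adj (ap F i) w))
    (fun i hi => not_isEmp_iff.1 (hne i _ hi (app_ap hF hi)))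
    (fun i hi h => hw (mem_sU.2 ⟨_, mem_img.2 ⟨i, hi, rfl⟩, h⟩)) (isProduct_prod isFam_lam)
  refine ⟨prod I F, isProduct_prod hF, not_isEmp_iff.2 ⟨s, ?_⟩⟩
  rw [mem_prod isFam_lam] at hs
  rw [mem_prod hF]
  refine ⟨hs.1, fun i hi => ?_⟩
  have := hs.2 i hi
  rw [ap_lam hi, mem_adj] at this
  exact this.resolve_right (hsw i hi)

/-- Finitely many conditions, each of which forces a component to be the new point, can be avoided
simultaneously. -/
theorem exists_avoiding {I F w P B : M} (hne : ∀ i, i ∈ᴹ I → ∃ x, x ∈ᴹ ap F i)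
    (hw : ∀ i, i ∈ᴹ I → ¬ w ∈ᴹ ap F i) (hP : IsProduct P I (lam I fun i => adj (ap F i) w))
    (hB : IsFin B) (R : M → M → Prop) [hR : DefPred M (fun p : M × M => R p.1 p.2)]
    (h : ∀ μ, μ ∈ᴹ B → ∃ i, i ∈ᴹ I ∧ ∀ s, s ∈ᴹ P → R μ s → ap s i = w) :
    ∃ s, s ∈ᴹ P ∧ ∀ μ, μ ∈ᴹ B → ¬ R μ s := by
  rw [isProduct_iff isFam_lam] at hP
  suffices H : ∃ s, s ∈ᴹ P ∧ ∀ μ, μ ∈ᴹ B → ∃ i, i ∈ᴹ I ∧ (∀ s, s ∈ᴹ P → R μ s → ap s i = w) ∧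
      ¬ ap s i = w by
    obtain ⟨s, hs, H⟩ := H
    refine ⟨s, hs, fun μ hμ h' => ?_⟩
    obtain ⟨i, -, h1, h2⟩ := H μ hμ
    exact h2 (h1 s hs h')
  have hR' {E : Type u} [Ctx M E] (f g : E → M) [DefMap M f] [DefMap M g] :
    DefPred M (fun e => R (f e) (g e)) := DefPred.subst₂ f g hR
  refine fin_induction hB (fun B => ∃ s, s ∈ᴹ P ∧ ∀ μ, μ ∈ᴹ B → ∃ i, i ∈ᴹ I ∧
    (∀ s, s ∈ᴹ P → R μ s → ap s i = w) ∧ ¬ ap s i = w) ?_ ?_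
  · refine ⟨lam I fun _ => w, (hP _).2 ⟨isFam_lam, fun i hi => ?_⟩,
      fun μ hμ => (not_mem_emp hμ).elim⟩
    rw [ap_lam hi, ap_lam hi]
    exact mem_adj.2 (.inr rfl)
  · rintro b μ - hμ ⟨s, hs, hsb⟩
    obtain ⟨i, hi, h'⟩ := h μ hμ
    obtain ⟨x, hx⟩ := hne i hi
    -- The component `i` of `s` is replaced by `x`.
    let c : M → M := fun j => un (sep (ap s j) fun _ => ¬ j = i) (sep x fun _ => j = i)
    have hc : DefMap M c := by infer_instance
    have hci : c i = x := mem_ext fun z => by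
      rw [mem_un, mem_sep, mem_sep]
      tauto
    have hcj : ∀ j, j ≠ i → c j = ap s j := fun j hj => mem_ext fun z => by
      rw [mem_un, mem_sep, mem_sep]
      tauto
    clear_value c
    refine ⟨lam I c, (hP _).2 ⟨isFam_lam, fun j hj => ?_⟩, fun ν hν => ?_⟩
    · rw [ap_lam hj, ap_lam hj]
      by_cases e : j = i
      · subst e
        rw [hci]
        exact mem_adj.2 (.inl hx)
      · rw [hcj j e]
        simpa only [ap_lam hj] using ((hP s).1 hs).2 j hj
    · rcases mem_adj.1 hν with hν | rfl
      · obtain ⟨j, hj, h1, h2⟩ := hsb ν hν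
        refine ⟨j, hj, h1, ?_⟩
        rw [ap_lam hj]
        by_cases e : j = i
        · subst e
          rw [hci]
          rintro rfl
          exact hw j hj hx
        · rwa [hcj j e]
      · refine ⟨i, hi, h', ?_⟩
        rw [ap_lam hi, hci]
        rintro rfl
        exact hw i hi hx

/-- The topology on `A ∪ {w}` in which every open set that meets `A` is the whole space. -/
noncomputable def pointTop (A w : M) : M :=
  sep (pow (adj A w)) fun u => ∀ x, x ∈ᴹ A → x ∈ᴹ u → Incl (adj A w) u

instance {E : Type u} [Ctx M E] (f g : E → M) [DefMap M f] [DefMap M g] :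
    DefMap M (fun e => pointTop (f e) (g e)) :=
  .subst₂ f g (by unfold pointTop; infer_instance)

theorem mem_pointTop {A w u : M} : u ∈ᴹ pointTop A w ↔
    Incl u (adj A w) ∧ ∀ x, x ∈ᴹ A → x ∈ᴹ u → Incl (adj A w) u := by
  rw [pointTop, mem_sep, mem_pow]

theorem isTopology_pointTop (A w : M) : IsTopology (adj A w) (pointTop A w) := by
  refine ⟨fun u hu => (mem_pointTop.1 hu).1, fun e he => ?_, ?_, fun S u hS hu => ?_,
    fun a b u ha hb hu => ?_⟩
  · exact mem_pointTop.2 ⟨fun x hx => (he x hx).elim, fun x _ hx => (he x hx).elim⟩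
  · exact mem_pointTop.2 ⟨Incl.refl _, fun _ _ _ => Incl.refl _⟩
  · refine mem_pointTop.2 ⟨fun x hx => ?_, fun x hxA hx y hy => ?_⟩
    · obtain ⟨v, hv, hx⟩ := (hu x).1 hx
      exact (mem_pointTop.1 (hS v hv)).1 x hx
    · obtain ⟨v, hv, hx⟩ := (hu x).1 hx
      exact (hu y).2 ⟨v, hv, (mem_pointTop.1 (hS v hv)).2 x hxA hx y hy⟩
  · rw [mem_pointTop] at ha hb ⊢
    refine ⟨fun x hx => ha.1 x ((hu x).1 hx).1, fun x hxA hx y hy => (hu y).2 ?_⟩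
    obtain ⟨h1, h2⟩ := (hu x).1 hx
    exact ⟨ha.2 x hxA h1 y hy, hb.2 x hxA h2 y hy⟩

theorem isCompactTop_pointTop {A w x : M} (hx : x ∈ᴹ A) :
    IsCompactTop (adj A w) (pointTop A w) := by
  intro S hS hcov
  obtain ⟨u, hu, hxu⟩ := hcov x (mem_adj.2 (.inl hx))
  refine ⟨adj (emp M) u, fun v hv => ?_, isFin_sing u,
    fun y hy => ⟨u, mem_adj.2 (.inr rfl), (mem_pointTop.1 (hS u hu)).2 x hx hxu y hy⟩⟩
  rcases mem_adj.1 hv with h | rfl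
  · exact (not_mem_emp h).elim
  · exact hu

/-- The topological Tychonoff theorem implies choice. -/
theorem ClassicalTychonoff.axiomOfChoice (H : ClassicalTychonoff M) : AxiomOfChoice M := by
  refine axiomOfChoice_of_exists fun I F w P hne hw hP => ?_
  by_contra! hno
  have hPi := (isProduct_iff isFam_lam).1 hP
  obtain ⟨O, hO⟩ := exists_isProductTop I (lam I fun i => pointTop (ap F i) w) P
  have hc := H I (lam I fun i => adj (ap F i) w) (lam I fun i => pointTop (ap F i) w) isFam_lam
    isFam_lam (fun i Xi Ti hi hXi hTi => by
      obtain ⟨-, rfl⟩ := app_lam.1 hXi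
      obtain ⟨-, rfl⟩ := app_lam.1 hTi
      obtain ⟨x, hx⟩ := hne i hi
      exact ⟨isTopology_pointTop _ w, isCompactTop_pointTop hx⟩) P O hP hO
  obtain ⟨S, hS, hfin, hcov⟩ := hc (img I fun i => sep P fun s => ap s i = w)
    (fun u hu => by
      obtain ⟨i, hi, rfl⟩ := mem_img.1 hu
      refine hO.2.1 i _ (adj (emp M) w) _ hi (app_lam.2 ⟨hi, rfl⟩) (mem_pointTop.2
        ⟨fun y hy => ?_, fun x hx hxw => ?_⟩) fun s => ?_
      · exact mem_adj.2 ((mem_adj.1 hy).imp_left fun h => (not_mem_emp h).elim)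
      · rcases mem_adj.1 hxw with h | rfl
        · exact (not_mem_emp h).elim
        · exact (hw i hi hx).elim
      · rw [mem_sep]
        refine and_congr_right fun hs => ?_
        simp [app_eq ((hPi s).1 hs).1 hi, mem_adj, not_mem_emp])
    (fun s hs => by
      obtain ⟨i, hi, h⟩ := hno s hs
      exact ⟨_, mem_img.2 ⟨i, hi, rfl⟩, mem_sep.2 ⟨hs, h⟩⟩)
  obtain ⟨s, hs, h⟩ := exists_avoiding hne hw hP hfin (fun u s => s ∈ᴹ u) fun u hu => by
    obtain ⟨i, hi, rfl⟩ := mem_img.1 (hS u hu)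
    exact ⟨i, hi, fun s _ h => (mem_sep.1 h).2⟩
  obtain ⟨u, hu, hsu⟩ := hcov s hs
  exact h u hu hsu

/-- The fuzzy sets on `A ∪ {w}` that attain their minimum at every point of `A`. -/
noncomputable def pointFuz (A w : M) : M :=
  sep (fuz (adj A w)) fun α => ∀ x, x ∈ᴹ A → ∀ y, y ∈ᴹ adj A w → Incl (ap α x) (ap α y)

instance {E : Type u} [Ctx M E] (f g : E → M) [DefMap M f] [DefMap M g] :
    DefMap M (fun e => pointFuz (f e) (g e)) :=
  .subst₂ f g (by unfold pointFuz fuz famBound; infer_instance)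

theorem mem_pointFuz {A w α : M} : α ∈ᴹ pointFuz A w ↔ IsFuzzy α (adj A w) ∧
    ∀ x, x ∈ᴹ A → ∀ y, y ∈ᴹ adj A w → Incl (ap α x) (ap α y) := by
  rw [pointFuz, mem_sep, mem_fuz]

section

variable {A w : M}

theorem mem_pointFuz_of_const {c α : M} (h : IsConst α c (adj A w)) : α ∈ᴹ pointFuz A w := by
  rw [isConst_iff] at h
  refine mem_pointFuz.2 ⟨h.1, fun x hx y hy => ?_⟩
  rw [h.2 x (mem_adj.2 (.inl hx)), h.2 y hy]
  exact Incl.refl c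

theorem mem_pointFuz_of_join {Γ γ : M} (hΓ : Incl Γ (pointFuz A w)) (h : IsJoin γ Γ (adj A w)) :
    γ ∈ᴹ pointFuz A w := by
  have hΓ' := fun α hα => mem_pointFuz.1 (hΓ α hα)
  rw [isJoin_iff fun α hα => (hΓ' α hα).1] at h
  refine mem_pointFuz.2 ⟨h.1, fun x hx y hy p hp => ?_⟩
  obtain ⟨α, hα, hp⟩ := (h.2 x (mem_adj.2 (.inl hx)) p).1 hp
  exact (h.2 y hy p).2 ⟨α, hα, (hΓ' α hα).2 x hx y hy p hp⟩

theorem mem_pointFuz_of_pointwise {op : M → M → M → Prop}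
    (hop : ∀ a b c a' b' c', IsCut a → IsCut b → IsCut a' → IsCut b' → op c a b → op c' a' b' →
      Incl a a' → Incl b b' → Incl c c')
    {α β γ : M} (hα : α ∈ᴹ pointFuz A w) (hβ : β ∈ᴹ pointFuz A w)
    (h : IsPointwise op γ α β (adj A w)) : γ ∈ᴹ pointFuz A w := by
  rw [mem_pointFuz] at hα hβ
  rw [isPointwise_iff hα.1 hβ.1] at h
  refine mem_pointFuz.2 ⟨h.1, fun x hx y hy => ?_⟩
  have hx' : x ∈ᴹ adj A w := mem_adj.2 (.inl hx)
  exact hop _ _ _ _ _ _ (hα.1.cut hx') (hβ.1.cut hx') (hα.1.cut hy) (hβ.1.cut hy) (h.2 x hx')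
    (h.2 y hy) (hα.2 x hx y hy) (hβ.2 x hx y hy)

theorem isLowenTop_pointFuz (A w : M) : IsLowenTop (adj A w) (pointFuz A w) :=
  ⟨fun _ hα => (mem_pointFuz.1 hα).1, fun _ _ _ => mem_pointFuz_of_const,
    fun _ _ => mem_pointFuz_of_join, fun _ _ _ => mem_pointFuz_of_pointwise
      fun _ _ _ _ _ _ _ _ _ _ h h' hA hB f hf => (h' f).2 (((h f).1 hf).imp (hA f) (hB f))⟩

theorem isMVTop_pointFuz (A w : M) : IsMVTop (adj A w) (pointFuz A w) := by
  refine ⟨fun _ hα => (mem_pointFuz.1 hα).1, fun _ _ _ => mem_pointFuz_of_const,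
    fun _ _ _ => mem_pointFuz_of_const, fun _ _ => mem_pointFuz_of_join,
    fun _ _ _ => mem_pointFuz_of_pointwise fun a b c a' b' c' ha hb ha' hb' h h' hA hB f hf => ?_,
    fun _ _ _ => mem_pointFuz_of_pointwise fun a b c a' b' c' ha hb ha' hb' h h' hA hB f hf => ?_,
    fun _ _ _ => mem_pointFuz_of_pointwise fun _ _ _ _ _ _ _ _ _ _ h h' hA hB f hf =>
      (h' f).2 (((h f).1 hf).imp (hA f) (hB f))⟩
  · rw [isOdot_iff.1 h, mem_odot ha hb] at hf
    obtain ⟨hf, x, y, hx, hy, hxy⟩ := hf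
    rw [isOdot_iff.1 h', mem_odot ha' hb']
    exact ⟨hf, x, y, hA x hx, hB y hy, hxy⟩
  · rw [isOplus_iff.1 h, mem_oplus ha hb] at hf
    rw [isOplus_iff.1 h', mem_oplus ha' hb']
    exact hf.imp_right <| And.imp_right <| Or.imp (hA f) <| Or.imp (hB f)
      fun ⟨x, y, hx, hy, hxy⟩ => ⟨x, y, hA x hx, hB y hy, hxy⟩

theorem isFuzzyCompact_pointFuz {x : M} (hx : x ∈ᴹ A) :
    IsFuzzyCompact (adj A w) (pointFuz A w) := by
  have hx' : x ∈ᴹ adj A w := mem_adj.2 (.inl hx)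
  refine (isFuzzyCompact_iff (isLowenTop_pointFuz A w).1).2 fun h g B hh _ hlt _ hB hcov => ?_
  obtain ⟨μ, hμ, hg⟩ := hcov x hx'
  obtain ⟨hf, hμ'⟩ := mem_pointFuz.1 (hB μ hμ)
  refine ⟨adj (emp M) μ, fun ν hν => ?_, isFin_sing μ, fun y hy =>
    ⟨μ, mem_adj.2 (.inr rfl), hμ' x hx y hy h ((hf.cut hx').down hg hh hlt.le)⟩⟩
  rcases mem_adj.1 hν with h | rfl
  · exact (not_mem_emp h).elim
  · exact hμ

theorem isCompactMV_pointFuz {x : M} (hx : x ∈ᴹ A) :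
    IsCompactMV (adj A w) (pointFuz A w) := by
  have hx' : x ∈ᴹ adj A w := mem_adj.2 (.inl hx)
  intro Γ hΓ hcov
  have hΓf : ∀ α, α ∈ᴹ Γ → IsFuzzy α (adj A w) := fun α hα => (mem_pointFuz.1 (hΓ α hα)).1
  obtain ⟨r, hr, hr1⟩ := exists_half_frac M
  obtain ⟨α, hα, hrα⟩ := (isCovering_iff hΓf).1 hcov x hx' r hr
  obtain ⟨σ, h1, h2, h3⟩ := exists_isFiniteSum (r := r) hΓf (isFin_sing α) (fun ν hν => by
    rcases mem_adj.1 hν with h | rfl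
    · exact (not_mem_emp h).elim
    · exact hα) hr1.ge
  refine ⟨one M, σ, isOne_iff.2 rfl, isConst_iff.2 ⟨h2, fun y hy => h3 y hy ?_⟩, h1⟩
  exact ⟨α, mem_adj.2 (.inr rfl), (mem_pointFuz.1 (hΓ α hα)).2 x hx y hy r hrα⟩

end

/-- The cut `1` if `a = b` and `0` otherwise. -/
noncomputable def delta (a b : M) : M := sep (one M) fun _ => a = b

instance {E : Type u} [Ctx M E] (f g : E → M) [DefMap M f] [DefMap M g] :
    DefMap M (fun e => delta (f e) (g e)) :=
  .subst₂ f g (by unfold delta; infer_instance)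

theorem mem_delta {a b p : M} : p ∈ᴹ delta a b ↔ p ∈ᴹ one M ∧ a = b := mem_sep

theorem isCut_delta (a b : M) : IsCut (delta a b) := by
  by_cases h : a = b
  · rw [show delta a b = one M from mem_ext fun p => mem_delta.trans (and_iff_left h)]
    exact isCut_one
  · rw [show delta a b = emp M from
      isEmp_iff.1 fun p hp => h (mem_delta.1 hp).2]
    exact isCut_emp

/-- The characteristic function of `w` on `A ∪ {w}` belongs to `pointFuz A w`. -/
theorem lam_delta_mem_pointFuz {A w : M} (hw : ¬ w ∈ᴹ A) :
    lam (adj A w) (fun y => delta y w) ∈ᴹ pointFuz A w := by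
  refine mem_pointFuz.2 ⟨isFuzzy_lam fun y _ => isCut_delta y w, fun x hx y _ p hp => ?_⟩
  rw [ap_lam (mem_adj.2 (.inl hx)), mem_delta] at hp
  exact (hw (hp.2 ▸ hx)).elim

/-- The pullbacks to the product of the characteristic functions of the new points. -/
noncomputable def deltas (P I w : M) : M := img I fun i => lam P fun s => delta (ap s i) w

section

variable {I F w P : M}

theorem isFuzzy_of_mem_deltas {μ : M} (hμ : μ ∈ᴹ deltas P I w) : IsFuzzy μ P := by
  obtain ⟨i, -, rfl⟩ := mem_img.1 hμ
  exact isFuzzy_lam fun s _ => isCut_delta _ w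

theorem deltas_covers (h : ∀ s, s ∈ᴹ P → ∃ i, i ∈ᴹ I ∧ ap s i = w) {s p : M} (hs : s ∈ᴹ P)
    (hp : p ∈ᴹ one M) : ∃ μ, μ ∈ᴹ deltas P I w ∧ p ∈ᴹ ap μ s := by
  obtain ⟨i, hi, h⟩ := h s hs
  refine ⟨_, mem_img.2 ⟨i, hi, rfl⟩, ?_⟩
  rw [ap_lam hs]
  exact mem_delta.2 ⟨hp, h⟩

theorem deltas_subset {O : M} (hw : ∀ i, i ∈ᴹ I → ¬ w ∈ᴹ ap F i)
    (hP : IsProduct P I (lam I fun i => adj (ap F i) w))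
    (hO : ContainsPullbacks O I (lam I fun i => pointFuz (ap F i) w) P) :
    Incl (deltas P I w) O := by
  intro μ hμ
  obtain ⟨i, hi, rfl⟩ := mem_img.1 hμ
  have hPi : ∀ s, s ∈ᴹ P → IsFam s I ∧ ap s i ∈ᴹ adj (ap F i) w := fun s hs => by
    have := ((isProduct_iff isFam_lam).1 hP s).1 hs
    exact ⟨this.1, by simpa only [ap_lam hi] using this.2 i hi⟩
  have hmem := lam_delta_mem_pointFuz (hw i hi)
  refine hO i _ _ _ hi (app_lam.2 ⟨hi, rfl⟩) hmem ((isPullback_iff hPi hi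
    (mem_pointFuz.1 hmem).1).2 ⟨isFuzzy_lam fun s _ => isCut_delta _ w, fun s hs => ?_⟩)
  rw [ap_lam hs, ap_lam (hPi s hs).2]

/-- No finitely many of the fuzzy sets in `deltas P I w` have a nowhere vanishing supremum. -/
theorem deltas_avoiding {B : M} (hne : ∀ i, i ∈ᴹ I → ∃ x, x ∈ᴹ ap F i)
    (hw : ∀ i, i ∈ᴹ I → ¬ w ∈ᴹ ap F i) (hP : IsProduct P I (lam I fun i => adj (ap F i) w))
    (hB : IsFin B) (hBD : Incl B (deltas P I w)) :
    ∃ s, s ∈ᴹ P ∧ ∀ μ, μ ∈ᴹ B → ¬ zf M ∈ᴹ ap μ s := by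
  refine exists_avoiding hne hw hP hB (fun μ s => zf M ∈ᴹ ap μ s) fun μ hμ => ?_
  obtain ⟨i, hi, rfl⟩ := mem_img.1 (hBD μ hμ)
  refine ⟨i, hi, fun s hs h => ?_⟩
  rw [ap_lam hs] at h
  exact (mem_delta.1 h).2

end

/-- The Tychonoff theorem for fuzzy spaces in the sense of Lowen implies choice. -/
theorem LowenTychonoff.axiomOfChoice (H : LowenTychonoff M) : AxiomOfChoice M := by
  refine axiomOfChoice_of_exists fun I F w P hne hw hP => ?_
  by_contra! hno
  obtain ⟨O, hO⟩ := exists_isProductLowen I (lam I fun i => pointFuz (ap F i) w) P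
  have hc := H I _ _ isFam_lam isFam_lam (fun i Xi Ti hi hXi hTi => by
      obtain ⟨-, rfl⟩ := app_lam.1 hXi
      obtain ⟨-, rfl⟩ := app_lam.1 hTi
      obtain ⟨x, hx⟩ := hne i hi
      exact ⟨isLowenTop_pointFuz _ w, isFuzzyCompact_pointFuz hx⟩) P O hP hO
  obtain ⟨r, hr, hr1⟩ := exists_half_frac M
  obtain ⟨hrf, hr1'⟩ := mem_one.1 hr
  obtain ⟨B, hB, hfin, hcov⟩ := (isFuzzyCompact_iff hO.1.1).1 hc (zf M) r (deltas P I w) zf_mem hrf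
    (by rw [fval_zf]; have := NRat.zero_lt_one (M := M); grind) hr1' (deltas_subset hw hP hO.2.1)
    fun s hs => deltas_covers hno hs hr
  obtain ⟨s, hs, h⟩ := deltas_avoiding hne hw hP hfin hB
  obtain ⟨μ, hμ, hsμ⟩ := hcov s hs
  exact h μ hμ hsμ

/-- The support of a finite sum is covered by the supports of finitely many summands. -/
theorem IsFiniteSum.exists_fin {σ Γ X : M} (h : IsFiniteSum σ Γ X)
    (hΓ : ∀ α, α ∈ᴹ Γ → IsFuzzy α X) : ∃ B, Incl B Γ ∧ IsFin B ∧
      ∀ x, x ∈ᴹ X → zf M ∈ᴹ ap σ x → ∃ α, α ∈ᴹ B ∧ zf M ∈ᴹ ap α x := by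
  refine (mem_sep.1 (h (sep (fuz X) fun σ => ∃ B, Incl B Γ ∧ IsFin B ∧
    ∀ x, x ∈ᴹ X → zf M ∈ᴹ ap σ x → ∃ α, α ∈ᴹ B ∧ zf M ∈ᴹ ap α x)
    (fun z ζ hz hζ => ?_) fun δ α γ hδ hα hγ => ?_)).2
  · rw [isConst_iff] at hζ
    refine mem_sep.2 ⟨mem_fuz.2 hζ.1, emp M, fun _ h => (not_mem_emp h).elim, isFin_emp,
      fun x hx h => ?_⟩
    rw [hζ.2 x hx] at h
    exact (hz _ h).elim
  · rw [mem_sep, mem_fuz] at hδ ⊢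
    obtain ⟨hδf, B, hB, hfin, hBδ⟩ := hδ
    rw [isPointwise_iff hδf (hΓ α hα)] at hγ
    refine ⟨hγ.1, adj B α, fun β hβ => ?_, hfin.adj, fun x hx h => ?_⟩
    · rcases mem_adj.1 hβ with h | rfl
      · exact hB β h
      · exact hα
    · by_cases hxδ : zf M ∈ᴹ ap δ x
      · obtain ⟨β, hβ, h'⟩ := hBδ x hx hxδ
        exact ⟨β, mem_adj.2 (.inl hβ), h'⟩
      · refine ⟨α, mem_adj.2 (.inr rfl), ?_⟩
        by_contra hxα
        rw [isOplus_iff.1 (hγ.2 x hx)] at h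
        exact zf_not_mem_oplus (hδf.cut hx) ((hΓ α hα).cut hx) hxδ hxα h

/-- The Tychonoff theorem for MV-topological spaces implies choice. -/
theorem MVTychonoff.axiomOfChoice (H : MVTychonoff M) : AxiomOfChoice M := by
  refine axiomOfChoice_of_exists fun I F w P hne hw hP => ?_
  by_contra! hno
  obtain ⟨O, hO⟩ := exists_isProductMV I (lam I fun i => pointFuz (ap F i) w) P
  have hc := H I _ _ isFam_lam isFam_lam (fun i Xi Ti hi hXi hTi => by
      obtain ⟨-, rfl⟩ := app_lam.1 hXi
      obtain ⟨-, rfl⟩ := app_lam.1 hTi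
      obtain ⟨x, hx⟩ := hne i hi
      exact ⟨isMVTop_pointFuz _ w, isCompactMV_pointFuz hx⟩) P O hP hO
  have hΓ : ∀ μ, μ ∈ᴹ deltas P I w → IsFuzzy μ P := fun _ => isFuzzy_of_mem_deltas
  obtain ⟨c, u, hc, hu, hsum⟩ := hc (deltas P I w) (deltas_subset hw hP hO.2.1)
    ((isCovering_iff hΓ).2 fun s hs p hp => deltas_covers hno hs hp)
  obtain rfl := isOne_iff.1 hc
  obtain ⟨B, hB, hfin, hcov⟩ := hsum.exists_fin hΓ
  obtain ⟨s, hs, h⟩ := deltas_avoiding hne hw hP hfin hB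
  obtain ⟨μ, hμ, hsμ⟩ := hcov s hs ((isConst_iff.1 hu).2 s hs ▸ zf_mem_one)
  exact h μ hμ hsμ

end

end ZFTych

theorem theorem5p7 (M : Type*) [ZFTych.setLang.Structure M] (hM : ZFTych.IsZFModel M) :
    List.TFAE [ZFTych.AxiomOfChoice M, ZFTych.ClassicalTychonoff M, ZFTych.LowenTychonoff M,
      ZFTych.MVTychonoff M] := by
  have : Fact (ZFTych.IsZFModel M) := ⟨hM⟩
  tfae_have 1 → 2 := ZFTych.AxiomOfChoice.classicalTychonoff
  tfae_have 1 → 3 := ZFTych.AxiomOfChoice.lowenTychonoff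
  tfae_have 1 → 4 := ZFTych.AxiomOfChoice.mvTychonoff
  tfae_have 2 → 1 := ZFTych.ClassicalTychonoff.axiomOfChoice
  tfae_have 3 → 1 := ZFTych.LowenTychonoff.axiomOfChoice
  tfae_have 4 → 1 := ZFTych.MVTychonoff.axiomOfChoice
  tfae_finish
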